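/- **Setting.** In the restricted three-body problem with the massless particle exterior to the perturber, let $\mathcal Gm_0>0$, $a_*>0$, $a_1>0$, $e_1\in[0,1)$, $n_1\in\mathbb R$, an integer $\nu_1\ge1$, $L_*=\sqrt{\mathcal Gm_0a_*}$, $n_*=\mathcal G^2m_0^2/L_*^3$, $\eta_1=\sqrt{1-e_1^2}$, and assume that $k_*n_*+k_1n_1\neq0$ for all $(k_*,k_1)\in\mathbb Z^2\setminus\{0\}$. *Closed-form expressions* are Laurent polynomials in $\delta L,e,\eta,\iota_c=\cos i,\iota_s=\sin i,\rho=\|r_1\|,\phi_1,J_1$ times harmonics of $f,g,h,E_1$, all regarded as independent symbols. We work with formal series $\sum_k F_k\sigma^k$ in the book-keeping symbol $\sigma$ (finitely many negative powers); each $F_k$ is a formal power series in the mass parameter $\mu$ and in the multipole ratio $\|r_1\|/\|R\|$, with closed-form coefficients. $O(\sigma^k)$ means: no powers of $\sigma$ below $k$. **Hamiltonian ($\nu=1$).** Put $\mathscr Z_0=n_*\delta L+n_1J_1$, $w=1-\sigma^{\nu_1}e_1\cos E_1$, $\theta=f+g$ and $$\frac1{\|R\|}=\frac{\mathcal Gm_0}{(L_*+\sigma\delta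 L)^{2}}\,(1+\sigma e\cos f)\Big(1+\big(\tfrac1{\eta^2}-1\big)\sigma^2\Big),\qquad r_1^2:=a_1^2w^2,$$ $$\frac{r_1\cdot R}{\|R\|}=a_1\Big((\cos E_1-\sigma^{\nu_1}e_1)(\cos h\cos\theta-\iota_c\sin h\sin\theta)+(1+\sigma^{2\nu_1}(\eta_1-1))\sin E_1(\sin h\cos\theta+\iota_c\cos h\sin\theta)\Big).$$ With $\bar\mu=\sigma\mu$, $u=2\,r_1\cdot R/\|R\|^2$, $v=r_1^2/\|R\|^2$, let $$\mathcal H_1=-\frac{\mathcal Gm_0}{\|R\|}\Big(\sum_{l\ge0}\bar\mu^l+\sum_{l\ge1}\bar\mu^{l-1}\tbinom{-1/2}{l}(u+\bar\mu v)^l+\sum_{l\ge1}(1-\bar\mu)^{l-1}\tbinom{-1/2}{l}(-u+(1-\bar\mu)v)^l\Big),$$ $$\mathscr H^{(0)}=\mathscr Z_0+\frac{a_1w}{\rho}\Big(-\frac{\mathcal G^2m_0^2}{2L_*^2}\sum_{l\ge2}\tbinom{-2}{l}\Big(\frac{\delta L}{L_*}\Big)^l\sigma^{l-1}+\bar\mu\,\mathcal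 H_1\Big)=:\mathscr Z_0+\mathscr R^{(0)}_1,$$ everything being expanded in powers of $\sigma$, $\mu$ and $\|r_1\|/\|R\|$. **Poisson bracket.** $\{F,K\}=F_\ell K_{\delta L}+F_gK_G+F_hK_H+F_{M_1}K_{J_1}-F_{\delta L}K_\ell-F_GK_g-F_HK_h-F_{J_1}K_{M_1}$ with the total derivatives $F_\ell=\frac{a_1w}{\rho}\frac{\partial f}{\partial\ell}\partial_fF$, $F_g=\frac{a_1w}{\rho}\partial_gF$, $F_h=\frac{a_1w}{\rho}\partial_hF$, $F_{J_1}=\partial_{J_1}F$, $F_{M_1}=\big(\partial_{E_1}F+\sigma^{\nu_1}a_1e_1\sin E_1\,\partial_\rho F+\sigma^{-\nu_1}\partial_{\phi_1}F\big)\frac{a_1}{\rho}-\sigma^{-\nu_1}\partial_{\phi_1}F$, $F_{\delta L}=\frac{\partial f}{\partial\delta L}\partial_fF+\partial_{\delta L}F+\sigma^{-1}\frac{\partial e}{\partial\delta L}\partial_eF+\frac{\partial\eta}{\partial\delta L}\partial_\eta F$, $F_G=\frac{\partial f}{\partial G}\partial_fF+\sigma^{-1}\frac{\partial e}{\partial G}\partial_eF+\frac{\partial\eta}{\partial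 G}\partial_\eta F+\frac{\partial\iota_c}{\partial G}\partial_{\iota_c}F+\frac{\partial\iota_s}{\partial G}\partial_{\iota_s}F$, $F_H=\frac{\partial\iota_c}{\partial H}\partial_{\iota_c}F+\frac{\partial\iota_s}{\partial H}\partial_{\iota_s}F$, where, with $\Lambda=1/(L_*+\sigma\delta L)$ expanded in $\delta L$, $s(x)=1+(x-1)\sigma^2$ and $q=\frac{2\sin f}{e}\sigma^{-1}+\frac{\sin 2f}2$, $$\tfrac{\partial f}{\partial\ell}=(1+\sigma e\cos f)^2s(\eta^{-3}),\quad \tfrac{\partial f}{\partial\delta L}=\Lambda q,\quad \tfrac{\partial f}{\partial G}=-\Lambda s(\eta^{-1})q,\quad \tfrac{\partial e}{\partial\delta L}=\Lambda\big(\tfrac{\sigma^{-1}}e+\tfrac{\eta^2-1}e\sigma\big),\quad \tfrac{\partial e}{\partial G}=-\Lambda\big(\tfrac{\sigma^{-1}}e+\tfrac{\eta-1}e\sigma\big),$$ $$\tfrac{\partial\eta}{\partial\delta L}=-\Lambda s(\eta),\quad \tfrac{\partial\eta}{\partial G}=\Lambda,\quad \tfrac{\partial\iota_c}{\partial G}=-\Lambda\iota_cs(\eta^{-1}),\quad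 \tfrac{\partial\iota_s}{\partial G}=\Lambda\tfrac{1-\iota_s^2}{\iota_s}s(\eta^{-1}),\quad \tfrac{\partial\iota_c}{\partial H}=\Lambda s(\eta^{-1}),\quad \tfrac{\partial\iota_s}{\partial H}=-\Lambda\tfrac{\iota_c}{\iota_s}s(\eta^{-1}).$$ For a generating function $\chi$ put $\exp(\mathcal L_\chi)F=\sum_{n\ge0}\frac1{n!}\mathcal L_\chi^nF$, $\mathcal L_\chi=\{\cdot,\chi\}$, followed by the substitution $\phi_1=e_1\sin E_1$. **Normalization step of order $j$.** A remainder is *in closed form* if each coefficient is a finite sum of terms $\frac{a_1}{\rho^\lambda}d\cos(s_1f+s_2g+s_3h+s_4E_1)$ with $\lambda\ge1$ and $d$ a real function (Laurent polynomial) of $\delta L,e,\eta,\iota_c,\iota_s$. If $\sum_{\lambda\ge1}\frac{a_1}{\rho^{\lambda}}\big(\sum_{p}d'_{\lambda,p}\cos(p_1g+p_2h)+\sum_{(s_1,s_4)\ne(0,0)}d''_{\lambda,s}\cos(s_1f+s_2g+s_3h+s_4E_1)\big)$ is the coefficient of $\sigma^j$ in the current remainder $\mathscr R$, the step targeted to it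 has generating function and normal form term $$\chi=\frac{\phi_1}{n_1}\sigma^{j+\nu_1}\sum_{\lambda\ge1}\sum_{\psi=1}^{\lambda}\frac{1}{a_1^{\psi-1}\rho^{\lambda-\psi}}\sum_pd'_{\lambda,p}\cos(p_1g+p_2h)+\sigma^j\sum_{\lambda\ge1}\frac1{\rho^{\lambda-1}}\sum_{(s_1,s_4)\neq(0,0)}\frac{d''_{\lambda,s}\sin(s_1f+s_2g+s_3h+s_4E_1)}{s_1n_*+s_4n_1},$$ $$\mathscr Z=\sigma^j\sum_{\lambda\ge1}\frac{1}{a_1^{\lambda-1}}\sum_pd'_{\lambda,p}\cos(p_1g+p_2h),$$ and transforms the Hamiltonian by $\exp(\mathcal L_\chi)$. **Proposition.** For $\nu=1$ and every $\nu_1\ge1$, all the Lie series below converge formally (for each power of $\sigma$, $\mu$, $\|r_1\|/\|R\|$ only finitely many terms contribute), all the remainders $\mathscr R$ below are in closed form with $\mathscr R_k=O(\sigma^k)$, and all the $\mathscr Z$'s with lower index $k$ equal $\sigma^k$ times secular terms, i.e. (coefficientwise) finite sums of $\zeta(\delta L,e,\eta,\iota_c,\iota_s)\cos(p_1g+p_2h)$,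 $\zeta$ real: 1. $\mathscr H^{(0)}=\mathscr Z_0+\mathscr R^{(0)}_1$. The step of order $1$ gives $\mathscr H^{(1)}=\mathscr Z_0+\mathscr Z_1^{(1)}+\mathscr R_2^{(1)}$, and the step of order $2$ then gives $\mathscr H^{(2)}=\mathscr Z_0+\mathscr Z_1^{(1)}+\mathscr Z_2^{(2)}+\mathscr R_2^{(2)}$, with a remainder that is again only $O(\sigma^2)$. 2. One extra step of order $2$, targeted to the $\sigma^2$-terms $\mathscr R^{(2)}_{2,2}$ of $\mathscr R_2^{(2)}$, gives $$\mathscr H^{(\mathrm{II})}=\exp\big(\mathcal L_{\chi_2^{(\mathrm{II})}}\big)\mathscr H^{(2)}=\mathscr Z_0+\mathscr Z_1^{(1)}+\mathscr Z_2^{(2)}+\mathscr Z_2^{(\mathrm{II})}+\mathscr R_3^{(\mathrm{II})}.$$ 3. From there the scheme works at all orders: the step of order $3$ applied to $\mathscr H^{(\mathrm{II})}$ gives $$\mathscr H^{(3)}=\exp\big(\mathcal L_{\chi_3^{(3)}}\big)\mathscr H^{(\mathrm{II})}=\mathscr Z_0+\mathscr Z_1^{(1)}+\mathscr Z_2^{(2)}+\mathscr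 Z_2^{(\mathrm{II})}+\mathscr Z_3^{(3)}+\mathscr R_4^{(3)},$$ and for every $j\ge4$ the step of order $j$ applied to $\mathscr H^{(j-1)}$ gives $$\mathscr H^{(j)}=\exp\big(\mathcal L_{\chi_j^{(j)}}\big)\mathscr H^{(j-1)}=\mathscr Z_0+\sum_{l=1}^{j}\mathscr Z_l^{(l)}+\mathscr Z_2^{(\mathrm{II})}+\mathscr R^{(j)}_{j+1}.$$ -/

import Mathlib

noncomputable section

namespace ClosedForm

/-- The symbols of a closed-form expression. The angles are the true anomaly `f`, the argument of
pericentre `g`, the longitude of the node `h` and the eccentric anomaly `E₁` of the perturber. The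
other symbols are `δL`, the eccentricity `e`, `η`, `ιc = cos i`, `ιs = sin i`, the distance
`ρ = ‖r₁‖`, `φ₁ = E₁ - M₁` and the action `J₁`. All of them count as independent symbols. -/
inductive Sym
  | f | g | h | E₁ | δL | e | η | ιc | ιs | ρ | φ₁ | J₁
  deriving DecidableEq

/-- Closed-form expressions: Laurent polynomials in the symbols. For an angle the exponent `s`
stands for the harmonic `exp (i s ·)`, for any other symbol it is an ordinary power. -/
abbrev Expr := AddMonoidAlgebra ℂ (Sym → ℤ)

/-- The `k`-th power of a (non-angular) symbol. -/
def sym (v : Sym) (k : ℤ) : Expr := AddMonoidAlgebra.single (Pi.single v k) 1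

/-- A real constant. -/
def num (x : ℝ) : Expr := AddMonoidAlgebra.single 0 (x : ℂ)

/-- The exponent vector of the angle `s₁ f + s₂ g + s₃ h + s₄ E₁`. -/
def angle (s₁ s₂ s₃ s₄ : ℤ) : Sym → ℤ :=
  Pi.single Sym.f s₁ + Pi.single Sym.g s₂ + Pi.single Sym.h s₃ + Pi.single Sym.E₁ s₄

/-- `cos (s₁ f + s₂ g + s₃ h + s₄ E₁)`. -/
def cosA (s₁ s₂ s₃ s₄ : ℤ) : Expr :=
  AddMonoidAlgebra.single (angle s₁ s₂ s₃ s₄) (1 / 2) +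
    AddMonoidAlgebra.single (-angle s₁ s₂ s₃ s₄) (1 / 2)

/-- `sin (s₁ f + s₂ g + s₃ h + s₄ E₁)`. -/
def sinA (s₁ s₂ s₃ s₄ : ℤ) : Expr :=
  AddMonoidAlgebra.single (angle s₁ s₂ s₃ s₄) (1 / (2 * Complex.I)) -
    AddMonoidAlgebra.single (-angle s₁ s₂ s₃ s₄) (1 / (2 * Complex.I))

/-- The linear operator on closed-form expressions with prescribed values on the monomials. -/
def onMonomials (T : (Sym → ℤ) → Expr) : Expr →ₗ[ℂ] Expr :=
  Finsupp.linearCombination ℂ T ∘ₗ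
    (AddMonoidAlgebra.coeffLinearEquiv ℂ : Expr ≃ₗ[ℂ] ((Sym → ℤ) →₀ ℂ)).toLinearMap

/-- Partial derivative with respect to an angle. -/
def dAngle (v : Sym) : Expr →ₗ[ℂ] Expr :=
  onMonomials fun m => AddMonoidAlgebra.single m (Complex.I * (m v : ℂ))

/-- Partial derivative with respect to a non-angular symbol, the other symbols being fixed. -/
def dSym (v : Sym) : Expr →ₗ[ℂ] Expr :=
  onMonomials fun m => AddMonoidAlgebra.single (m - Pi.single v 1) (m v : ℂ)

/-- Formal power series in the mass parameter `μ` (variable `0`) and in a symbol `τ`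
(variable `1`) that counts the powers of `‖r₁‖ / ‖R‖` in the multipole expansion. -/
abbrev Coef := MvPowerSeries (Fin 2) Expr

/-- Formal series in the book-keeping symbol `σ`, with finitely many negative powers. -/
abbrev Ser := LaurentSeries Coef

/-- A linear operator on expressions, applied to every coefficient in `μ`, `τ`. -/
def coeffwise (D : Expr →ₗ[ℂ] Expr) : Coef →+ Coef where
  toFun F := fun n => D (MvPowerSeries.coeff n F)
  map_zero' := by
    funext n
    exact D.map_zero
  map_add' F G := by
    funext n
    exact D.map_add _ _

/-- A linear operator on expressions, applied to every coefficient in `σ`, `μ`, `τ`. -/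
def act (D : Expr →ₗ[ℂ] Expr) (F : Ser) : Ser := HahnSeries.map F (coeffwise D)

/-- A closed-form expression as a series of order `σ⁰`. -/
def cst (c : Expr) : Ser := HahnSeries.C (MvPowerSeries.C c)

/-- The power `σ ^ k`. -/
def sig (k : ℤ) : Ser := HahnSeries.single k 1

/-- The same for power series in `σ`. -/
def cstP (c : Expr) : PowerSeries Coef := PowerSeries.C (MvPowerSeries.C c)

/-- The numerical data: `GM = 𝒢 m₀`, the reference semi-major axis `aStar` of the particle, the
semi-major axis `a₁`, eccentricity `e₁` and mean motion `n₁` of the perturber, and the book-keeping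
exponent `ν₁`. -/
structure Params where
  GM : ℝ
  aStar : ℝ
  a₁ : ℝ
  e₁ : ℝ
  n₁ : ℝ
  ν₁ : ℕ

namespace Params

variable (P : Params)

/-- `L_* = √(𝒢 m₀ a_*)`. -/
def LStar : ℝ := √(P.GM * P.aStar)

/-- The mean motion `n_* = 𝒢² m₀² / L_*³` of the particle. -/
def nStar : ℝ := P.GM ^ 2 / P.LStar ^ 3

/-- `η₁ = √(1 - e₁²)`. -/
def η₁ : ℝ := √(1 - P.e₁ ^ 2)

/-! ### The Hamiltonian with book-keeping, for `ν = 1` -/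

/-- The generalized binomial coefficient `β (β - 1) ⋯ (β - l + 1) / l!`. -/
def binom (β : ℝ) (l : ℕ) : ℝ := (∏ i ∈ Finset.range l, (β - i)) / (l.factorial : ℝ)

/-- `1 / L = 1 / (L_* + σ δL)`, expanded in powers of `δL`. -/
def invLP : PowerSeries Coef :=
  PowerSeries.mk fun k =>
    MvPowerSeries.C (num ((-1) ^ k / P.LStar ^ (k + 1)) * sym Sym.δL k)

/-- `1 - σ^ν₁ e₁ cos E₁`. -/
def oneSubP : PowerSeries Coef :=
  1 - PowerSeries.X ^ P.ν₁ * cstP (num P.e₁ * cosA 0 0 0 1)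

/-- The mass parameter with its book-keeping weight, `σ μ`. -/
def muP : PowerSeries Coef := PowerSeries.X * PowerSeries.C (MvPowerSeries.X 0)

/-- `1 / ‖R‖ = (1 + σ e cos f) ((1/η² - 1) σ² + 1) / a` with `1 / a = 𝒢 m₀ / L²`. -/
def invR : PowerSeries Coef :=
  cstP (num P.GM) * P.invLP ^ 2 *
    (1 + PowerSeries.X * cstP (sym Sym.e 1 * cosA 1 0 0 0)) *
    (1 + PowerSeries.X ^ 2 * cstP (sym Sym.η (-2) - 1))

/-- `(r₁ · R) / ‖R‖`. -/
def r₁R : PowerSeries Coef :=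
  cstP (num P.a₁) *
    ((cstP (cosA 0 0 0 1) - PowerSeries.X ^ P.ν₁ * cstP (num P.e₁)) *
        cstP (cosA 0 0 1 0 * cosA 1 1 0 0 - sinA 0 0 1 0 * sinA 1 1 0 0 * sym Sym.ιc 1) +
      (1 + PowerSeries.X ^ (2 * P.ν₁) * cstP (num (P.η₁ - 1))) * cstP (sinA 0 0 0 1) *
        cstP (sinA 0 0 1 0 * cosA 1 1 0 0 + cosA 0 0 1 0 * sinA 1 1 0 0 * sym Sym.ιc 1))

/-- `(r₁ · R) / ‖R‖²`, marked by `τ`. -/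
def ratioDot : PowerSeries Coef :=
  PowerSeries.C (MvPowerSeries.X 1) * P.r₁R * P.invR

/-- `(‖r₁‖ / ‖R‖)²` with `‖r₁‖ = a₁ (1 - σ^ν₁ e₁ cos E₁)`, marked by `τ²`. -/
def ratioSq : PowerSeries Coef :=
  (PowerSeries.C (MvPowerSeries.X 1) * cstP (num P.a₁) * P.oneSubP * P.invR) ^ 2

/-- The sum `∑ l ≥ 0, T l`, for a family such that `τ ^ l` divides `T l`. -/
def tauSum (T : ℕ → PowerSeries Coef) : PowerSeries Coef :=
  PowerSeries.mk fun k => fun n =>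
    ∑ l ∈ Finset.range (n 1 + 1), MvPowerSeries.coeff n (PowerSeries.coeff k (T l))

/-- The disturbing function `ℋ₁`,
`-(𝒢 m₀ / ‖R‖) (∑_{l≥0} μ^l + ∑_{l≥1} μ^(l-1) C(-1/2, l) (2 r₁·R/‖R‖² + μ (‖r₁‖/‖R‖)²)^l
+ ∑_{l≥1} (1-μ)^(l-1) C(-1/2, l) (-2 r₁·R/‖R‖² + (1-μ) (‖r₁‖/‖R‖)²)^l)`. -/
def disturbing : PowerSeries Coef :=
  -(cstP (num P.GM) * P.invR) *
    (PowerSeries.mk (fun l => (MvPowerSeries.X 0 : Coef) ^ l) +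
      tauSum (fun l => muP ^ l * cstP (num (binom (-1 / 2) (l + 1))) *
        (2 * P.ratioDot + muP * P.ratioSq) ^ (l + 1)) +
      tauSum (fun l => (1 - muP) ^ l * cstP (num (binom (-1 / 2) (l + 1))) *
        (-2 * P.ratioDot + (1 - muP) * P.ratioSq) ^ (l + 1)))

/-- The part `-(𝒢² m₀² / (2 L_*²)) ∑_{l≥2} C(-2, l) (δL / L_*)^l σ^(l-1)` of the Keplerian
Hamiltonian that is nonlinear in `δL`. -/
def keplerP : PowerSeries Coef :=
  PowerSeries.mk fun k => if k = 0 then 0 else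
    MvPowerSeries.C (num (-(P.GM ^ 2 / (2 * P.LStar ^ 2)) * binom (-2) (k + 1) /
      P.LStar ^ (k + 1)) * sym Sym.δL (k + 1))

/-- `𝒵₀ = n_* δL + n₁ J₁`. -/
def Z₀ : Ser := cst (num P.nStar * sym Sym.δL 1) + cst (num P.n₁ * sym Sym.J₁ 1)

/-- `ℋ⁽⁰⁾ = 𝒵₀ + (ℋ - 𝒵₀) a₁ (1 - σ^ν₁ e₁ cos E₁) / ‖r₁‖`. -/
def H₀ : Ser :=
  P.Z₀ + HahnSeries.ofPowerSeries ℤ Coef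
    ((P.keplerP + muP * P.disturbing) * (cstP (num P.a₁ * sym Sym.ρ (-1)) * P.oneSubP))

/-! ### The Poisson bracket with book-keeping -/

/-- `1 / L = 1 / (L_* + σ δL)`. -/
def invL : Ser := HahnSeries.ofPowerSeries ℤ Coef P.invLP

/-- The factor `a₁ (1 - σ^ν₁ e₁ cos E₁) / ‖r₁‖`, numerically equal to `1`. -/
def unitFactor : Ser :=
  cst (num P.a₁ * sym Sym.ρ (-1)) * (1 - sig P.ν₁ * cst (num P.e₁ * cosA 0 0 0 1))

/-- The partition `1 + (x - 1) σ²` of a power `x` of `η`. -/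
def split (x : Expr) : Ser := 1 + cst (x - 1) * sig 2

/-- `∂f/∂ℓ = (1 + e cos f)² / η³`; `e` carries `σ`, and `1/η³ = 1 + (1/η³ - 1) σ²` throughout. -/
def f_ℓ : Ser :=
  (1 + cst (sym Sym.e 1 * cosA 1 0 0 0) * sig 1) ^ 2 * split (sym Sym.η (-3))

/-- `2 sin f / e + sin (2 f) / 2`. -/
def fAct : Ser :=
  cst (2 * sinA 1 0 0 0 * sym Sym.e (-1)) * sig (-1) + cst (num (1 / 2) * sinA 2 0 0 0)

/-- `∂f/∂δL`. -/
def f_δL : Ser := P.invL * fAct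

/-- `∂e/∂δL = η² / (e L)`, with `η² = 1 + (η² - 1) σ²`. -/
def e_δL : Ser :=
  P.invL * (cst (sym Sym.e (-1)) * sig (-1) + cst ((sym Sym.η 2 - 1) * sym Sym.e (-1)) * sig 1)

/-- `∂η/∂δL = -η / L`. -/
def η_δL : Ser := -(P.invL * split (sym Sym.η 1))

/-- `∂f/∂G`. -/
def f_G : Ser := -(P.invL * split (sym Sym.η (-1)) * fAct)

/-- `∂e/∂G = -η / (e L)`. -/
def e_G : Ser :=
  -(P.invL * (cst (sym Sym.e (-1)) * sig (-1) +
    cst ((sym Sym.η 1 - 1) * sym Sym.e (-1)) * sig 1))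

/-- `∂η/∂G = 1 / L`. -/
def η_G : Ser := P.invL

/-- `∂ιc/∂G = -ιc / (η L)`. -/
def ιc_G : Ser := -(P.invL * cst (sym Sym.ιc 1) * split (sym Sym.η (-1)))

/-- `∂ιs/∂G = (1 - ιs²) / (η L ιs)`. -/
def ιs_G : Ser :=
  P.invL * cst ((1 - sym Sym.ιs 2) * sym Sym.ιs (-1)) * split (sym Sym.η (-1))

/-- `∂ιc/∂H = 1 / (η L)`. -/
def ιc_H : Ser := P.invL * split (sym Sym.η (-1))

/-- `∂ιs/∂H = -ιc / (η L ιs)`. -/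
def ιs_H : Ser :=
  -(P.invL * cst (sym Sym.ιc 1 * sym Sym.ιs (-1)) * split (sym Sym.η (-1)))

/-- `dF/dℓ`. -/
def d_ℓ (F : Ser) : Ser := act (dAngle Sym.f) F * f_ℓ * P.unitFactor

/-- `dF/dg`. -/
def d_g (F : Ser) : Ser := act (dAngle Sym.g) F * P.unitFactor

/-- `dF/dh`. -/
def d_h (F : Ser) : Ser := act (dAngle Sym.h) F * P.unitFactor

/-- `dF/dM₁`, with `d‖r₁‖/dE₁ = σ^ν₁ a₁ e₁ sin E₁` and `dE₁/dM₁ = a₁ / ‖r₁‖`. -/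
def d_M₁ (F : Ser) : Ser :=
  (act (dAngle Sym.E₁) F +
      act (dSym Sym.ρ) F * (cst (num (P.a₁ * P.e₁) * sinA 0 0 0 1) * sig P.ν₁) +
      act (dSym Sym.φ₁) F * sig (-P.ν₁)) * cst (num P.a₁ * sym Sym.ρ (-1)) -
    act (dSym Sym.φ₁) F * sig (-P.ν₁)

/-- `dF/dδL`. -/
def d_δL (F : Ser) : Ser :=
  act (dAngle Sym.f) F * P.f_δL + act (dSym Sym.δL) F + act (dSym Sym.e) F * P.e_δL * sig (-1) +
    act (dSym Sym.η) F * P.η_δL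

/-- `dF/dG`. -/
def d_G (F : Ser) : Ser :=
  act (dAngle Sym.f) F * P.f_G + act (dSym Sym.e) F * P.e_G * sig (-1) +
    act (dSym Sym.η) F * P.η_G + act (dSym Sym.ιc) F * P.ιc_G + act (dSym Sym.ιs) F * P.ιs_G

/-- `dF/dH`. -/
def d_H (F : Ser) : Ser :=
  act (dSym Sym.ιc) F * P.ιc_H + act (dSym Sym.ιs) F * P.ιs_H

/-- `dF/dJ₁`. -/
def d_J₁ (F : Ser) : Ser := act (dSym Sym.J₁) F

/-- The Poisson bracket `{F, K}`. -/
def bracket (F K : Ser) : Ser :=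
  P.d_ℓ F * P.d_δL K + P.d_g F * P.d_G K + P.d_h F * P.d_H K + P.d_M₁ F * d_J₁ K -
    P.d_δL F * P.d_ℓ K - P.d_G F * P.d_g K - P.d_H F * P.d_h K - d_J₁ F * P.d_M₁ K

/-- `G = exp(L_χ) F = ∑ n, L_χⁿ F / n!` with `L_χ = {·, χ}`: for each power of `σ`, `μ`, `τ` the
coefficient of the partial sums is eventually equal to that of `G` (so `G` is unique). -/
def IsLieSeries (χ F G : Ser) : Prop :=
  ∀ (k : ℤ) (n : Fin 2 →₀ ℕ), ∀ᶠ N in Filter.atTop,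
    MvPowerSeries.coeff n ((∑ i ∈ Finset.range N,
      cst (num ((i.factorial : ℝ)⁻¹)) * (fun K => P.bracket K χ)^[i] F).coeff k) =
    MvPowerSeries.coeff n (G.coeff k)

/-- The substitution `φ₁ = e₁ sin E₁` (`φ₁` never occurs with a negative exponent). -/
def substφ₁ : Expr →ₗ[ℂ] Expr :=
  onMonomials fun m => AddMonoidAlgebra.single (m - Pi.single Sym.φ₁ (m Sym.φ₁)) 1 *
    (num P.e₁ * sinA 0 0 0 1) ^ (m Sym.φ₁).toNat

/-! ### One normalization step -/

/-- Sends `(a₁ / ‖r₁‖^λ) d cos (s₁ f + s₂ g + s₃ h + s₄ E₁)`, `(s₁, s₄) ≠ (0, 0)`, to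
`(1 / ‖r₁‖^(λ-1)) d / (s₁ n_* + s₄ n₁) sin (s₁ f + s₂ g + s₃ h + s₄ E₁)`, and the terms without `f`
and `E₁` to `0`. -/
def genFast : Expr →ₗ[ℂ] Expr :=
  onMonomials fun m => if m Sym.f = 0 ∧ m Sym.E₁ = 0 then 0 else
    AddMonoidAlgebra.single (m + Pi.single Sym.ρ 1)
      ((P.a₁ : ℂ) * (Complex.I * (m Sym.f * P.nStar + m Sym.E₁ * P.n₁)))⁻¹

/-- Sends `(a₁ / ‖r₁‖^λ) d cos (p₁ g + p₂ h)` to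
`(φ₁ / n₁) ∑_{ψ=1}^λ 1 / (a₁^(ψ-1) ‖r₁‖^(λ-ψ)) d cos (p₁ g + p₂ h)`, and the terms with `f` or `E₁`
to `0`. -/
def genSlow : Expr →ₗ[ℂ] Expr :=
  onMonomials fun m => if m Sym.f = 0 ∧ m Sym.E₁ = 0 then
    ∑ ψ ∈ Finset.Icc 1 (-m Sym.ρ).toNat,
      AddMonoidAlgebra.single (m + Pi.single Sym.ρ (ψ : ℤ) + Pi.single Sym.φ₁ 1)
        ((P.a₁ : ℂ) * (P.n₁ * P.a₁ ^ (ψ - 1)))⁻¹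
    else 0

/-- Sends `(a₁ / ‖r₁‖^λ) d cos (p₁ g + p₂ h)` to `(1 / a₁^(λ-1)) d cos (p₁ g + p₂ h)`, and the terms
with `f` or `E₁` to `0`. -/
def average : Expr →ₗ[ℂ] Expr :=
  onMonomials fun m => if m Sym.f = 0 ∧ m Sym.E₁ = 0 then
    AddMonoidAlgebra.single (m + Pi.single Sym.ρ (-m Sym.ρ)) ((P.a₁ : ℂ) ^ (-m Sym.ρ).toNat)⁻¹
    else 0

/-- The generating function that targets the terms of order `σ^j` of `R`. -/
def generator (j : ℕ) (R : Ser) : Ser :=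
  HahnSeries.single ((j : ℤ) + P.ν₁) (coeffwise P.genSlow (R.coeff j)) +
    HahnSeries.single (j : ℤ) (coeffwise P.genFast (R.coeff j))

/-- The normal form term produced by the terms of order `σ^j` of `R`. -/
def secular (j : ℕ) (R : Ser) : Ser :=
  HahnSeries.single (j : ℤ) (coeffwise P.average (R.coeff j))

/-- One normalization step, targeted to the terms of order `σ^j` of the remainder `R` of the
Hamiltonian `H`: `χ` is its generating function, `Z` its normal form term, and `H'` the transformed
Hamiltonian `exp(L_χ) H` after the substitution `φ₁ = e₁ sin E₁`. -/
def IsStep (j : ℕ) (H R χ Z H' : Ser) : Prop :=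
  χ = P.generator j R ∧ Z = P.secular j R ∧
    ∃ G : Ser, P.IsLieSeries χ H G ∧ H' = act P.substφ₁ G

end Params

/-! ### The shape of normal form terms and of remainders -/

/-- A monomial in `δL, e, η, ιc, ιs`, polynomial in `δL` and `ιc`. -/
def slowMonomial (i₁ : ℕ) (i₂ i₃ : ℤ) (i₄ : ℕ) (i₅ : ℤ) : Expr :=
  sym Sym.δL i₁ * sym Sym.e i₂ * sym Sym.η i₃ * sym Sym.ιc i₄ * sym Sym.ιs i₅

/-- Finite sums of `ζ cos (p₁ g + p₂ h)`, `ζ` being real functions of `δL, e, η, ιc, ιs`. -/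
def secularForms : Submodule ℝ Expr :=
  Submodule.span ℝ {c | ∃ (i₁ : ℕ) (i₂ i₃ : ℤ) (i₄ : ℕ) (i₅ p₁ p₂ : ℤ),
    c = slowMonomial i₁ i₂ i₃ i₄ i₅ * cosA 0 p₁ p₂ 0}

/-- Finite sums of `(a₁ / ‖r₁‖^λ) d cos (s₁ f + s₂ g + s₃ h + s₄ E₁)` with `λ ≥ 1`, `d` being real
functions of `δL, e, η, ιc, ιs`. -/
def remainderForms : Submodule ℝ Expr :=
  Submodule.span ℝ {c | ∃ (k : ℕ) (i₁ : ℕ) (i₂ i₃ : ℤ) (i₄ : ℕ) (i₅ s₁ s₂ s₃ s₄ : ℤ), 1 ≤ k ∧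
    c = sym Sym.ρ (-k) * slowMonomial i₁ i₂ i₃ i₄ i₅ * cosA s₁ s₂ s₃ s₄}

/-- `Z` is a secular term of order exactly `σ^j`. -/
def IsSecular (j : ℕ) (Z : Ser) : Prop :=
  ∃ z : Coef, Z = HahnSeries.single (j : ℤ) z ∧ ∀ n, MvPowerSeries.coeff n z ∈ secularForms

/-- `R` is a remainder `O(σ^j)` in closed form. -/
def IsRemainder (j : ℕ) (R : Ser) : Prop :=
  (∀ k : ℤ, k < j → R.coeff k = 0) ∧
    ∀ (k : ℤ) (n : Fin 2 →₀ ℕ), MvPowerSeries.coeff n (R.coeff k) ∈ remainderForms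

end ClosedForm

end

/-! The obstacle is that the bracket is singular in `σ`. The derivatives in `e`, and the term `2 sin
f / e` of `∂f/∂δL` and `∂f/∂G`, cost up to `σ⁻²`. A generating function of order `σ` or `σ²` might
therefore lower the order, or leave it unchanged for ever.

The remedy is to use `x = e exp(i f)` and `y = e exp(-i f)` at fixed `θ = f + g`. A monomial with
exponents `f, g, e` is `exp(i g θ) x^a y^b` with `a = wq` and `b = -wp`, so `wp` and `wq` are up to
sign the Euler operators of `y` and `x`. In these variables (`bracket_expansion`, `low_bracket`) the
`σ⁻²` part of the bracket pairs an `x`-derivative of one argument with a `y`-derivative of the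
other. The `σ⁻¹` part always contains an `x`- or `y`-derivative, and the rest does not lower the
order. Singular terms thus vanish on functions free of `x, y`.

Counting orders then gives the scheme. In the initial remainder the `σ`-terms are functions of `θ`,
and the `σ²`-terms have degree at most one in `x, y`. Hence `χ₁` is free of `x, y`, and its bracket
with the remainder is `O(σ²)` (`lie_first`). The function `χ₂` has degree at most one at `σ²`, so
the `σ⁻²` part of its brackets gives back `σ²`-terms and the remainder does not improve. One `x`-
and one `y`-derivative use up all the `x, y` present, however, so the new `σ²`-terms depend on `θ`
only (`lie_second`). The extra generating function is then free of `x, y` at `σ²`, and its bracket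
raises the order (`lie_raises`). From `σ³` on a loss of two orders is harmless.

Two further facts are needed. The normal form terms produced so far must not lose two orders. Below
`σ³` they are independent of `f, g, e` (`lie_secular`), because a parity relation between the
exponents of `E₁` and `g`, inherited from `r₁ · R`, excludes terms like `e cos g`. In the first two
steps the Lie series does not gain powers of `σ`. It converges because the dangerous parts of `χ`
carry a factor `μ`, so the total order in `σ` and `μ` grows (`Contracting`, `lie_filtration`).

The homological equation is solved monomial by monomial (`homological_expr`). Closed form is
preserved because all operations respect two symmetries, complex conjugation and reversal of the
angles; their invariants without `φ₁` are the real combinations of cosines (`mem_of_mem_frm`). -/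

noncomputable section

namespace ClosedForm

/-! ### Coefficientwise properties of formal series -/

/-- The coefficient of `σ ^ k` and of the monomial `n` in `μ`, `τ`. -/
def cf (F : Ser) (k : ℤ) (n : Fin 2 →₀ ℕ) : Expr := MvPowerSeries.coeff n (F.coeff k)

/-- A condition on the coefficients of a series: one subgroup of expressions for every power of
`σ` and every monomial in `μ`, `τ`. -/
abbrev Fam := ℤ → (Fin 2 →₀ ℕ) → AddSubgroup Expr

/-- All coefficients of `F` satisfy the condition `M`. -/
def In (M : Fam) (F : Ser) : Prop := ∀ k n, cf F k n ∈ M k n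

theorem Ser.ext_cf {F G : Ser} (h : ∀ k n, cf F k n = cf G k n) : F = G := by
  ext k : 2
  exact MvPowerSeries.ext fun n => h k n

theorem cf_zero (k n) : cf 0 k n = 0 := by simp [cf]

theorem cf_add (F G : Ser) (k n) : cf (F + G) k n = cf F k n + cf G k n := by simp [cf]

theorem cf_neg (F : Ser) (k n) : cf (-F) k n = -cf F k n := by simp [cf]

theorem cf_sub (F G : Ser) (k n) : cf (F - G) k n = cf F k n - cf G k n := by simp [cf]

theorem cf_sum {ι : Type*} (s : Finset ι) (F : ι → Ser) (k n) :
    cf (∑ i ∈ s, F i) k n = ∑ i ∈ s, cf (F i) k n := by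
  classical
  induction s using Finset.induction_on with
  | empty => simp [cf_zero]
  | insert a s ha ih => rw [Finset.sum_insert ha, Finset.sum_insert ha, cf_add, ih]

theorem cf_mul (F G : Ser) (k n) : cf (F * G) k n =
    ∑ ij ∈ Finset.antidiagonal F.isPWO_support G.isPWO_support k,
      ∑ p ∈ Finset.HasAntidiagonal.antidiagonal n, cf F ij.1 p.1 * cf G ij.2 p.2 := by
  classical
  simp only [cf, HahnSeries.coeff_mul, map_sum, MvPowerSeries.coeff_mul]

theorem cf_single (a : ℤ) (C : Coef) (k n) :
    cf (HahnSeries.single a C) k n = if k = a then MvPowerSeries.coeff n C else 0 := by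
  unfold cf
  split_ifs with h
  · rw [h, HahnSeries.coeff_single_same]
  · rw [HahnSeries.coeff_single_of_ne h, map_zero]

theorem cf_cst (c : Expr) (k n) : cf (cst c) k n = if k = 0 ∧ n = 0 then c else 0 := by
  classical
  rw [cst, HahnSeries.C_apply, cf_single, MvPowerSeries.coeff_C]
  split_ifs <;> simp_all

theorem cf_sig (a k : ℤ) (n) : cf (sig a) k n = if k = a ∧ n = 0 then 1 else 0 := by
  classical
  rw [sig, cf_single, MvPowerSeries.coeff_one]
  split_ifs <;> simp_all

theorem cf_act (D : Expr →ₗ[ℂ] Expr) (F : Ser) (k n) : cf (act D F) k n = D (cf F k n) := rfl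

theorem cf_ofPowerSeries_nat (A : PowerSeries Coef) (k : ℕ) (n) :
    cf (HahnSeries.ofPowerSeries ℤ Coef A) k n =
      MvPowerSeries.coeff n (PowerSeries.coeff k A) := by
  rw [cf, HahnSeries.ofPowerSeries_apply_coeff]

theorem cf_ofPowerSeries_neg (A : PowerSeries Coef) {k : ℤ} (hk : k < 0) (n) :
    cf (HahnSeries.ofPowerSeries ℤ Coef A) k n = 0 := by
  have : (HahnSeries.ofPowerSeries ℤ Coef A).coeff k = 0 := by
    rw [HahnSeries.ofPowerSeries_apply]
    refine HahnSeries.embDomain_of_notMem_range ?_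
    rintro ⟨m, hm⟩
    have : (m : ℤ) = k := hm
    omega
  rw [cf, this, map_zero]

section
variable {M N U : Fam} {F G : Ser}

theorem In.mono (h : In M F) (hMN : ∀ k n, M k n ≤ N k n) : In N F := fun k n => hMN k n (h k n)

theorem In.zero : In M 0 := fun k n => by rw [cf_zero]; exact zero_mem _

theorem In.add (hF : In M F) (hG : In M G) : In M (F + G) := fun k n => by
  rw [cf_add]; exact add_mem (hF k n) (hG k n)

theorem In.neg (hF : In M F) : In M (-F) := fun k n => by
  rw [cf_neg]; exact neg_mem (hF k n)

theorem In.sub (hF : In M F) (hG : In M G) : In M (F - G) := fun k n => by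
  rw [cf_sub]; exact sub_mem (hF k n) (hG k n)

theorem In.sum {ι : Type*} {s : Finset ι} {F : ι → Ser} (h : ∀ i ∈ s, In M (F i)) :
    In M (∑ i ∈ s, F i) := fun k n => by
  rw [cf_sum]; exact sum_mem fun i hi => h i hi k n

theorem In.mul (hF : In M F) (hG : In N G)
    (h : ∀ k₁ k₂ n₁ n₂, ∀ a ∈ M k₁ n₁, ∀ b ∈ N k₂ n₂, a * b ∈ U (k₁ + k₂) (n₁ + n₂)) :
    In U (F * G) := fun k n => by
  rw [cf_mul]
  refine sum_mem fun ij hij => sum_mem fun p hp => ?_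
  have h1 : ij.1 + ij.2 = k := (Finset.mem_antidiagonal.mp hij).2.2
  have h2 : p.1 + p.2 = n := Finset.HasAntidiagonal.mem_antidiagonal.mp hp
  subst h1 h2
  exact h _ _ _ _ _ (hF _ _) _ (hG _ _)

theorem In.act {D : Expr →ₗ[ℂ] Expr} (hF : In M F) (h : ∀ k n, ∀ a ∈ M k n, D a ∈ N k n) :
    In N (act D F) := fun k n => h k n _ (hF k n)

theorem In.cst {c : Expr} (h : c ∈ M 0 0) : In M (cst c) := fun k n => by
  rw [cf_cst]
  split_ifs with hk
  · rw [hk.1, hk.2]; exact h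
  · exact zero_mem _

theorem In.sig {a : ℤ} (h : (1 : Expr) ∈ M a 0) : In M (sig a) := fun k n => by
  rw [cf_sig]
  split_ifs with hk
  · rw [hk.1, hk.2]; exact h
  · exact zero_mem _

theorem In.single {a : ℤ} {C : Coef} (h : ∀ n, MvPowerSeries.coeff n C ∈ M a n) :
    In M (HahnSeries.single a C) := fun k n => by
  rw [cf_single]
  split_ifs with hk
  · rw [hk]; exact h n
  · exact zero_mem _

theorem In.ofPowerSeries {A : PowerSeries Coef}
    (h : ∀ (k : ℕ) n, MvPowerSeries.coeff n (PowerSeries.coeff k A) ∈ M k n) :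
    In M (HahnSeries.ofPowerSeries ℤ Coef A) := fun k n => by
  rcases lt_or_ge k 0 with hk | hk
  · rw [cf_ofPowerSeries_neg A hk]; exact zero_mem _
  · lift k to ℕ using hk
    rw [cf_ofPowerSeries_nat]; exact h k n

end

theorem act_add (D : Expr →ₗ[ℂ] Expr) (F G : Ser) : act D (F + G) = act D F + act D G :=
  Ser.ext_cf fun k n => by simp [cf_act, cf_add]

theorem act_cst (D : Expr →ₗ[ℂ] Expr) (c : Expr) : act D (cst c) = cst (D c) :=
  Ser.ext_cf fun k n => by
    rw [cf_act, cf_cst, cf_cst]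
    split_ifs <;> simp

theorem act_single (D : Expr →ₗ[ℂ] Expr) (a : ℤ) (C : Coef) :
    act D (HahnSeries.single a C) = HahnSeries.single a (coeffwise D C) :=
  Ser.ext_cf fun k n => by
    rw [cf_act, cf_single, cf_single]
    split_ifs
    · rfl
    · simp

theorem cst_mul (a b : Expr) : cst (a * b) = cst a * cst b := by
  simp only [cst, map_mul]

theorem cst_add (a b : Expr) : cst (a + b) = cst a + cst b := by
  simp only [cst, map_add]

theorem cst_sub (a b : Expr) : cst (a - b) = cst a - cst b := by
  simp only [cst, map_sub]

theorem cst_neg (a : Expr) : cst (-a) = -cst a := by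
  simp only [cst, map_neg]

theorem cst_one : cst 1 = 1 := by
  simp only [cst, map_one]

theorem sig_mul (a b : ℤ) : sig a * sig b = sig (a + b) := by
  simp [sig, HahnSeries.single_mul_single]

theorem sym_mul (v : Sym) (a b : ℤ) : sym v a * sym v b = sym v (a + b) := by
  simp [sym, AddMonoidAlgebra.single_mul_single, Pi.single_add]

theorem sym_zero (v : Sym) : sym v 0 = 1 := by
  simp [sym, AddMonoidAlgebra.one_def]

/-! ### Linear operators prescribed on monomials -/

theorem onMonomials_single (T : (Sym → ℤ) → Expr) (m : Sym → ℤ) (z : ℂ) :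
    onMonomials T (AddMonoidAlgebra.single m z) = z • T m := by
  simp [onMonomials, Finsupp.linearCombination_single]

theorem linearMap_eq_on_single {D E : Expr →ₗ[ℂ] Expr}
    (h : ∀ m, D (AddMonoidAlgebra.single m 1) = E (AddMonoidAlgebra.single m 1)) : D = E := by
  refine LinearMap.ext fun c => ?_
  induction c using AddMonoidAlgebra.induction_linear with
  | zero => simp
  | add a b ha hb => rw [map_add, map_add, ha, hb]
  | single m z =>
    have : (AddMonoidAlgebra.single m z : Expr) = z • AddMonoidAlgebra.single m 1 := by simp
    rw [this, map_smul, map_smul, h]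

/-- Multiplication of the coefficient of the monomial `m` by `w m`. -/
def diag (w : (Sym → ℤ) → ℂ) : Expr →ₗ[ℂ] Expr :=
  onMonomials fun m => AddMonoidAlgebra.single m (w m)

theorem diag_single (w : (Sym → ℤ) → ℂ) (m z) :
    diag w (AddMonoidAlgebra.single m z) = AddMonoidAlgebra.single m (w m * z) := by
  simp [diag, onMonomials_single, mul_comm]

theorem coeff_diag (w : (Sym → ℤ) → ℂ) (c : Expr) (m) : (diag w c).coeff m = w m * c.coeff m := by
  induction c using AddMonoidAlgebra.induction_linear with
  | zero => simp
  | add a b ha hb => simp [ha, hb, mul_add]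
  | single m' z =>
    rw [diag_single]
    by_cases h : m' = m
    · subst h; simp
    · simp [h]

theorem dAngle_eq_diag (v : Sym) : dAngle v = diag fun m => Complex.I * (m v : ℂ) := rfl

/-- Factoring out `v⁻¹` leaves the diagonal Euler operator of `v`. Diagonal operators can be
combined with each other, which is used below for `e`. -/
theorem dSym_eq (v : Sym) (c : Expr) : dSym v c = sym v (-1) * diag (fun m => (m v : ℂ)) c := by
  have : dSym v = (LinearMap.mulLeft ℂ (sym v (-1))) ∘ₗ diag (fun m => (m v : ℂ)) := by
    refine linearMap_eq_on_single fun m => ?_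
    simp only [LinearMap.comp_apply, diag_single, LinearMap.mulLeft_apply, dSym,
      onMonomials_single, sym, AddMonoidAlgebra.single_mul_single, Pi.single_neg]
    simp [neg_add_eq_sub]
  rw [this]; rfl

theorem act_dSym (v : Sym) (F : Ser) :
    act (dSym v) F = cst (sym v (-1)) * act (diag fun m => (m v : ℂ)) F := by
  refine Ser.ext_cf fun k n => ?_
  have hc : cst (sym v (-1)) = HahnSeries.single (0 : ℤ)
      (MvPowerSeries.C (sym v (-1)) : Coef) := rfl
  rw [cf_act, dSym_eq, hc]
  simp only [cf]
  rw [HahnSeries.coeff_single_zero_mul, MvPowerSeries.coeff_C_mul]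
  rfl

/-! ### Supports -/

/-- Expressions whose monomials satisfy `S`. -/
def supp (S : (Sym → ℤ) → Prop) : AddSubgroup Expr where
  carrier := {c | ∀ m, c.coeff m ≠ 0 → S m}
  zero_mem' m h := by simp at h
  add_mem' {a b} ha hb m h := by
    by_cases h1 : a.coeff m = 0
    · by_cases h2 : b.coeff m = 0
      · simp [h1, h2] at h
      · exact hb m h2
    · exact ha m h1
  neg_mem' {a} ha m h := ha m (by simpa using h)

theorem supp_mono {S T : (Sym → ℤ) → Prop} (h : ∀ m, S m → T m) : supp S ≤ supp T :=
  fun _ hc m hm => h m (hc m hm)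

theorem single_mem_supp {S : (Sym → ℤ) → Prop} {m : Sym → ℤ} {z : ℂ} (h : S m) :
    (AddMonoidAlgebra.single m z : Expr) ∈ supp S := fun m' hm' => by
  by_cases hm : m = m'
  · exact hm ▸ h
  · simp [hm] at hm'

theorem mul_mem_supp {S T U : (Sym → ℤ) → Prop} {a b : Expr} (ha : a ∈ supp S) (hb : b ∈ supp T)
    (h : ∀ m m', S m → T m' → U (m + m')) : a * b ∈ supp U := fun m hm => by
  classical
  have h1 : m ∈ (a * b).coeff.support := Finsupp.mem_support_iff.mpr hm
  obtain ⟨x, hx, y, hy, rfl⟩ :=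
    Finset.mem_add.mp (AddMonoidAlgebra.support_coeff_mul_subset a b h1)
  exact h _ _ (ha x (Finsupp.mem_support_iff.mp hx)) (hb y (Finsupp.mem_support_iff.mp hy))

theorem linear_mem {S : (Sym → ℤ) → Prop} {A : AddSubgroup Expr} (D : Expr →ₗ[ℂ] Expr) {c : Expr}
    (hc : c ∈ supp S) (h : ∀ m, S m → ∀ z, c.coeff m = z →
      D (AddMonoidAlgebra.single m z) ∈ A) : D c ∈ A := by
  rw [← AddMonoidAlgebra.sum_coeff_single c, Finsupp.sum, map_sum]
  exact sum_mem fun m hm => h m (hc m (Finsupp.mem_support_iff.mp hm)) _ rfl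

theorem one_mem_supp {S : (Sym → ℤ) → Prop} (h : S 0) : (1 : Expr) ∈ supp S := by
  rw [AddMonoidAlgebra.one_def]; exact single_mem_supp h

/-- A diagonal operator also deletes the monomials of weight zero. Every gain of order in the
singular part of the bracket comes from this extra conclusion. -/
theorem diag_mem_supp {S : (Sym → ℤ) → Prop} {w : (Sym → ℤ) → ℂ} {c : Expr} (hc : c ∈ supp S) :
    diag w c ∈ supp fun m => S m ∧ w m ≠ 0 := fun m hm => by
  rw [coeff_diag] at hm
  exact ⟨hc m (right_ne_zero_of_mul hm), left_ne_zero_of_mul hm⟩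

/-- The family of conditions given by a condition on monomials. -/
def suppFam (S : ℤ → (Fin 2 →₀ ℕ) → (Sym → ℤ) → Prop) : Fam := fun k n => supp (S k n)

/-- All monomials of the series satisfy `S`. -/
abbrev Sup (S : ℤ → (Fin 2 →₀ ℕ) → (Sym → ℤ) → Prop) (F : Ser) : Prop := In (suppFam S) F

section
variable {S T U : ℤ → (Fin 2 →₀ ℕ) → (Sym → ℤ) → Prop} {F G : Ser}

theorem Sup.mono' (hF : Sup S F) (h : ∀ k n m, S k n m → T k n m) : Sup T F :=
  In.mono hF fun k n => supp_mono (h k n)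

theorem Sup.mul (hF : Sup S F) (hG : Sup T G)
    (h : ∀ k k' n n' m m', S k n m → T k' n' m' → U (k + k') (n + n') (m + m')) :
    Sup U (F * G) :=
  In.mul hF hG fun k k' n n' _ ha _ hb => mul_mem_supp ha hb fun m m' => h k k' n n' m m'

theorem Sup.diag {w : (Sym → ℤ) → ℂ} (hF : Sup S F) :
    Sup (fun k n m => S k n m ∧ w m ≠ 0) (act (diag w) F) :=
  In.act hF fun _ _ _ ha => diag_mem_supp ha

end

/-! ### Parity and reality of closed-form expressions -/

/-- `-1` for the angles, `1` for the other symbols. -/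
def angleSign : Sym → ℤ
  | .f | .g | .h | .E₁ => -1
  | _ => 1

/-- The change of sign of all angles, on exponent vectors. -/
def flip : (Sym → ℤ) →+ (Sym → ℤ) where
  toFun m v := angleSign v * m v
  map_zero' := by ext; simp
  map_add' m m' := by ext; simp [mul_add]

theorem flip_apply (m : Sym → ℤ) (v : Sym) : flip m v = angleSign v * m v := rfl

/-- The ring endomorphism sending `z X ^ m` to `(-1) ^ (m φ₁) s(z) X ^ (φ m)`. -/
def twist (s : ℂ →+* ℂ) (φ : (Sym → ℤ) →+ (Sym → ℤ)) : Expr →+* Expr :=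
  AddMonoidAlgebra.liftNCRingHom (AddMonoidAlgebra.singleZeroRingHom.comp s)
    { toFun := fun m => AddMonoidAlgebra.single (φ m.toAdd) ((-1) ^ (m.toAdd Sym.φ₁))
      map_one' := by simp [AddMonoidAlgebra.one_def]
      map_mul' := fun a b => by
        simp [AddMonoidAlgebra.single_mul_single, zpow_add₀] }
    fun _ _ => Commute.all _ _

theorem twist_single (s φ m z) : twist s φ (AddMonoidAlgebra.single m z) =
    AddMonoidAlgebra.single (φ m) ((-1) ^ (m Sym.φ₁) * s z) := by
  simp [twist, AddMonoidAlgebra.single_mul_single, mul_comm]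

/-- Complex conjugation of the coefficients, with `φ₁` counted as imaginary. -/
def conjT : Expr →+* Expr := twist (starRingEnd ℂ) (AddMonoidHom.id _)

/-- Change of sign of all angles and of `φ₁`. -/
def flipT : Expr →+* Expr := twist (RingHom.id ℂ) flip

theorem conjT_single (m z) : conjT (AddMonoidAlgebra.single m z) =
    AddMonoidAlgebra.single m ((-1) ^ (m Sym.φ₁) * starRingEnd ℂ z) := twist_single _ _ _ _

theorem flipT_single (m z) : flipT (AddMonoidAlgebra.single m z) =
    AddMonoidAlgebra.single (flip m) ((-1) ^ (m Sym.φ₁) * z) := twist_single _ _ _ _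

/-- The exponents that occur in formal series of closed forms, without `J₁` and with the exponent of
`ρ` at most `r`. -/
def Admissible (r : ℤ) (m : Sym → ℤ) : Prop :=
  m Sym.ρ ≤ r ∧ 0 ≤ m Sym.δL ∧ 0 ≤ m Sym.ιc ∧ 0 ≤ m Sym.φ₁ ∧ m Sym.J₁ = 0

/-- Real closed forms of parity `p` in the angles (`φ₁` being odd) with admissible exponents. -/
def frm (r p : ℤ) : AddSubgroup Expr where
  carrier := {c | c ∈ supp (Admissible r) ∧ conjT c = p • c ∧ flipT c = p • c}
  zero_mem' := by simp
  add_mem' {a b} ha hb := ⟨add_mem ha.1 hb.1, by rw [map_add, ha.2.1, hb.2.1, smul_add],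
    by rw [map_add, ha.2.2, hb.2.2, smul_add]⟩
  neg_mem' {a} ha := ⟨neg_mem ha.1, by rw [map_neg, ha.2.1, smul_neg],
    by rw [map_neg, ha.2.2, smul_neg]⟩

theorem frm_mono {r r' p : ℤ} (h : r ≤ r') : frm r p ≤ frm r' p := fun _ hc =>
  ⟨supp_mono (fun _ hm => ⟨hm.1.trans h, hm.2⟩) hc.1, hc.2⟩

theorem mul_mem_frm {r r' p p' : ℤ} {a b : Expr} (ha : a ∈ frm r p) (hb : b ∈ frm r' p') :
    a * b ∈ frm (r + r') (p * p') := by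
  refine ⟨mul_mem_supp ha.1 hb.1 fun m m' hm hm' => ?_, ?_, ?_⟩
  · simp only [Admissible, Pi.add_apply] at *
    omega
  · rw [map_mul, ha.2.1, hb.2.1, smul_mul_smul_comm]
  · rw [map_mul, ha.2.2, hb.2.2, smul_mul_smul_comm]

theorem admissible_flip {r : ℤ} {m : Sym → ℤ} (h : Admissible r m) : Admissible r (flip m) := by
  simpa [Admissible, flip_apply, angleSign] using h

/-- Both symmetries are additive, so commutation up to the sign `q` need only be checked on
admissible monomials. The sign `q` is the parity of the operator itself. -/
theorem linear_mem_frm {r r' p q : ℤ} {D : Expr →ₗ[ℂ] Expr} {c : Expr} (hc : c ∈ frm r p)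
    (hs : ∀ m, Admissible r m → ∀ z, D (AddMonoidAlgebra.single m z) ∈ supp (Admissible r'))
    (h1 : ∀ m, Admissible r m → ∀ z, conjT (D (AddMonoidAlgebra.single m z)) =
      q • D (conjT (AddMonoidAlgebra.single m z)))
    (h2 : ∀ m, Admissible r m → ∀ z, flipT (D (AddMonoidAlgebra.single m z)) =
      q • D (flipT (AddMonoidAlgebra.single m z))) : D c ∈ frm r' (q * p) := by
  have key : ∀ T : Expr →+* Expr, (∀ m, Admissible r m → ∀ z,
      T (D (AddMonoidAlgebra.single m z)) = q • D (T (AddMonoidAlgebra.single m z))) →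
      T (D c) = q • D (T c) := fun T hT => by
    conv_lhs => rw [← AddMonoidAlgebra.sum_coeff_single c]
    conv_rhs => rw [← AddMonoidAlgebra.sum_coeff_single c]
    simp only [Finsupp.sum, map_sum, Finset.smul_sum]
    exact Finset.sum_congr rfl fun m hm => hT m (hc.1 m (Finsupp.mem_support_iff.mp hm)) _
  refine ⟨linear_mem D hc.1 fun m hm z _ => hs m hm z, ?_, ?_⟩
  · rw [key _ h1, hc.2.1, map_zsmul, smul_smul]
  · rw [key _ h2, hc.2.2, map_zsmul, smul_smul]

theorem single_mem_frm {r : ℤ} {m : Sym → ℤ} {x : ℝ} (hm : Admissible r m) (h0 : flip m = m)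
    (h1 : m Sym.φ₁ = 0) : (AddMonoidAlgebra.single m (x : ℂ) : Expr) ∈ frm r 1 := by
  refine ⟨single_mem_supp hm, ?_, ?_⟩
  · rw [conjT_single, h1]; simp
  · rw [flipT_single, h1, h0]; simp

theorem admissible_zero {r : ℤ} (hr : 0 ≤ r) : Admissible r 0 := by simp [Admissible, hr]

theorem num_mem_frm (x : ℝ) : num x ∈ frm 0 1 :=
  single_mem_frm (admissible_zero le_rfl) (map_zero _) rfl

theorem one_mem_frm : (1 : Expr) ∈ frm 0 1 := by
  have := num_mem_frm 1
  simpa [num, AddMonoidAlgebra.one_def] using this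

theorem num_mul_mem_frm {r p : ℤ} (x : ℝ) {c : Expr} (hc : c ∈ frm r p) : num x * c ∈ frm r p := by
  simpa using mul_mem_frm (num_mem_frm x) hc

theorem flip_pi_single {v : Sym} (hv : angleSign v = 1) (k : ℤ) :
    flip (Pi.single v k) = Pi.single v k := by
  ext w
  rw [flip_apply]
  by_cases hw : w = v
  · subst hw; simp [hv]
  · simp [hw]

theorem sym_mem_frm {r : ℤ} {v : Sym} {k : ℤ} (h : Admissible r (Pi.single v k))
    (hv : angleSign v = 1) (h1 : (Pi.single v k : Sym → ℤ) Sym.φ₁ = 0) : sym v k ∈ frm r 1 := by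
  have := single_mem_frm (x := 1) h (flip_pi_single hv k) h1
  simpa [sym] using this

theorem admissible_angle (s₁ s₂ s₃ s₄ : ℤ) : Admissible 0 (angle s₁ s₂ s₃ s₄) := by
  simp [Admissible, angle]

theorem flip_angle (s₁ s₂ s₃ s₄ : ℤ) : flip (angle s₁ s₂ s₃ s₄) = -angle s₁ s₂ s₃ s₄ := by
  ext v
  cases v <;> simp [flip_apply, angle, angleSign]

theorem admissible_neg_angle (s₁ s₂ s₃ s₄ : ℤ) : Admissible 0 (-angle s₁ s₂ s₃ s₄) := by
  rw [← flip_angle]; exact admissible_flip (admissible_angle _ _ _ _)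

theorem angle_φ₁ (s₁ s₂ s₃ s₄ : ℤ) : angle s₁ s₂ s₃ s₄ Sym.φ₁ = 0 := by simp [angle]

theorem cosA_mem_frm (s₁ s₂ s₃ s₄ : ℤ) : cosA s₁ s₂ s₃ s₄ ∈ frm 0 1 := by
  refine ⟨add_mem (single_mem_supp (admissible_angle _ _ _ _))
    (single_mem_supp (admissible_neg_angle _ _ _ _)), ?_, ?_⟩
  · simp [cosA, conjT_single, angle_φ₁, map_ofNat]
  · simp only [cosA, map_add, flipT_single, map_neg, flip_angle, neg_neg, angle_φ₁, Pi.neg_apply]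
    simp [add_comm]

theorem sinA_mem_frm (s₁ s₂ s₃ s₄ : ℤ) : sinA s₁ s₂ s₃ s₄ ∈ frm 0 (-1) := by
  refine ⟨sub_mem (single_mem_supp (admissible_angle _ _ _ _))
    (single_mem_supp (admissible_neg_angle _ _ _ _)), ?_, ?_⟩
  · simp [sinA, conjT_single, angle_φ₁, map_ofNat]
  · simp only [sinA, map_sub, flipT_single, map_neg, flip_angle, neg_neg, angle_φ₁, Pi.neg_apply]
    simp
    abel

theorem dAngle_mem_frm {r p : ℤ} {v : Sym} (hv : angleSign v = -1)
    {c : Expr} (hc : c ∈ frm r p) : dAngle v c ∈ frm r (-p) := by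
  rw [dAngle_eq_diag, ← neg_one_mul]
  refine linear_mem_frm hc (fun m hm z => ?_) (fun m hm z => ?_) (fun m hm z => ?_)
  · rw [diag_single]; exact single_mem_supp hm
  · simp only [diag_single, conjT_single, neg_smul, one_smul, ← AddMonoidAlgebra.single_neg]
    congr 1
    simp
    ring
  · simp only [diag_single, flipT_single, neg_smul, one_smul, ← AddMonoidAlgebra.single_neg,
      flip_apply, hv]
    congr 1
    push_cast
    ring

/-- Lowering the exponent of `φ₁` by one changes the sign `(-1) ^ (m φ₁)` in both symmetries, so `q
= -1` for `φ₁`. For the other non-angular symbols `q = 1`. -/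
theorem dSym_mem_frm {r p q : ℤ} {v : Sym} (hv : angleSign v = 1)
    (hq : q = (-1) ^ ((Pi.single v 1 : Sym → ℤ) Sym.φ₁).natAbs) {c : Expr}
    (hc : c ∈ frm r p) : dSym v c ∈ frm r (q * p) := by
  have hflip := flip_pi_single hv 1
  have hz : ∀ a : ℤ, ((-1 : ℂ)) ^ (a - (Pi.single v (1 : ℤ) : Sym → ℤ) Sym.φ₁) =
      q * (-1) ^ a := fun a => by
    rw [hq, zpow_sub₀ (by norm_num)]
    by_cases h : v = Sym.φ₁
    · subst h; simp [div_neg]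
    · simp [Ne.symm h]
  refine linear_mem_frm hc (fun m hm z => ?_) (fun m hm z => ?_) (fun m hm z => ?_)
  · rw [dSym, onMonomials_single, AddMonoidAlgebra.smul_single]
    -- The exponents of `δL`, `ιc`, `φ₁` cannot become negative, because a monomial with exponent
    -- `0` is annihilated.
    by_cases h : m v = 0
    · rw [h]; simp
    · refine single_mem_supp ?_
      simp only [Admissible, Pi.sub_apply, Pi.single_apply] at *
      cases v <;> simp at * <;> omega
  · simp only [dSym, onMonomials_single, conjT_single, AddMonoidAlgebra.smul_single,
      Pi.sub_apply, hz]
    congr 1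
    simp
    ring
  · simp only [dSym, onMonomials_single, flipT_single, AddMonoidAlgebra.smul_single,
      Pi.sub_apply, hz, map_sub, hflip, flip_apply, hv]
    congr 1
    simp
    ring

/-- All coefficients are real closed forms of parity `p`. -/
abbrev Frm (r p : ℤ) (F : Ser) : Prop := In (fun _ _ => frm r p) F

theorem Frm.mul {r r' p p' : ℤ} {F G : Ser} (hF : Frm r p F) (hG : Frm r' p' G) :
    Frm (r + r') (p * p') (F * G) :=
  In.mul hF hG fun _ _ _ _ _ ha _ hb => mul_mem_frm ha hb

theorem Frm.mul' {r r' r'' p p' p'' : ℤ} {F G : Ser} (hF : Frm r p F) (hG : Frm r' p' G)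
    (hr : r + r' ≤ r'' := by norm_num) (hp : p * p' = p'' := by norm_num) :
    Frm r'' p'' (F * G) :=
  hp ▸ In.mono (hF.mul hG) fun _ _ => frm_mono hr

theorem Frm.mono {r r' p : ℤ} {F : Ser} (hF : Frm r p F) (hr : r ≤ r') : Frm r' p F :=
  In.mono hF fun _ _ => frm_mono hr

theorem frm_sig (a : ℤ) : Frm 0 1 (sig a) := In.sig one_mem_frm

theorem frm_one : Frm 0 1 1 := frm_sig 0

theorem Frm.dAngle {r p : ℤ} {v : Sym} (hv : angleSign v = -1) {F : Ser}
    (hF : Frm r p F) : Frm r (-p) (act (dAngle v) F) :=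
  In.act hF fun _ _ _ ha => dAngle_mem_frm hv ha

theorem Frm.dSym {r p : ℤ} {v : Sym} (hv : angleSign v = 1) (hφ : v ≠ Sym.φ₁) {F : Ser}
    (hF : Frm r p F) : Frm r p (act (dSym v) F) := by
  have := In.act (N := fun _ _ => frm r (1 * p)) hF fun _ _ _ ha =>
    dSym_mem_frm hv (by simp [Ne.symm hφ]) ha
  simpa using this

/-! ### The bracket preserves real closed forms of definite parity -/

theorem frm_cst {r p : ℤ} {c : Expr} (h : c ∈ frm r p) : Frm r p (cst c) := In.cst h

theorem sym_η_mem (k : ℤ) : sym Sym.η k ∈ frm 0 1 := sym_mem_frm (by simp [Admissible]) rfl (by simp)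

theorem sym_e_mem (k : ℤ) : sym Sym.e k ∈ frm 0 1 := sym_mem_frm (by simp [Admissible]) rfl (by simp)

theorem sym_ιs_mem (k : ℤ) : sym Sym.ιs k ∈ frm 0 1 :=
  sym_mem_frm (by simp [Admissible]) rfl (by simp)

theorem sym_ιc_mem {k : ℤ} (hk : 0 ≤ k) : sym Sym.ιc k ∈ frm 0 1 :=
  sym_mem_frm (by simp [Admissible, hk]) rfl (by simp)

theorem sym_δL_mem {k : ℤ} (hk : 0 ≤ k) : sym Sym.δL k ∈ frm 0 1 :=
  sym_mem_frm (by simp [Admissible, hk]) rfl (by simp)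

theorem sym_ρ_mem (k : ℤ) : sym Sym.ρ k ∈ frm k 1 := sym_mem_frm (by simp [Admissible]) rfl (by simp)

theorem mul_mem_frm_zero {p p' : ℤ} {a b : Expr} (ha : a ∈ frm 0 p) (hb : b ∈ frm 0 p') :
    a * b ∈ frm 0 (p * p') := by
  simpa using mul_mem_frm ha hb

theorem mul_mem_frm_one {a b : Expr} (ha : a ∈ frm 0 1) (hb : b ∈ frm 0 1) : a * b ∈ frm 0 1 := by
  simpa using mul_mem_frm ha hb

theorem mul_mem_frm_neg {a b : Expr} (ha : a ∈ frm 0 1) (hb : b ∈ frm 0 (-1)) :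
    a * b ∈ frm 0 (-1) := by
  simpa using mul_mem_frm ha hb

theorem Frm.mul_one' {r : ℤ} {F G : Ser} (hF : Frm r 1 F) (hG : Frm 0 1 G) : Frm r 1 (F * G) :=
  Frm.mul' hF hG (by simp) (by simp)

theorem two_mem_frm : (2 : Expr) ∈ frm 0 1 := by
  rw [← one_add_one_eq_two]; exact add_mem one_mem_frm one_mem_frm

theorem dSym_J₁_eq_zero {r p : ℤ} {c : Expr} (hc : c ∈ frm r p) :
    dSym Sym.J₁ c = 0 := by
  have : dSym Sym.J₁ c ∈ (⊥ : AddSubgroup Expr) := by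
    refine linear_mem _ hc.1 fun m hm z _ => ?_
    rw [dSym, onMonomials_single, hm.2.2.2.2]
    simp
  simpa using this

theorem Frm.d_J₁_eq_zero {r p : ℤ} {F : Ser} (hF : Frm r p F) : Params.d_J₁ F = 0 :=
  Ser.ext_cf fun k n => by
    rw [Params.d_J₁, cf_act, cf_zero]; exact dSym_J₁_eq_zero (hF k n)

namespace Params

variable (P : Params)

theorem frm_unitFactor : Frm (-1) 1 P.unitFactor := by
  refine Frm.mul_one' (frm_cst (num_mul_mem_frm _ (sym_ρ_mem _))) (frm_one.sub ?_)
  exact (frm_sig _).mul_one' (frm_cst (num_mul_mem_frm _ (cosA_mem_frm _ _ _ _)))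

theorem frm_invL : Frm 0 1 P.invL := by
  classical
  refine In.ofPowerSeries fun k n => ?_
  rw [invLP, PowerSeries.coeff_mk, MvPowerSeries.coeff_C]
  split_ifs
  · exact num_mul_mem_frm _ (sym_δL_mem (by positivity))
  · exact zero_mem _

theorem frm_split {x : Expr} (hx : x ∈ frm 0 1) : Frm 0 1 (split x) :=
  frm_one.add ((frm_cst (sub_mem hx one_mem_frm)).mul_one' (frm_sig 2))

theorem frm_f_ℓ : Frm 0 1 f_ℓ := by
  have h : Frm 0 1 (1 + cst (sym Sym.e 1 * cosA 1 0 0 0) * sig 1) :=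
    frm_one.add ((frm_cst (mul_mem_frm_one (sym_e_mem _) (cosA_mem_frm _ _ _ _))).mul_one'
      (frm_sig _))
  rw [f_ℓ, pow_two]
  exact (h.mul_one' h).mul_one' (frm_split (sym_η_mem _))

theorem frm_fAct : Frm 0 (-1) fAct := by
  refine In.add (Frm.mul' (frm_cst (r := 0) (p := -1) ?_) (frm_sig _)) (frm_cst ?_)
  · rw [mul_comm]
    exact mul_mem_frm_neg (sym_e_mem _) (mul_mem_frm_neg two_mem_frm (sinA_mem_frm _ _ _ _))
  · exact num_mul_mem_frm _ (sinA_mem_frm _ _ _ _)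

theorem frm_f_δL : Frm 0 (-1) P.f_δL := P.frm_invL.mul' frm_fAct

theorem frm_e_δL : Frm 0 1 P.e_δL :=
  P.frm_invL.mul_one' (((frm_cst (sym_e_mem _)).mul_one' (frm_sig _)).add
    ((frm_cst (mul_mem_frm_one (sub_mem (sym_η_mem _) one_mem_frm) (sym_e_mem _))).mul_one'
      (frm_sig _)))

theorem frm_η_δL : Frm 0 1 P.η_δL := (P.frm_invL.mul_one' (frm_split (sym_η_mem _))).neg

theorem frm_f_G : Frm 0 (-1) P.f_G :=
  ((P.frm_invL.mul_one' (frm_split (sym_η_mem _))).mul' frm_fAct).neg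

theorem frm_e_G : Frm 0 1 P.e_G :=
  (P.frm_invL.mul_one' (((frm_cst (sym_e_mem _)).mul_one' (frm_sig _)).add
    ((frm_cst (mul_mem_frm_one (sub_mem (sym_η_mem _) one_mem_frm) (sym_e_mem _))).mul_one'
      (frm_sig _)))).neg

theorem frm_ιc_G : Frm 0 1 P.ιc_G :=
  ((P.frm_invL.mul_one' (frm_cst (sym_ιc_mem (by norm_num)))).mul_one'
    (frm_split (sym_η_mem _))).neg

theorem frm_ιs_G : Frm 0 1 P.ιs_G :=
  (P.frm_invL.mul_one' (frm_cst (mul_mem_frm_one (sub_mem one_mem_frm (sym_ιs_mem _))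
    (sym_ιs_mem _)))).mul_one' (frm_split (sym_η_mem _))

theorem frm_ιc_H : Frm 0 1 P.ιc_H := P.frm_invL.mul_one' (frm_split (sym_η_mem _))

theorem frm_ιs_H : Frm 0 1 P.ιs_H :=
  ((P.frm_invL.mul_one' (frm_cst (mul_mem_frm_one (sym_ιc_mem (by norm_num))
    (sym_ιs_mem _)))).mul_one' (frm_split (sym_η_mem _))).neg

section
variable {p : ℤ} {F : Ser}

theorem frm_d_ℓ (hF : Frm 0 p F) : Frm (-1) (-p) (P.d_ℓ F) :=
  Frm.mul' (Frm.mul' (hF.dAngle rfl) frm_f_ℓ le_rfl (mul_one _)) P.frm_unitFactor (by simp)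
    (mul_one _)

theorem frm_d_g (hF : Frm 0 p F) : Frm (-1) (-p) (P.d_g F) :=
  Frm.mul' (hF.dAngle rfl) P.frm_unitFactor (by simp) (mul_one _)

theorem frm_d_h (hF : Frm 0 p F) : Frm (-1) (-p) (P.d_h F) :=
  Frm.mul' (hF.dAngle rfl) P.frm_unitFactor (by simp) (mul_one _)

theorem frm_d_δL (hF : Frm 0 p F) : Frm 0 p (P.d_δL F) := by
  refine In.add (In.add (In.add ?_ ?_) ?_) ?_
  · exact Frm.mul' (hF.dAngle rfl) P.frm_f_δL le_rfl (by simp)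
  · exact hF.dSym rfl (by decide)
  · exact Frm.mul' (Frm.mul' (hF.dSym rfl (by decide)) P.frm_e_δL le_rfl (mul_one _)) (frm_sig _)
      le_rfl (mul_one _)
  · exact Frm.mul' (hF.dSym rfl (by decide)) P.frm_η_δL le_rfl (mul_one _)

theorem frm_d_G (hF : Frm 0 p F) : Frm 0 p (P.d_G F) := by
  refine In.add (In.add (In.add (In.add ?_ ?_) ?_) ?_) ?_
  · exact Frm.mul' (hF.dAngle rfl) P.frm_f_G le_rfl (by simp)
  · exact Frm.mul' (Frm.mul' (hF.dSym rfl (by decide)) P.frm_e_G le_rfl (mul_one _)) (frm_sig _)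
      le_rfl (mul_one _)
  · exact Frm.mul' (hF.dSym rfl (by decide)) P.frm_invL le_rfl (mul_one _)
  · exact Frm.mul' (hF.dSym rfl (by decide)) P.frm_ιc_G le_rfl (mul_one _)
  · exact Frm.mul' (hF.dSym rfl (by decide)) P.frm_ιs_G le_rfl (mul_one _)

theorem frm_d_H (hF : Frm 0 p F) : Frm 0 p (P.d_H F) := by
  refine In.add ?_ ?_
  · exact Frm.mul' (hF.dSym rfl (by decide)) P.frm_ιc_H le_rfl (mul_one _)
  · exact Frm.mul' (hF.dSym rfl (by decide)) P.frm_ιs_H le_rfl (mul_one _)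

end

/-- Each product left in the bracket has exactly one derivative in `ℓ`, `g` or `h`. It reverses the
parity and brings the factor `a₁ w / ρ`, which is why `ρ⁻¹` is gained. The pair `M₁, J₁` drops out
because neither argument contains `J₁`. -/
theorem frm_bracket {F K : Ser} (hF : Frm 0 1 F) (hK : Frm 0 (-1) K) :
    Frm (-1) 1 (P.bracket F K) := by
  rw [bracket, hF.d_J₁_eq_zero, hK.d_J₁_eq_zero, mul_zero, zero_mul, add_zero, sub_zero]
  refine In.sub (In.sub (In.sub (In.add (In.add ?_ ?_) ?_) ?_) ?_) ?_
  · exact (P.frm_d_ℓ hF).mul' (P.frm_d_δL hK)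
  · exact (P.frm_d_g hF).mul' (P.frm_d_G hK)
  · exact (P.frm_d_h hF).mul' (P.frm_d_H hK)
  · exact (P.frm_d_δL hF).mul' (P.frm_d_ℓ hK)
  · exact (P.frm_d_G hF).mul' (P.frm_d_g hK)
  · exact (P.frm_d_H hF).mul' (P.frm_d_h hK)

theorem bracket_add_left (F F' K : Ser) :
    P.bracket (F + F') K = P.bracket F K + P.bracket F' K := by
  simp only [bracket, d_ℓ, d_g, d_h, d_M₁, d_δL, d_G, d_H, d_J₁, act_add]
  ring

/-- The Lie derivative `{·, χ}`. -/
def lie (χ : Ser) : Ser →+ Ser := AddMonoidHom.mk' (fun F => P.bracket F χ)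
  fun F F' => P.bracket_add_left F F' χ

theorem lie_apply (χ F : Ser) : P.lie χ F = P.bracket F χ := rfl

end Params

/-! ### Tracking low orders in `σ`

Conditions on the exponents of `σ`, `μ`, `f`, `g` and `e` only. -/

/-- All monomials of `F` satisfy `Q`, a condition on the exponents of `σ`, `μ`, `f`, `g`, `e`. -/
def Low (Q : ℤ → ℕ → ℤ → ℤ → ℤ → Prop) (F : Ser) : Prop :=
  Sup (fun k n m => Q k (n 0) (m Sym.f) (m Sym.g) (m Sym.e)) F

/-- The exponents of a series that starts at `σ ^ a` with the exponents `f₀`, `g₀`, `e₀`. -/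
def Lead (a f₀ g₀ e₀ : ℤ) (k : ℤ) (_ : ℕ) (f g e : ℤ) : Prop :=
  a ≤ k ∧ (k = a → f = f₀ ∧ g = g₀ ∧ e = e₀)

section
variable {Q R U : ℤ → ℕ → ℤ → ℤ → ℤ → Prop} {F G : Ser}

theorem Low.add (hF : Low Q F) (hG : Low Q G) : Low Q (F + G) := In.add hF hG

theorem Low.sub (hF : Low Q F) (hG : Low Q G) : Low Q (F - G) := In.sub hF hG

theorem Low.neg (hF : Low Q F) : Low Q (-F) := In.neg hF

theorem Low.mono (hF : Low Q F) (h : ∀ k n f g e, Q k n f g e → R k n f g e) : Low R F :=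
  Sup.mono' hF fun _ _ _ => h _ _ _ _ _

theorem Low.mul (hF : Low Q F) (hG : Low R G)
    (h : ∀ k k' n n' f f' g g' e e', Q k n f g e → R k' n' f' g' e' →
      U (k + k') (n + n') (f + f') (g + g') (e + e')) : Low U (F * G) :=
  Sup.mul hF hG fun _ _ _ _ _ _ => h _ _ _ _ _ _ _ _ _ _

theorem Low.dSym {v : Sym} (hF : Low Q F) (hf : v ≠ Sym.f) (hg : v ≠ Sym.g) (he : v ≠ Sym.e) :
    Low Q (act (dSym v) F) :=
  In.act hF fun k n a ha => linear_mem _ ha fun m hm z _ => by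
    rw [ClosedForm.dSym, onMonomials_single, AddMonoidAlgebra.smul_single]
    refine single_mem_supp ?_
    simpa [Ne.symm hf, Ne.symm hg, Ne.symm he] using hm

theorem Low.dAngle (v : Sym) (hF : Low Q F) : Low Q (act (dAngle v) F) :=
  Sup.mono' (Sup.diag hF) fun _ _ _ h => h.1

theorem Low.dAngle_g (hF : Low Q F) :
    Low (fun k n f g e => Q k n f g e ∧ g ≠ 0) (act (ClosedForm.dAngle Sym.g) F) :=
  Sup.mono' (Sup.diag hF) fun _ _ _ h => ⟨h.1, fun h0 => h.2 (by rw [h0]; simp)⟩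

theorem low_cst {c : Expr} (h : c ∈ supp fun m => Q 0 0 (m Sym.f) (m Sym.g) (m Sym.e)) :
    Low Q (cst c) := In.cst h

theorem low_sig {a : ℤ} (h : Q a 0 0 0 0) : Low Q (sig a) := In.sig (one_mem_supp h)

theorem Low.mul_lead {a f₀ g₀ e₀ b f₁ g₁ e₁ c f₂ g₂ e₂ : ℤ} (hF : Low (Lead a f₀ g₀ e₀) F)
    (hG : Low (Lead b f₁ g₁ e₁) G) (hc : a + b = c := by norm_num) (hf : f₀ + f₁ = f₂ := by norm_num)
    (hg : g₀ + g₁ = g₂ := by norm_num) (he : e₀ + e₁ = e₂ := by norm_num) :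
    Low (Lead c f₂ g₂ e₂) (F * G) :=
  Low.mul hF hG fun _ _ _ _ _ _ _ _ _ _ h h' => by unfold Lead at *; omega

theorem Low.lead_zero_mul {a f g e : ℤ} (hF : Low (Lead 0 0 0 0) F) (hG : Low (Lead a f g e) G) :
    Low (Lead a f g e) (F * G) :=
  Low.mul_lead hF hG (zero_add _) (zero_add _) (zero_add _) (zero_add _)

theorem Low.mul_lead_zero {a f g e : ℤ} (hF : Low (Lead a f g e) F) (hG : Low (Lead 0 0 0 0) G) :
    Low (Lead a f g e) (F * G) :=
  Low.mul_lead hF hG (add_zero _) (add_zero _) (add_zero _) (add_zero _)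

theorem lead_sig (a : ℤ) : Low (Lead a 0 0 0) (sig a) := low_sig ⟨le_rfl, fun _ => ⟨rfl, rfl, rfl⟩⟩

theorem lead_single {f g e : ℤ} {m : Sym → ℤ} (z : ℂ) (hf : m Sym.f = f) (hg : m Sym.g = g)
    (he : m Sym.e = e) : Low (Lead 0 f g e) (cst (AddMonoidAlgebra.single m z)) :=
  low_cst (single_mem_supp ⟨le_rfl, fun _ => ⟨hf, hg, he⟩⟩)

theorem lead_sym {v : Sym} {k : ℤ} (hf : v ≠ Sym.f) (hg : v ≠ Sym.g) (he : v ≠ Sym.e) :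
    Low (Lead 0 0 0 0) (cst (sym v k)) :=
  lead_single _ (by simp [Ne.symm hf]) (by simp [Ne.symm hg]) (by simp [Ne.symm he])

theorem lead_num (x : ℝ) : Low (Lead 0 0 0 0) (cst (num x)) := lead_single _ rfl rfl rfl

theorem lead_one : Low (Lead 0 0 0 0) 1 := lead_sig 0

theorem Low.lead_of_pos {a b f g e : ℤ} (hF : Low (fun k _ _ _ _ => b ≤ k) F) (h : a < b) :
    Low (Lead a f g e) F :=
  Low.mono hF fun _ _ _ _ _ hk => ⟨by omega, by omega⟩

theorem Low.ge_of_lead {a f g e : ℤ} (hF : Low (Lead a f g e) F) : Low (fun k _ _ _ _ => a ≤ k) F :=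
  Low.mono hF fun _ _ _ _ _ h => h.1

theorem low_cst_nonneg (c : Expr) : Low (fun k _ _ _ _ => 0 ≤ k) (cst c) :=
  low_cst fun _ _ => le_rfl

theorem Low.mul_ge {a b c : ℤ} (hF : Low (fun k _ _ _ _ => a ≤ k) F)
    (hG : Low (fun k _ _ _ _ => b ≤ k) G) (hc : a + b = c := by norm_num) :
    Low (fun k _ _ _ _ => c ≤ k) (F * G) :=
  Low.mul hF hG fun _ _ _ _ _ _ _ _ _ _ h h' => by omega

theorem lead_cosA (s : ℤ) : Low (Lead 0 0 0 0) (cst (cosA 0 0 0 s)) := by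
  rw [cosA, cst_add]
  exact Low.add (lead_single _ (by simp [angle]) (by simp [angle]) (by simp [angle]))
    (lead_single _ (by simp [angle]) (by simp [angle]) (by simp [angle]))

theorem lead_sinA (s : ℤ) : Low (Lead 0 0 0 0) (cst (sinA 0 0 0 s)) := by
  rw [sinA, cst_sub]
  exact Low.sub (lead_single _ (by simp [angle]) (by simp [angle]) (by simp [angle]))
    (lead_single _ (by simp [angle]) (by simp [angle]) (by simp [angle]))

end

namespace Params

variable (P : Params)

/-- The part of `a₁ (1 - σ^ν₁ e₁ cos E₁) / ‖r₁‖` of positive order in `σ`. -/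
def unitTail : Ser := -(cst (num P.a₁ * sym Sym.ρ (-1)) *
  (sig P.ν₁ * cst (num P.e₁ * cosA 0 0 0 1)))

theorem unitFactor_eq : P.unitFactor = cst (num P.a₁ * sym Sym.ρ (-1)) + P.unitTail := by
  rw [unitFactor, unitTail]; ring

theorem lead_a₁_div_ρ : Low (Lead 0 0 0 0) (cst (num P.a₁ * sym Sym.ρ (-1))) := by
  rw [cst_mul]
  exact Low.mul_lead (lead_num _) (lead_sym (by decide) (by decide) (by decide))

theorem lead_unitTail : Low (Lead P.ν₁ 0 0 0) P.unitTail := by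
  have h : Low (Lead 0 0 0 0) (cst (num P.e₁ * cosA 0 0 0 1)) := by
    rw [cst_mul]
    exact Low.mul_lead (lead_num _) (lead_cosA _)
  exact Low.neg (Low.lead_zero_mul P.lead_a₁_div_ρ (Low.mul_lead_zero (lead_sig _) h))

theorem lead_unitFactor (hν : 1 ≤ P.ν₁) : Low (Lead 0 0 0 0) P.unitFactor := by
  rw [unitFactor_eq]
  exact Low.add P.lead_a₁_div_ρ (P.lead_unitTail.ge_of_lead.lead_of_pos (by omega))

theorem lead_invL : Low (Lead 0 0 0 0) P.invL := by
  classical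
  refine In.ofPowerSeries fun k n => ?_
  rw [invLP, PowerSeries.coeff_mk, MvPowerSeries.coeff_C]
  split_ifs
  · rw [num, sym, AddMonoidAlgebra.single_mul_single]
    refine single_mem_supp ⟨by positivity, fun _ => ?_⟩
    simp
  · exact zero_mem _

theorem lead_split (x : Expr) : Low (Lead 0 0 0 0) (split x) :=
  Low.add lead_one ((Low.mul_ge (low_cst_nonneg _) (lead_sig 2).ge_of_lead (zero_add 2)).lead_of_pos
    (by norm_num))

/-- The part of `∂f/∂ℓ` of positive order in `σ`. -/
def f_ℓTail : Ser :=
  2 * (cst (sym Sym.e 1) * cst (cosA 1 0 0 0) * sig 1) +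
    sig 2 * ((cst (sym Sym.e 1 * cosA 1 0 0 0)) ^ 2 * split (sym Sym.η (-3)) +
      cst (sym Sym.η (-3) - 1) * (1 + 2 * (cst (sym Sym.e 1 * cosA 1 0 0 0) * sig 1)))

theorem f_ℓ_eq : f_ℓ = 1 + f_ℓTail := by
  have h : sig 2 = sig 1 * sig 1 := by rw [sig_mul]; rfl
  rw [f_ℓ, f_ℓTail, split, h, cst_mul]
  ring

end Params

/-! ### Euler operators of `e exp(± i f)` at fixed `f + g`. -/

/-- Half the difference of the excess exponent of `f` over `g` and the exponent of `e`. -/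
def wp (m : Sym → ℤ) : ℂ := ((m Sym.f : ℂ) - m Sym.g - m Sym.e) / 2

/-- Half the sum of the excess exponent of `f` over `g` and the exponent of `e`. -/
def wq (m : Sym → ℤ) : ℂ := ((m Sym.f : ℂ) - m Sym.g + m Sym.e) / 2

/-- On exponents this is `f = g + wp + wq`. The derivative in `f` splits into the derivative in `θ =
f + g` at fixed `x, y` and the rotation of `x = e exp(i f)`, `y = e exp(-i f)`. -/
theorem dAngle_f_eq (F : Ser) : act (dAngle Sym.f) F = act (dAngle Sym.g) F +
    cst (AddMonoidAlgebra.single 0 Complex.I) * (act (diag wp) F + act (diag wq) F) := by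
  refine Ser.ext_cf fun k n => ?_
  have hc : ∀ c, cst c = HahnSeries.single (0 : ℤ) (MvPowerSeries.C c : Coef) := fun _ => rfl
  rw [hc, cf_add]
  simp only [cf]
  rw [HahnSeries.coeff_single_zero_mul, MvPowerSeries.coeff_C_mul]
  simp only [HahnSeries.coeff_add, map_add]
  change dAngle Sym.f (cf F k n) = dAngle Sym.g (cf F k n) +
    AddMonoidAlgebra.single 0 Complex.I * (diag wp (cf F k n) + diag wq (cf F k n))
  have : dAngle Sym.f = dAngle Sym.g + LinearMap.mulLeft ℂ (AddMonoidAlgebra.single 0 Complex.I) ∘ₗ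
      (diag wp + diag wq) := by
    refine linearMap_eq_on_single fun m => ?_
    simp only [dAngle_eq_diag, LinearMap.add_apply, LinearMap.comp_apply, diag_single,
      LinearMap.mulLeft_apply, mul_add, AddMonoidAlgebra.single_mul_single, zero_add,
      ← AddMonoidAlgebra.single_add, wp, wq]
    congr 1
    ring
  rw [this]; rfl

theorem act_diag_e (F : Ser) :
    act (diag fun m => (m Sym.e : ℂ)) F = act (diag wq) F - act (diag wp) F := by
  refine Ser.ext_cf fun k n => ?_
  rw [cf_sub, cf_act, cf_act, cf_act]
  have : diag (fun m => (m Sym.e : ℂ)) = diag wq - diag wp := by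
    refine linearMap_eq_on_single fun m => ?_
    simp only [diag_single, LinearMap.sub_apply, ← AddMonoidAlgebra.single_sub, wp, wq]
    congr 1
    ring
  rw [this]; rfl

theorem dSym_e_eq (F : Ser) : act (dSym Sym.e) F =
    cst (sym Sym.e (-1)) * (act (diag wq) F - act (diag wp) F) := by
  rw [act_dSym, act_diag_e]

section
variable {Q : ℤ → ℕ → ℤ → ℤ → ℤ → Prop} {F : Ser}

theorem Low.wp (hF : Low Q F) :
    Low (fun k n f g e => Q k n f g e ∧ f - g ≠ 1 * e) (act (diag wp) F) :=
  Sup.mono' (Sup.diag hF) fun _ _ m h => ⟨h.1, fun h0 => h.2 (by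
    have : (m Sym.f : ℂ) - m Sym.g = m Sym.e := by rw [one_mul] at h0; exact_mod_cast h0
    rw [ClosedForm.wp, this]; simp)⟩

theorem Low.wq (hF : Low Q F) :
    Low (fun k n f g e => Q k n f g e ∧ f - g ≠ -1 * e) (act (diag wq) F) :=
  Sup.mono' (Sup.diag hF) fun _ _ m h => ⟨h.1, fun h0 => h.2 (by
    have : (m Sym.f : ℂ) - m Sym.g = -m Sym.e := by rw [neg_one_mul] at h0; exact_mod_cast h0
    rw [ClosedForm.wq, this]; simp)⟩

theorem Low.wq_sub_wp (hF : Low Q F) :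
    Low (fun k n f g e => Q k n f g e ∧ (f ≠ g ∨ e ≠ 0))
      (act (diag ClosedForm.wq) F - act (diag ClosedForm.wp) F) :=
  Low.sub (Low.mono hF.wq fun _ _ _ _ _ h => ⟨h.1, by omega⟩)
    (Low.mono hF.wp fun _ _ _ _ _ h => ⟨h.1, by omega⟩)

theorem Low.wp_add_wq (hF : Low Q F) :
    Low (fun k n f g e => Q k n f g e ∧ (f ≠ g ∨ e ≠ 0))
      (act (diag ClosedForm.wp) F + act (diag ClosedForm.wq) F) :=
  Low.add (Low.mono hF.wp fun _ _ _ _ _ h => ⟨h.1, by omega⟩)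
    (Low.mono hF.wq fun _ _ _ _ _ h => ⟨h.1, by omega⟩)

end

/-! ### The orders in the bracket -/

/-- The bracket is regrouped by its singularity. Here `E = 1/e`, `s = σ⁻¹`, `xp, xm = exp(± i f)`,
and `p, q` are the images under `wp, wq`. The four groups on the right are regular terms, terms with
a regular coefficient and one Euler operator, `σ⁻¹` terms and `σ⁻²` terms. The leading coefficients
of `e` against `ℓ` and of `e` against `g` are opposite by `h₁` and `h₂`. The `σ⁻²` terms in `Fg` and
`Kg` therefore cancel, and only products of `p` with `q` survive at `σ⁻²`. -/
theorem bracket_expansion {R : Type*} [CommRing R]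
    (u fl iL E s xp xm i c sn M₁ M₂ V fδL eδL fG eG ηδL ηG cG sG cH sH : R)
    (Fg Fh FδL Fη Fc Fs pF qF Kg Kh KδL Kη Kc Ks pK qK : R)
    {Ff Fe Kf Ke : R} (hFf : Ff = Fg + i * (pF + qF)) (hFe : Fe = E * (qF - pF))
    (hKf : Kf = Kg + i * (pK + qK)) (hKe : Ke = E * (qK - pK))
    (h₁ : fl * (eδL * s) = iL * (E * s ^ 2 + 2 * c * s + M₁))
    (h₂ : eG * s = -(iL * (E * s ^ 2 + M₂)))
    (h₃ : fG = -(iL * (2 * sn * E * s + V)))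
    (hc : 2 * c = xp + xm) (hs : 2 * sn = -(i * (xp - xm))) (hi : i ^ 2 = -1) :
    Ff * fl * u * (Kf * fδL + KδL + Ke * eδL * s + Kη * ηδL) +
      Fg * u * (Kf * fG + Ke * eG * s + Kη * ηG + Kc * cG + Ks * sG) +
      Fh * u * (Kc * cH + Ks * sH) -
      (Ff * fδL + FδL + Fe * eδL * s + Fη * ηδL) * (Kf * fl * u) -
      (Ff * fG + Fe * eG * s + Fη * ηG + Fc * cG + Fs * sG) * (Kg * u) -
      (Fc * cH + Fs * sH) * (Kh * u) =
    (u * fl * (Ff * KδL) - u * fl * (FδL * Kf) +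
      (u * fl * ηδL * (Ff * Kη) - u * fl * ηδL * (Fη * Kf)) +
      (u * ηG * (Fg * Kη) - u * ηG * (Fη * Kg)) +
      (u * cG * (Fg * Kc) - u * cG * (Fc * Kg)) + (u * sG * (Fg * Ks) - u * sG * (Fs * Kg)) +
      (u * cH * (Fh * Kc) - u * cH * (Fc * Kh)) + (u * sH * (Fh * Ks) - u * sH * (Fs * Kh))) +
    (u * iL * M₁ * E * (Ff * (qK - pK)) - u * iL * M₁ * E * ((qF - pF) * Kf) -
      u * iL * M₂ * E * (Fg * (qK - pK)) + u * iL * M₂ * E * ((qF - pF) * Kg) -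
      u * iL * V * i * (Fg * (pK + qK)) + u * iL * V * i * ((pF + qF) * Kg)) +
    (u * iL * (2 * (s * E * xp)) * (pF * Kg) - u * iL * (2 * (s * E * xm)) * (qF * Kg) -
      u * iL * (2 * (s * E * xp)) * (Fg * pK) + u * iL * (2 * (s * E * xm)) * (Fg * qK) +
      u * iL * i * (2 * (s * E * xp)) * (pF * qK) - u * iL * i * (2 * (s * E * xp)) * (qF * pK) +
      u * iL * i * (2 * (s * E * xm)) * (pF * qK) - u * iL * i * (2 * (s * E * xm)) * (qF * pK)) +
    (u * iL * i * (2 * (s * s * (E * E))) * (pF * qK) -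
      u * iL * i * (2 * (s * s * (E * E))) * (qF * pK)) := by
  subst hFf hFe hKf hKe h₃
  linear_combination
    u * ((Fg + i * (pF + qF)) * (E * (qK - pK)) - E * (qF - pF) * (Kg + i * (pK + qK))) * h₁ +
    u * (Fg * (E * (qK - pK)) - E * (qF - pF) * Kg) * h₂ +
    u * iL * s * ((Fg + i * (pF + qF)) * (E * (qK - pK)) - E * (qF - pF) * (Kg + i * (pK + qK))) *
      hc -
    u * iL * s * E * (Fg * (i * (pK + qK)) - i * (pF + qF) * Kg) * hs +
    u * iL * s * E * (xp - xm) * (Fg * (pK + qK) - (pF + qF) * Kg) * hi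

/-! ### Singular and regular parts of the coefficients, and the resulting order bound. -/

namespace Params

variable (P : Params)

/-- `exp (i s f)`. -/
def expf (s : ℤ) : Ser := cst (AddMonoidAlgebra.single (angle s 0 0 0) 1)

/-- The imaginary unit. -/
def imag : Ser := cst (AddMonoidAlgebra.single 0 Complex.I)

/-- The coefficient of `σ²` in `∂f/∂ℓ`. -/
def f_ℓSecond : Ser :=
  (cst (sym Sym.e 1 * cosA 1 0 0 0)) ^ 2 * split (sym Sym.η (-3)) +
    cst (sym Sym.η (-3) - 1) * (1 + 2 * (cst (sym Sym.e 1 * cosA 1 0 0 0) * sig 1))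

/-- The regular part of `∂f/∂ℓ ∂e/∂δL` over `1/L`. -/
def regPart₁ : Ser :=
  f_ℓSecond * cst (sym Sym.e (-1)) + f_ℓ * cst ((sym Sym.η 2 - 1) * sym Sym.e (-1))

/-- The regular part of `∂e/∂G` over `-1/L`. -/
def regPart₂ : Ser := cst ((sym Sym.η 1 - 1) * sym Sym.e (-1))

/-- The regular part of `∂f/∂G` over `-1/L`. -/
def regPart₃ : Ser := split (sym Sym.η (-1)) * cst (num (1 / 2) * sinA 2 0 0 0) +
  cst (sym Sym.η (-1) - 1) * sig 1 * (2 * cst (sinA 1 0 0 0) * cst (sym Sym.e (-1)))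

/-- The `σ` in `2 σ e cos f` meets `σ⁻² / e` and leaves a `σ⁻¹` term without `e`. The leading term
`σ⁻² / e` is the opposite of the one in `e_G_mul`, and this causes the cancellation in
`bracket_expansion`. -/
theorem f_ℓ_mul_e_δL : f_ℓ * (P.e_δL * sig (-1)) = P.invL *
    (cst (sym Sym.e (-1)) * sig (-1) ^ 2 + 2 * cst (cosA 1 0 0 0) * sig (-1) + regPart₁) := by
  have h1 : sig 1 * sig (-1) = 1 := by rw [sig_mul]; rfl
  have h2 : sig 2 = sig 1 ^ 2 := by rw [pow_two, sig_mul]; rfl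
  have h3 : cst (sym Sym.e 1) * cst (sym Sym.e (-1)) = 1 := by
    rw [← cst_mul, sym_mul, ← cst_one]; simp [sym_zero]
  have hf : f_ℓ = 1 + 2 * (cst (sym Sym.e 1) * cst (cosA 1 0 0 0) * sig 1) +
      sig 1 ^ 2 * f_ℓSecond := by
    rw [f_ℓ_eq, f_ℓTail, f_ℓSecond, h2]
    ring
  have key : f_ℓ * (cst (sym Sym.e (-1)) * sig (-1) ^ 2) = cst (sym Sym.e (-1)) * sig (-1) ^ 2 +
      2 * cst (cosA 1 0 0 0) * sig (-1) + f_ℓSecond * cst (sym Sym.e (-1)) := by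
    rw [hf]
    linear_combination (2 * cst (cosA 1 0 0 0) * sig (-1) * sig 1 * sig (-1)) * h3 +
      (2 * cst (cosA 1 0 0 0) * sig (-1) +
        f_ℓSecond * cst (sym Sym.e (-1)) * (sig 1 * sig (-1) + 1)) * h1
  rw [e_δL, regPart₁]
  linear_combination P.invL * key +
    P.invL * f_ℓ * cst ((sym Sym.η 2 - 1) * sym Sym.e (-1)) * h1

theorem e_G_mul : P.e_G * sig (-1) =
    -(P.invL * (cst (sym Sym.e (-1)) * sig (-1) ^ 2 + regPart₂)) := by
  have h1 : sig 1 * sig (-1) = 1 := by rw [sig_mul]; rfl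
  rw [e_G, regPart₂]
  linear_combination -P.invL * cst ((sym Sym.η 1 - 1) * sym Sym.e (-1)) * h1

theorem cst_two : cst 2 = 2 := by
  rw [cst, map_ofNat, map_ofNat]

theorem f_G_eq : P.f_G =
    -(P.invL * (2 * cst (sinA 1 0 0 0) * cst (sym Sym.e (-1)) * sig (-1) + regPart₃)) := by
  have h1 : sig 1 * sig (-1) = 1 := by rw [sig_mul]; rfl
  have h2 : sig 2 = sig 1 ^ 2 := by rw [pow_two, sig_mul]; rfl
  rw [f_G, regPart₃, fAct, split, h2, cst_mul (2 * sinA 1 0 0 0), cst_mul 2, cst_two]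
  linear_combination -P.invL * cst (sym Sym.η (-1) - 1) * sig 1 *
    (2 * cst (sinA 1 0 0 0) * cst (sym Sym.e (-1))) * h1

theorem neg_angle_f (s : ℤ) : -angle s 0 0 0 = angle (-s) 0 0 0 := by
  ext v; cases v <;> simp [angle]

theorem two_cos_f : 2 * cst (cosA 1 0 0 0) = expf 1 + expf (-1) := by
  rw [expf, expf, ← cst_two, ← cst_mul, ← cst_add, cosA, neg_angle_f, two_mul]
  congr 1
  rw [add_add_add_comm, ← AddMonoidAlgebra.single_add, ← AddMonoidAlgebra.single_add]
  norm_num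

theorem two_sin_f : 2 * cst (sinA 1 0 0 0) = -(imag * (expf 1 - expf (-1))) := by
  rw [expf, expf, imag, ← cst_two, ← cst_mul, ← cst_sub, ← cst_mul, ← cst_neg, sinA, neg_angle_f,
    two_mul]
  congr 1
  rw [sub_add_sub_comm, ← AddMonoidAlgebra.single_add, ← AddMonoidAlgebra.single_add, mul_sub,
    AddMonoidAlgebra.single_mul_single, AddMonoidAlgebra.single_mul_single, neg_sub, zero_add,
    zero_add, mul_one]
  have h : (1 : ℂ) / (2 * Complex.I) + 1 / (2 * Complex.I) = -Complex.I := by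
    simp
    ring
  rw [h, AddMonoidAlgebra.single_neg, AddMonoidAlgebra.single_neg]
  abel

theorem imag_sq : imag ^ 2 = -1 := by
  rw [imag, pow_two, ← cst_mul, AddMonoidAlgebra.single_mul_single, Complex.I_mul_I, add_zero,
    AddMonoidAlgebra.single_neg, ← AddMonoidAlgebra.one_def, cst_neg, cst_one]

theorem bracket_eq_expansion {F K : Ser} (hF : d_J₁ F = 0) (hK : d_J₁ K = 0) :
    P.bracket F K = P.d_ℓ F * P.d_δL K + P.d_g F * P.d_G K + P.d_h F * P.d_H K -
      P.d_δL F * P.d_ℓ K - P.d_G F * P.d_g K - P.d_H F * P.d_h K := by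
  rw [bracket, hF, hK]; ring

theorem low_two {Q : ℤ → ℕ → ℤ → ℤ → ℤ → Prop} {F : Ser} (h : Low Q F) : Low Q (2 * F) := by
  rw [two_mul]; exact h.add h

theorem low_nonneg_mul {F G : Ser} (hF : Low (fun k _ _ _ _ => 0 ≤ k) F)
    (hG : Low (fun k _ _ _ _ => 0 ≤ k) G) : Low (fun k _ _ _ _ => 0 ≤ k) (F * G) :=
  hF.mul_ge hG (add_zero _)

theorem low_nonneg_f_ℓ : Low (fun k _ _ _ _ => 0 ≤ k) f_ℓ := by
  have h : Low (fun k _ _ _ _ => 0 ≤ k) (1 + cst (sym Sym.e 1 * cosA 1 0 0 0) * sig 1) :=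
    lead_one.ge_of_lead.add (Low.mono (Low.mul_ge (low_cst_nonneg _) (lead_sig 1).ge_of_lead rfl)
      fun _ _ _ _ _ h => by omega)
  rw [f_ℓ, pow_two]
  exact low_nonneg_mul (low_nonneg_mul h h) (lead_split _).ge_of_lead

theorem low_nonneg_sig {a : ℤ} (ha : 0 ≤ a) : Low (fun k _ _ _ _ => 0 ≤ k) (sig a) :=
  low_sig ha

theorem low_f_ℓSecond : Low (fun k _ _ _ _ => 0 ≤ k) f_ℓSecond := by
  have h := low_nonneg_mul (low_cst_nonneg (sym Sym.e 1 * cosA 1 0 0 0))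
    (low_cst_nonneg (sym Sym.e 1 * cosA 1 0 0 0))
  rw [f_ℓSecond, pow_two]
  exact (low_nonneg_mul h (lead_split _).ge_of_lead).add (low_nonneg_mul (low_cst_nonneg _)
    (lead_one.ge_of_lead.add (low_two (low_nonneg_mul (low_cst_nonneg _)
      (low_nonneg_sig (by norm_num))))))

theorem low_regPart₁ : Low (fun k _ _ _ _ => 0 ≤ k) regPart₁ :=
  (low_nonneg_mul low_f_ℓSecond (low_cst_nonneg _)).add
    (low_nonneg_mul low_nonneg_f_ℓ (low_cst_nonneg _))

theorem low_regPart₃ : Low (fun k _ _ _ _ => 0 ≤ k) regPart₃ :=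
  (low_nonneg_mul (lead_split _).ge_of_lead (low_cst_nonneg _)).add
    (low_nonneg_mul (low_nonneg_mul (low_cst_nonneg _) (low_nonneg_sig (by norm_num)))
      (low_nonneg_mul (low_two (low_cst_nonneg _)) (low_cst_nonneg _)))

theorem lead_f_ℓ : Low (Lead 0 0 0 0) f_ℓ := by
  have h : Low (fun k _ _ _ _ => 1 ≤ k) f_ℓTail := by
    refine Low.add (low_two ?_) ?_
    · exact Low.mul_ge (low_nonneg_mul (low_cst_nonneg _) (low_cst_nonneg _))
        (lead_sig 1).ge_of_lead (zero_add 1)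
    · exact Low.mono ((lead_sig 2).ge_of_lead.mul_ge low_f_ℓSecond (add_zero 2))
        fun _ _ _ _ _ h => by omega
  rw [f_ℓ_eq]
  exact lead_one.add (h.lead_of_pos zero_lt_one)

theorem lead_η_δL : Low (Lead 0 0 0 0) P.η_δL := (P.lead_invL.mul_lead_zero (lead_split _)).neg

theorem lead_ιc_H : Low (Lead 0 0 0 0) P.ιc_H := P.lead_invL.mul_lead_zero (lead_split _)

theorem lead_ιc_G : Low (Lead 0 0 0 0) P.ιc_G :=
  ((P.lead_invL.mul_lead_zero (lead_sym (by decide) (by decide) (by decide))).mul_lead_zero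
    (lead_split _)).neg

theorem lead_ιs_G : Low (Lead 0 0 0 0) P.ιs_G := by
  have h : Low (Lead 0 0 0 0) (cst ((1 - sym Sym.ιs 2) * sym Sym.ιs (-1))) := by
    rw [cst_mul, cst_sub, cst_one]
    exact (lead_one.sub (lead_sym (v := Sym.ιs) (by decide) (by decide) (by decide))).mul_lead_zero
      (lead_sym (v := Sym.ιs) (by decide) (by decide) (by decide))
  exact (P.lead_invL.mul_lead_zero h).mul_lead_zero (lead_split _)

theorem lead_ιs_H : Low (Lead 0 0 0 0) P.ιs_H := by
  have h : Low (Lead 0 0 0 0) (cst (sym Sym.ιc 1 * sym Sym.ιs (-1))) := by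
    rw [cst_mul]
    exact (lead_sym (v := Sym.ιc) (by decide) (by decide) (by decide)).mul_lead_zero
      (lead_sym (v := Sym.ιs) (by decide) (by decide) (by decide))
  exact ((P.lead_invL.mul_lead_zero h).mul_lead_zero (lead_split _)).neg

theorem lead_imag : Low (Lead 0 0 0 0) imag := lead_single _ rfl rfl rfl

theorem lead_expf (s : ℤ) : Low (Lead 0 s 0 0) (expf s) :=
  lead_single _ (by simp [angle]) (by simp [angle]) (by simp [angle])

theorem lead_inv_e : Low (Lead 0 0 0 (-1)) (cst (sym Sym.e (-1))) :=
  lead_single _ (by simp) (by simp) (by simp)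

theorem Low.mul₃ {Q₀ Q₁ Q₂ U : ℤ → ℕ → ℤ → ℤ → ℤ → Prop} {C A B : Ser} (hC : Low Q₀ C)
    (hA : Low Q₁ A) (hB : Low Q₂ B)
    (h : ∀ k₀ k₁ k₂ n₀ n₁ n₂ f₀ f₁ f₂ g₀ g₁ g₂ e₀ e₁ e₂, Q₀ k₀ n₀ f₀ g₀ e₀ → Q₁ k₁ n₁ f₁ g₁ e₁ →
      Q₂ k₂ n₂ f₂ g₂ e₂ →
      U (k₀ + k₁ + k₂) (n₀ + n₁ + n₂) (f₀ + f₁ + f₂) (g₀ + g₁ + g₂) (e₀ + e₁ + e₂)) :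
    Low U (C * (A * B)) := by
  rw [← mul_assoc]
  exact Low.mul (U := U) (Low.mul (U := fun k n f g e => ∃ k₀ k₁ n₀ n₁ f₀ f₁ g₀ g₁ e₀ e₁,
    k = k₀ + k₁ ∧ n = n₀ + n₁ ∧ f = f₀ + f₁ ∧ g = g₀ + g₁ ∧ e = e₀ + e₁ ∧ Q₀ k₀ n₀ f₀ g₀ e₀ ∧
      Q₁ k₁ n₁ f₁ g₁ e₁) hC hA fun _ _ _ _ _ _ _ _ _ _ h₁ h₂ =>
        ⟨_, _, _, _, _, _, _, _, _, _, rfl, rfl, rfl, rfl, rfl, h₁, h₂⟩) hB (by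
    rintro _ _ _ _ _ _ _ _ _ _ ⟨_, _, _, _, _, _, _, _, _, _, rfl, rfl, rfl, rfl, rfl, h₁, h₂⟩ h₃
    exact h _ _ _ _ _ _ _ _ _ _ _ _ _ _ _ h₁ h₂ h₃)

/-- The exponents of a product of three series, the first of which starts at `σ ^ a` with the
exponents `f₀`, `0`, `e₀` of `f`, `g`, `e`. -/
def Prod₃ (a f₀ e₀ : ℤ) (Q₁ Q₂ U : ℤ → ℕ → ℤ → ℤ → ℤ → Prop) : Prop :=
  ∀ k k₁ k₂ n n₁ n₂ f f₁ f₂ g g₁ g₂ e e₁ e₂, Lead a f₀ 0 e₀ k n f g e → Q₁ k₁ n₁ f₁ g₁ e₁ →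
    Q₂ k₂ n₂ f₂ g₂ e₂ → U (k + k₁ + k₂) (n + n₁ + n₂) (f + f₁ + f₂) (g + g₁ + g₂) (e + e₁ + e₂)

/-- An order bound for the bracket reduces to arithmetic on exponents, with one hypothesis for each
group of `bracket_expansion`. The inequalities `f - g ≠ ± e` say that the monomial is not killed by
`wp` or `wq`, that is, that it really depends on `y` or `x`. The condition `g ≠ 0` says the same for
the derivative in `g`. -/
theorem low_bracket (hν : 1 ≤ P.ν₁) {Q₁ Q₂ U : ℤ → ℕ → ℤ → ℤ → ℤ → Prop} {F K : Ser}
    (hF : Low Q₁ F) (hK : Low Q₂ K) (hF₀ : d_J₁ F = 0) (hK₀ : d_J₁ K = 0)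
    (reg : Prod₃ 0 0 0 Q₁ Q₂ U)
    (mix : ∀ k k₁ k₂ n n₁ n₂ f f₁ f₂ g g₁ g₂ e e₁ e₂, 0 ≤ k → Q₁ k₁ n₁ f₁ g₁ e₁ →
      Q₂ k₂ n₂ f₂ g₂ e₂ → (f₁ ≠ g₁ ∨ e₁ ≠ 0 ∨ f₂ ≠ g₂ ∨ e₂ ≠ 0) →
      U (k + k₁ + k₂) (n + n₁ + n₂) (f + f₁ + f₂) (g + g₁ + g₂) (e + e₁ + e₂))
    (sing₁ : ∀ ε : ℤ, ε = 1 ∨ ε = -1 → Prod₃ (-1) ε (-1)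
      (fun k n f g e => Q₁ k n f g e ∧ f - g ≠ ε * e) (fun k n f g e => Q₂ k n f g e ∧ g ≠ 0) U)
    (sing₁' : ∀ ε : ℤ, ε = 1 ∨ ε = -1 → Prod₃ (-1) ε (-1)
      (fun k n f g e => Q₁ k n f g e ∧ g ≠ 0) (fun k n f g e => Q₂ k n f g e ∧ f - g ≠ ε * e) U)
    (sing₁'' : ∀ ε δ : ℤ, ε = 1 ∨ ε = -1 → δ = 1 ∨ δ = -1 → Prod₃ (-1) δ (-1)
      (fun k n f g e => Q₁ k n f g e ∧ f - g ≠ ε * e)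
      (fun k n f g e => Q₂ k n f g e ∧ f - g ≠ -ε * e) U)
    (sing₂ : ∀ ε : ℤ, ε = 1 ∨ ε = -1 → Prod₃ (-2) 0 (-2)
      (fun k n f g e => Q₁ k n f g e ∧ f - g ≠ ε * e)
      (fun k n f g e => Q₂ k n f g e ∧ f - g ≠ -ε * e) U) :
    Low U (P.bracket F K) := by
  rw [P.bracket_eq_expansion hF₀ hK₀]
  have hu := P.lead_unitFactor hν
  have hi := P.lead_invL
  have hui := hu.mul_lead_zero hi
  have huii := hui.mul_lead_zero lead_imag
  -- The coefficients `2 σ⁻¹ exp(± i f) / e` and `2 σ⁻² / e²` of the singular groups: their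
  -- exponents of `f` and `e` are exactly what turns a term of degree one in `x, y` into one of
  -- degree zero.
  have hs (ε : ℤ) : Low (Lead (-1) ε 0 (-1)) (2 * (sig (-1) * cst (sym Sym.e (-1)) * expf ε)) :=
    low_two (((lead_sig (-1)).mul_lead lead_inv_e (add_zero _) (zero_add _) (zero_add _)
      (zero_add _)).mul_lead
      (lead_expf ε)
      (by norm_num) (zero_add _) (by norm_num) (by norm_num))
  have hss : Low (Lead (-2) 0 0 (-2))
      (2 * (sig (-1) * sig (-1) * (cst (sym Sym.e (-1)) * cst (sym Sym.e (-1))))) :=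
    low_two (((lead_sig (-1)).mul_lead (lead_sig (-1)) (c := -2) (f₂ := 0) (g₂ := 0)
      (e₂ := 0)).mul_lead (lead_inv_e.mul_lead lead_inv_e (c := 0) (f₂ := 0) (g₂ := 0) (e₂ := -2)))
  -- These coefficients contain various powers of `e` and harmonics of `f` already at `σ⁰`, so only
  -- their order is recorded. They occur only next to an Euler operator, as `mix` requires.
  have hm₁ := low_nonneg_mul (low_nonneg_mul hui.ge_of_lead low_regPart₁) lead_inv_e.ge_of_lead
  have hm₂ := low_nonneg_mul (low_nonneg_mul hui.ge_of_lead (low_cst_nonneg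
    ((sym Sym.η 1 - 1) * sym Sym.e (-1)))) lead_inv_e.ge_of_lead
  have hm₃ := low_nonneg_mul (low_nonneg_mul hui.ge_of_lead low_regPart₃) lead_imag.ge_of_lead
  have R {C A B : Ser} (hC : Low (Lead 0 0 0 0) C) (hA : Low Q₁ A) (hB : Low Q₂ B) :
    Low U (C * (A * B)) := Low.mul₃ hC hA hB fun _ _ _ _ _ _ _ _ _ _ _ _ _ _ _ =>
      reg _ _ _ _ _ _ _ _ _ _ _ _ _ _ _
  have Mx {C A B : Ser} (hC : Low (fun k _ _ _ _ => 0 ≤ k) C) (hA : Low Q₁ A)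
      (hB : Low (fun k n f g e => Q₂ k n f g e ∧ (f ≠ g ∨ e ≠ 0)) B) : Low U (C * (A * B)) :=
    Low.mul₃ hC hA hB fun _ _ _ _ _ _ _ _ _ _ _ _ _ _ _ h0 h1 h2 =>
      mix _ _ _ _ _ _ _ _ _ _ _ _ _ _ _ h0 h1 h2.1 (Or.inr (Or.inr h2.2))
  have Mx' {C A B : Ser} (hC : Low (fun k _ _ _ _ => 0 ≤ k) C)
      (hA : Low (fun k n f g e => Q₁ k n f g e ∧ (f ≠ g ∨ e ≠ 0)) A) (hB : Low Q₂ B) :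
      Low U (C * (A * B)) :=
    Low.mul₃ hC hA hB fun _ _ _ _ _ _ _ _ _ _ _ _ _ _ _ h0 h1 h2 =>
      mix _ _ _ _ _ _ _ _ _ _ _ _ _ _ _ h0 h1.1 h2 (h1.2.elim Or.inl fun h => Or.inr (Or.inl h))
  have one : (1 : ℤ) = 1 ∨ (1 : ℤ) = -1 := Or.inl rfl
  have neg : (-1 : ℤ) = 1 ∨ (-1 : ℤ) = -1 := Or.inr rfl
  have hδF := hF.dSym (v := Sym.δL) (by decide) (by decide) (by decide)
  have hδK := hK.dSym (v := Sym.δL) (by decide) (by decide) (by decide)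
  have hηF := hF.dSym (v := Sym.η) (by decide) (by decide) (by decide)
  have hηK := hK.dSym (v := Sym.η) (by decide) (by decide) (by decide)
  have hcF := hF.dSym (v := Sym.ιc) (by decide) (by decide) (by decide)
  have hcK := hK.dSym (v := Sym.ιc) (by decide) (by decide) (by decide)
  have hsF := hF.dSym (v := Sym.ιs) (by decide) (by decide) (by decide)
  have hsK := hK.dSym (v := Sym.ιs) (by decide) (by decide) (by decide)
  simp only [d_ℓ, d_g, d_h, d_δL, d_G, d_H]
  rw [bracket_expansion P.unitFactor f_ℓ P.invL (cst (sym Sym.e (-1))) (sig (-1)) (expf 1)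
    (expf (-1)) imag (cst (cosA 1 0 0 0)) (cst (sinA 1 0 0 0)) regPart₁ regPart₂ regPart₃ P.f_δL
    P.e_δL P.f_G P.e_G P.η_δL P.η_G P.ιc_G P.ιs_G P.ιc_H P.ιs_H _ _ _ _ _ _ _ _ _ _ _ _ _ _ _ _
    (dAngle_f_eq F) (dSym_e_eq F) (dAngle_f_eq K) (dSym_e_eq K) P.f_ℓ_mul_e_δL P.e_G_mul P.f_G_eq
    two_cos_f two_sin_f imag_sq]
  refine Low.add (Low.add (Low.add ?_ ?_) ?_) ?_
  · refine Low.add (Low.add (Low.add (Low.add (Low.add (Low.add (Low.sub ?_ ?_) (Low.sub ?_ ?_))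
      (Low.sub ?_ ?_)) (Low.sub ?_ ?_)) (Low.sub ?_ ?_)) (Low.sub ?_ ?_)) (Low.sub ?_ ?_)
    · exact R (hu.mul_lead_zero lead_f_ℓ) (hF.dAngle _) hδK
    · exact R (hu.mul_lead_zero lead_f_ℓ) hδF (hK.dAngle _)
    · exact R ((hu.mul_lead_zero lead_f_ℓ).mul_lead_zero P.lead_η_δL) (hF.dAngle _) hηK
    · exact R ((hu.mul_lead_zero lead_f_ℓ).mul_lead_zero P.lead_η_δL) hηF (hK.dAngle _)
    · exact R hui (hF.dAngle _) hηK
    · exact R hui hηF (hK.dAngle _)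
    · exact R (hu.mul_lead_zero P.lead_ιc_G) (hF.dAngle _) hcK
    · exact R (hu.mul_lead_zero P.lead_ιc_G) hcF (hK.dAngle _)
    · exact R (hu.mul_lead_zero P.lead_ιs_G) (hF.dAngle _) hsK
    · exact R (hu.mul_lead_zero P.lead_ιs_G) hsF (hK.dAngle _)
    · exact R (hu.mul_lead_zero P.lead_ιc_H) (hF.dAngle _) hcK
    · exact R (hu.mul_lead_zero P.lead_ιc_H) hcF (hK.dAngle _)
    · exact R (hu.mul_lead_zero P.lead_ιs_H) (hF.dAngle _) hsK
    · exact R (hu.mul_lead_zero P.lead_ιs_H) hsF (hK.dAngle _)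
  · refine Low.add (Low.sub (Low.add (Low.sub (Low.sub ?_ ?_) ?_) ?_) ?_) ?_
    · exact Mx hm₁ (hF.dAngle _) hK.wq_sub_wp
    · exact Mx' hm₁ hF.wq_sub_wp (hK.dAngle _)
    · exact Mx hm₂ (hF.dAngle _) hK.wq_sub_wp
    · exact Mx' hm₂ hF.wq_sub_wp (hK.dAngle _)
    · exact Mx hm₃ (hF.dAngle _) hK.wp_add_wq
    · exact Mx' hm₃ hF.wp_add_wq (hK.dAngle _)
  · refine Low.sub (Low.add (Low.sub (Low.add (Low.add (Low.sub (Low.sub ?_ ?_) ?_) ?_) ?_) ?_)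
      ?_) ?_
    · exact Low.mul₃ (hui.lead_zero_mul (hs 1)) hF.wp hK.dAngle_g (sing₁ 1 one)
    · exact Low.mul₃ (hui.lead_zero_mul (hs (-1))) hF.wq hK.dAngle_g (sing₁ (-1) neg)
    · exact Low.mul₃ (hui.lead_zero_mul (hs 1)) hF.dAngle_g hK.wp (sing₁' 1 one)
    · exact Low.mul₃ (hui.lead_zero_mul (hs (-1))) hF.dAngle_g hK.wq (sing₁' (-1) neg)
    · exact Low.mul₃ (huii.lead_zero_mul (hs 1)) hF.wp hK.wq (sing₁'' 1 1 one one)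
    · exact Low.mul₃ (huii.lead_zero_mul (hs 1)) hF.wq hK.wp (sing₁'' (-1) 1 neg one)
    · exact Low.mul₃ (huii.lead_zero_mul (hs (-1))) hF.wp hK.wq (sing₁'' 1 (-1) one neg)
    · exact Low.mul₃ (huii.lead_zero_mul (hs (-1))) hF.wq hK.wp (sing₁'' (-1) (-1) neg neg)
  · refine Low.sub ?_ ?_
    · exact Low.mul₃ (huii.lead_zero_mul hss) hF.wp hK.wq (sing₂ 1 one)
    · exact Low.mul₃ (huii.lead_zero_mul hss) hF.wq hK.wp (sing₂ (-1) neg)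

end Params

/-! ### Low orders of Lie derivatives and convergence of Lie series -/

/-- A condition on `χ` under which `{·, χ}` does not lower the order in `σ` and raises the total
order in `σ` and `μ`. -/
def Contracting (χ : Ser) : Prop :=
  Low (fun k n f g e => 1 ≤ k ∧ ((f ≠ 0 ∨ g ≠ 0) → 2 ≤ k + n) ∧
    ((f ≠ g ∨ e ≠ 0) → 2 ≤ k ∧ 3 ≤ k + n)) χ

namespace Params

variable (P : Params) {F χ : Ser}

/-- A derivative of `χ` in `g` costs `σ⁻¹`, and then `χ` has total order at least `2`. A factor
`σ⁻²` requires dependence of `χ` on `x, y`, where the order in `σ` is at least `2` and the total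
order at least `3`. In both cases one unit of total order remains and no power of `σ` is lost. -/
theorem lie_filtration (hν : 1 ≤ P.ν₁) (hχ : Contracting χ) (hF₀ : d_J₁ F = 0) (hχ₀ : d_J₁ χ = 0)
    {a d : ℤ} (hF : Low (fun k n _ _ _ => a ≤ k ∧ d ≤ k + n) F) :
    Low (fun k n _ _ _ => a ≤ k ∧ d + 1 ≤ k + n) (P.lie χ F) := by
  refine P.low_bracket hν hF hχ hF₀ hχ₀ ?_ ?_ ?_ ?_ ?_ ?_
  · intro k k₁ k₂ n n₁ n₂ f f₁ f₂ g g₁ g₂ e e₁ e₂ h h' h''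
    unfold Lead at h
    push_cast
    omega
  · intro k k₁ k₂ n n₁ n₂ f f₁ f₂ g g₁ g₂ e e₁ e₂ h h' h'' h₃
    push_cast
    omega
  all_goals try rintro ε δ (rfl | rfl) (rfl | rfl)
  all_goals try rintro ε (rfl | rfl)
  all_goals
    intro k k₁ k₂ n n₁ n₂ f f₁ f₂ g g₁ g₂ e e₁ e₂ h h' h''
    unfold Lead at h
    push_cast
    omega

/-- The Lie derivative of a series that does not depend on `f`, `g`, `e` up to `σ ^ 2`. -/
theorem lie_secular (hν : 1 ≤ P.ν₁) {j : ℤ} (hF₀ : d_J₁ F = 0) (hχ₀ : d_J₁ χ = 0)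
    (hF : Low (fun k _ f g e => 1 ≤ k ∧ (k < 3 → f = 0 ∧ g = 0 ∧ e = 0)) F)
    (hχ : Low (fun k _ _ _ _ => j ≤ k) χ) :
    Low (fun k _ _ _ _ => j + 1 ≤ k) (P.lie χ F) := by
  refine P.low_bracket hν hF hχ hF₀ hχ₀ ?_ ?_ ?_ ?_ ?_ ?_
  · intro k k₁ k₂ n n₁ n₂ f f₁ f₂ g g₁ g₂ e e₁ e₂ h h' h''
    unfold Lead at h
    omega
  · intro k k₁ k₂ n n₁ n₂ f f₁ f₂ g g₁ g₂ e e₁ e₂ h h' h'' h₃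
    omega
  -- Every singular term differentiates `F` in `g`, `x` or `y`, hence sees only its terms from `σ³`
  -- on. The loss of two still leaves a gain of one over the order of `χ`.
  all_goals try rintro ε δ (rfl | rfl) (rfl | rfl)
  all_goals try rintro ε (rfl | rfl)
  all_goals
    intro k k₁ k₂ n n₁ n₂ f f₁ f₂ g g₁ g₂ e e₁ e₂ h h' h''
    unfold Lead at h
    omega

/-- If `χ` is of order `σ ^ 3`, or of order `σ ^ 2` and independent of `e` and `f - g`, then
`{·, χ}` raises the order in `σ`. -/
theorem lie_raises (hν : 1 ≤ P.ν₁) (hF₀ : d_J₁ F = 0) (hχ₀ : d_J₁ χ = 0) {a : ℤ}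
    (hF : Low (fun k _ _ _ _ => a ≤ k) F)
    (hχ : Low (fun k _ f g e => 2 ≤ k ∧ (k < 3 → f = g ∧ e = 0)) χ) :
    Low (fun k _ _ _ _ => a + 1 ≤ k) (P.lie χ F) := by
  refine P.low_bracket hν hF hχ hF₀ hχ₀ ?_ ?_ ?_ ?_ ?_ ?_
  · intro k k₁ k₂ n n₁ n₂ f f₁ f₂ g g₁ g₂ e e₁ e₂ h h' h''
    unfold Lead at h
    omega
  · intro k k₁ k₂ n n₁ n₂ f f₁ f₂ g g₁ g₂ e e₁ e₂ h h' h'' h₃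
    omega
  -- Where `χ` is differentiated in `x` or `y` it has order at least `3`, and the loss is at most
  -- `2`. Where it is differentiated in `g` it has order at least `2`, and the loss is `1`.
  all_goals try rintro ε δ (rfl | rfl) (rfl | rfl)
  all_goals try rintro ε (rfl | rfl)
  all_goals
    intro k k₁ k₂ n n₁ n₂ f f₁ f₂ g g₁ g₂ e e₁ e₂ h h' h''
    unfold Lead at h
    omega

/-- Up to `σ ^ 1` the exponents are those of a function of `f + g`, and at `σ ^ 2` those of a
polynomial of degree at most one in `e cos f`, `e sin f` over such functions. -/
theorem lie_first (hν : 1 ≤ P.ν₁) (hF₀ : d_J₁ F = 0) (hχ₀ : d_J₁ χ = 0)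
    (hF : Low (fun k _ f g e => 1 ≤ k ∧ (k = 1 → f = g ∧ e = 0) ∧
      (k = 2 → f = g ∧ e = 0 ∨ e = 1 ∧ (f - g = 1 ∨ f - g = -1))) F)
    (hχ : Low (fun k _ f g e => 1 ≤ k ∧ f = g ∧ e = 0) χ) :
    Low (fun k _ f g e => 2 ≤ k ∧ (k = 2 → f = g ∧ e = 0)) (P.lie χ F) := by
  refine P.low_bracket hν hF hχ hF₀ hχ₀ ?_ ?_ ?_ ?_ ?_ ?_
  · intro k k₁ k₂ n n₁ n₂ f f₁ f₂ g g₁ g₂ e e₁ e₂ h h' h''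
    unfold Lead at h
    omega
  · intro k k₁ k₂ n n₁ n₂ f f₁ f₂ g g₁ g₂ e e₁ e₂ h h' h'' h₃
    omega
  -- Since `wp` and `wq` kill `χ`, only the terms pairing an `x`- or `y`-derivative of `F` with the
  -- `g`-derivative of `χ` remain. They see `F` from `σ²` on, and at `σ²` the differentiation
  -- removes the single `x` or `y`.
  all_goals try rintro ε δ (rfl | rfl) (rfl | rfl)
  all_goals try rintro ε (rfl | rfl)
  all_goals
    intro k k₁ k₂ n n₁ n₂ f f₁ f₂ g g₁ g₂ e e₁ e₂ h h' h''
    unfold Lead at h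
    omega

/-- Only the `σ⁻²` part reaches `σ²`. It pairs a term linear in `x` with a term linear in `y`, and
the result contains neither. The conclusion is stronger than the hypothesis on `F`, so the bound can
be iterated. -/
theorem lie_second (hν : 1 ≤ P.ν₁) (hF₀ : d_J₁ F = 0) (hχ₀ : d_J₁ χ = 0)
    (hF : Low (fun k _ f g e => 2 ≤ k ∧
      (k = 2 → f = g ∧ e = 0 ∨ e = 1 ∧ (f - g = 1 ∨ f - g = -1))) F)
    (hχ : Low (fun k _ f g e => 2 ≤ k ∧
      (k = 2 → f = g ∧ e = 0 ∨ e = 1 ∧ (f - g = 1 ∨ f - g = -1))) χ) :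
    Low (fun k _ f g e => 2 ≤ k ∧ (k = 2 → f = g ∧ e = 0)) (P.lie χ F) := by
  refine P.low_bracket hν hF hχ hF₀ hχ₀ ?_ ?_ ?_ ?_ ?_ ?_
  · intro k k₁ k₂ n n₁ n₂ f f₁ f₂ g g₁ g₂ e e₁ e₂ h h' h''
    unfold Lead at h
    omega
  · intro k k₁ k₂ n n₁ n₂ f f₁ f₂ g g₁ g₂ e e₁ e₂ h h' h'' h₃
    omega
  all_goals try rintro ε δ (rfl | rfl) (rfl | rfl)
  all_goals try rintro ε (rfl | rfl)
  all_goals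
    intro k k₁ k₂ n n₁ n₂ f f₁ f₂ g g₁ g₂ e e₁ e₂ h h' h''
    unfold Lead at h
    omega

end Params

/-- A family of series, finitely many of which contribute to every coefficient, has a sum. -/
theorem exists_formal_sum (T : ℕ → Ser) (a : ℤ) (h₀ : ∀ i k n, k < a → cf (T i) k n = 0)
    (N : ℤ → (Fin 2 →₀ ℕ) → ℕ) (h : ∀ i k n, N k n ≤ i → cf (T i) k n = 0) :
    ∃ G : Ser, ∀ k n M, N k n ≤ M → cf G k n = cf (∑ i ∈ Finset.range M, T i) k n := by
  have hb : BddBelow (Function.support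
      fun k : ℤ => ((fun n => ∑ i ∈ Finset.range (N k n), cf (T i) k n : Coef))) := by
    refine ⟨a, fun k hk => ?_⟩
    by_contra hka
    refine hk (funext fun n => ?_)
    exact Finset.sum_eq_zero fun i _ => h₀ i k n (by omega)
  refine ⟨HahnSeries.ofSuppBddBelow _ hb, fun k n M hM => ?_⟩
  rw [cf_sum, ← Finset.sum_range_add_sum_Ico _ hM]
  rw [Finset.sum_eq_zero (s := Finset.Ico _ _) fun i hi => h i k n (Finset.mem_Ico.mp hi).1, add_zero]
  rfl

theorem cf_cst_mul (c : Expr) (F : Ser) (k n) : cf (cst c * F) k n = c * cf F k n := by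
  have hc : cst c = HahnSeries.single (0 : ℤ) (MvPowerSeries.C c : Coef) := rfl
  rw [hc]
  simp only [cf]
  rw [HahnSeries.coeff_single_zero_mul, MvPowerSeries.coeff_C_mul]

theorem cf_sig_mul (a : ℤ) (F : Ser) (k n) : cf (sig a * F) k n = cf F (k - a) n := by
  rw [sig]
  simp only [cf]
  rw [HahnSeries.coeff_single_mul, one_mul]

theorem num_mul_mem_supp {S : (Sym → ℤ) → Prop} (x : ℝ) {c : Expr} (hc : c ∈ supp S) :
    num x * c ∈ supp S :=
  mul_mem_supp (S := fun m => m = 0) (single_mem_supp rfl) hc fun m m' h h' => by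
    rw [h, zero_add]; exact h'

theorem Low.eq_zero {Q : ℤ → ℕ → ℤ → ℤ → ℤ → Prop} {F : Ser} (hF : Low Q F) {k : ℤ}
    {n : Fin 2 →₀ ℕ} (h : ∀ f g e, ¬Q k (n 0) f g e) : cf F k n = 0 := by
  ext m
  by_contra hm
  exact h _ _ _ (hF k n m hm)

namespace Params

variable (P : Params)

/-- `𝒵₀` is kept apart because it contains `J₁` and has no factor `ρ⁻¹`; its first bracket is known
from the homological equation. All later terms of the Lie series lie in the classes preserved by the
bracket, so they inherit the bound `Q` and the factor `ρ⁻¹`. -/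
theorem exists_lieSeries (hν : 1 ≤ P.ν₁) {χ B : Ser} (hχ : Contracting χ) (hχf : Frm 0 (-1) χ)
    (hB : Frm 0 1 B) (hB₁ : Low (fun k _ _ _ _ => 0 ≤ k) B) (hZ : Frm 0 1 (P.lie χ P.Z₀))
    (hZ₁ : Low (fun k _ _ _ _ => 0 ≤ k) (P.lie χ P.Z₀))
    (hZ₀ : Low (fun k _ _ _ _ => 0 ≤ k) P.Z₀) {Q : ℤ → ℕ → ℤ → ℤ → ℤ → Prop}
    (h₁ : Low Q (P.lie χ B)) (h₂ : Low Q (P.lie χ (P.lie χ P.Z₀)))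
    (h₃ : ∀ F, Frm 0 1 F → Low Q F → Low Q (P.lie χ F)) :
    ∃ G, P.IsLieSeries χ (P.Z₀ + B) G ∧ Frm (-1) 1 (G - (P.Z₀ + B + P.lie χ P.Z₀)) ∧
      Low Q (G - (P.Z₀ + B + P.lie χ P.Z₀)) := by
  have hstep {F : Ser} (hF : Frm 0 1 F) : Frm (-1) 1 (P.lie χ F) := P.frm_bracket hF hχf
  have hup {F : Ser} (hF : Frm (-1) 1 F) : Frm 0 1 F := hF.mono (by norm_num)
  set L : ℕ → Ser := fun i => (fun K => P.bracket K χ)^[i] (P.Z₀ + B) with hL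
  have hLs (i) : L (i + 1) = P.lie χ (L i) := Function.iterate_succ_apply' _ _ _
  have hL₁ : L 1 = P.lie χ P.Z₀ + P.lie χ B := by rw [hLs]; exact map_add _ _ _
  -- The total order in `σ` and `μ` grows by one with each bracket. The index is shifted because
  -- `{𝒵₀, χ}` is only known to have order at least `0`.
  have hF (i) : Frm 0 1 (L (i + 1)) ∧
      Low (fun k n _ _ _ => 0 ≤ k ∧ (i : ℤ) ≤ k + n) (L (i + 1)) := by
    induction i with
    | zero =>
      refine ⟨by rw [hL₁]; exact hZ.add (hup (hstep hB)), ?_⟩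
      rw [hL₁]
      refine Low.add (hZ₁.mono fun _ _ _ _ _ h => ⟨h, by push_cast; omega⟩) ?_
      refine (P.lie_filtration hν hχ hB.d_J₁_eq_zero hχf.d_J₁_eq_zero (a := 0) (d := 0)
        (hB₁.mono fun _ _ _ _ _ h => ⟨h, by omega⟩)).mono fun _ _ _ _ _ h => ⟨h.1, ?_⟩
      push_cast
      omega
    | succ i ih =>
      refine ⟨by rw [hLs]; exact hup (hstep ih.1), ?_⟩
      rw [hLs]
      refine (P.lie_filtration hν hχ ih.1.d_J₁_eq_zero hχf.d_J₁_eq_zero ih.2).mono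
        fun _ _ _ _ _ h => ?_
      push_cast at *
      exact h
  have hM (i) : Frm (-1) 1 (L (i + 2)) ∧ Low Q (L (i + 2)) := by
    induction i with
    | zero =>
      rw [hLs, hL₁, map_add]
      exact ⟨(hstep hZ).add (hstep (hup (hstep hB))), h₂.add (h₃ _ (hup (hstep hB)) h₁)⟩
    | succ i ih =>
      rw [hLs]
      exact ⟨hstep (hF _).1, h₃ _ (hF _).1 ih.2⟩
  set T : ℕ → Ser := fun i => cst (num ((i.factorial : ℝ)⁻¹)) * L i with hT
  obtain ⟨G, hG⟩ := exists_formal_sum T 0 (fun i k n hk => by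
      rw [hT, cf_cst_mul]
      have : cf (L i) k n = 0 := by
        cases i with
        | zero =>
          exact Low.eq_zero (Low.add hZ₀ hB₁) fun _ _ _ => by omega
        | succ i => exact Low.eq_zero (hF i).2 fun _ _ _ h => by omega
      rw [this, mul_zero])
    -- `L (i + 1)` has total order at least `i`, so it does not reach the coefficient `σ^k μ^(n 0)`
    -- once `i > k + n 0`. The `2` also guarantees that the terms of index `0` and `1` can be split
    -- off.
    (fun k n => (k + n 0).toNat + 2) (fun i k n hi => by
      obtain ⟨i, rfl⟩ : ∃ l, i = l + 1 := ⟨i - 1, by omega⟩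
      rw [hT, cf_cst_mul, Low.eq_zero (hF i).2 fun _ _ _ h => by omega, mul_zero])
  refine ⟨G, fun k n => ?_, ?_⟩
  · filter_upwards [Filter.eventually_ge_atTop ((k + n 0).toNat + 2)] with N hN
    exact (hG k n N hN).symm
  · have key (k n) : cf (G - (P.Z₀ + B + P.lie χ P.Z₀)) k n =
        cf (P.lie χ B + ∑ i ∈ Finset.range (k + n 0).toNat, T (i + 2)) k n := by
      rw [cf_sub, hG k n _ le_rfl, ← cf_sub]
      congr 1
      rw [Finset.sum_range_succ', Finset.sum_range_succ', hT]
      simp only [zero_add, Nat.factorial_zero, Nat.factorial_one, Nat.cast_one, inv_one, hL₁]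
      have : cst (num 1) = 1 := by rw [← cst_one]; rfl
      rw [this]
      have : L 0 = P.Z₀ + B := rfl
      rw [this]
      ring
    constructor
    · intro k n
      rw [key]
      refine In.add (hstep hB) (In.sum fun i _ => ?_) k n
      intro k n
      rw [hT, cf_cst_mul]
      exact num_mul_mem_frm _ ((hM i).1 k n)
    · intro k n
      rw [key]
      refine In.add h₁ (In.sum fun i _ => ?_) k n
      intro k n
      rw [hT, cf_cst_mul]
      exact num_mul_mem_supp _ ((hM i).2 k n)

end Params

/-! ### The homological equation -/

theorem act_sig_mul (D : Expr →ₗ[ℂ] Expr) (a : ℤ) (F : Ser) : act D (sig a * F) = sig a * act D F :=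
  Ser.ext_cf fun k n => by rw [cf_act, cf_sig_mul, cf_sig_mul, cf_act]

theorem act_eq_zero {D : Expr →ₗ[ℂ] Expr} {S : ℤ → (Fin 2 →₀ ℕ) → (Sym → ℤ) → Prop} {F : Ser}
    (hF : Sup S F) (h : ∀ k n m, S k n m → D (AddMonoidAlgebra.single m 1) = 0) :
    act D F = 0 := Ser.ext_cf fun k n => by
  rw [cf_act, cf_zero]
  have : D (cf F k n) ∈ (⊥ : AddSubgroup Expr) := linear_mem D (hF k n) fun m hm z _ => by
    have hz : (AddMonoidAlgebra.single m z : Expr) = z • AddMonoidAlgebra.single m 1 := by simp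
    rw [hz, map_smul, h k n m hm, smul_zero]
    exact zero_mem _
  simpa using this

theorem Sup.onMonomials {T : (Sym → ℤ) → Expr} {S U : ℤ → (Fin 2 →₀ ℕ) → (Sym → ℤ) → Prop}
    {F : Ser} (hF : Sup S F) (h : ∀ k n m, S k n m → T m ∈ supp (U k n)) :
    Sup U (act (onMonomials T) F) :=
  In.act hF fun k n _ ha => linear_mem _ ha fun m hm z _ => by
    rw [onMonomials_single]
    intro m' hm'
    exact h k n m hm m' (right_ne_zero_of_mul (by simpa using hm'))

/-- The part of `F` of order `σ ^ j`. -/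
def part (j : ℤ) (F : Ser) : Ser := HahnSeries.single j (F.coeff j)

theorem cf_part (j : ℤ) (F : Ser) (k n) : cf (part j F) k n = if k = j then cf F k n else 0 := by
  rw [part, cf_single]
  split_ifs with h
  · rw [h]; rfl
  · rfl

theorem In.part {M : Fam} {j : ℤ} {F : Ser} (hF : In M F) : In M (part j F) := fun k n => by
  rw [cf_part]
  split_ifs
  · exact hF k n
  · exact zero_mem _

theorem Sup.part {S : ℤ → (Fin 2 →₀ ℕ) → (Sym → ℤ) → Prop} {j : ℤ} {F : Ser} (hF : Sup S F) :
    Sup (fun k n m => k = j ∧ S k n m) (part j F) := fun k n m hm => by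
  rw [cf_part] at hm
  split_ifs at hm with h
  · exact ⟨h, hF k n m hm⟩
  · simp at hm

theorem Sup.sub_part {S : ℤ → (Fin 2 →₀ ℕ) → (Sym → ℤ) → Prop} {j : ℤ} {F : Ser} (hF : Sup S F) :
    Sup (fun k n m => k ≠ j ∧ S k n m) (F - ClosedForm.part j F) := fun k n m hm => by
  rw [cf_sub, cf_part] at hm
  split_ifs at hm with h
  · simp at hm
  · rw [sub_zero] at hm
    exact ⟨h, hF k n m hm⟩

theorem single_add_eq_sig_mul (a b : ℤ) (C : Coef) :
    (HahnSeries.single (a + b) C : Ser) = sig b * HahnSeries.single a C := by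
  rw [sig, HahnSeries.single_mul_single, one_mul, add_comm]

namespace Params

variable (P : Params)

theorem generator_eq (j : ℕ) (R : Ser) : P.generator j R =
    sig P.ν₁ * act P.genSlow (part j R) + act P.genFast (part j R) := by
  rw [generator, part, act_single, act_single, single_add_eq_sig_mul]

theorem secular_eq (j : ℕ) (R : Ser) : P.secular j R = act P.average (part j R) := by
  rw [secular, part, act_single]

/-- The sum telescopes: multiplication by `a₁/ρ - 1`, which is `dφ₁/dM₁`, turns a geometric sum in
`ρ/a₁` into the difference of the given monomial and its average. This explains the sum over `ψ` in
the generating function. -/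
theorem sum_slow (hn : P.n₁ ≠ 0) (ha : P.a₁ ≠ 0) (m : Sym → ℤ) (l : ℕ) :
    num P.n₁ * ((num P.a₁ * sym Sym.ρ (-1) - 1) * ∑ ψ ∈ Finset.Icc 1 l,
      AddMonoidAlgebra.single (m + Pi.single Sym.ρ (ψ : ℤ))
        ((P.a₁ : ℂ) * (P.n₁ * P.a₁ ^ (ψ - 1)))⁻¹) =
    AddMonoidAlgebra.single m 1 -
      AddMonoidAlgebra.single (m + Pi.single Sym.ρ (l : ℤ)) ((P.a₁ : ℂ) ^ l)⁻¹ := by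
  have hn' : (P.n₁ : ℂ) ≠ 0 := by exact_mod_cast hn
  have ha' : (P.a₁ : ℂ) ≠ 0 := by exact_mod_cast ha
  induction l with
  | zero => simp
  | succ l ih =>
    rw [Finset.sum_Icc_succ_top (by omega), mul_add, mul_add, ih]
    simp only [num, sym, sub_mul, mul_sub, one_mul, AddMonoidAlgebra.single_mul_single, zero_add,
      mul_one]
    have h1 : Pi.single Sym.ρ (-1) + (m + Pi.single Sym.ρ ((l + 1 : ℕ) : ℤ)) =
        m + Pi.single Sym.ρ (l : ℤ) := by
      rw [add_left_comm, ← Pi.single_add]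
      congr 2
      push_cast
      ring
    rw [h1]
    have h2 : (P.n₁ : ℂ) * (P.a₁ * ((P.a₁ : ℂ) * (P.n₁ * P.a₁ ^ (l + 1 - 1)))⁻¹) =
        ((P.a₁ : ℂ) ^ l)⁻¹ := by
      rw [Nat.add_sub_cancel]; field_simp
    have h3 : (P.n₁ : ℂ) * ((P.a₁ : ℂ) * (P.n₁ * P.a₁ ^ (l + 1 - 1)))⁻¹ =
        ((P.a₁ : ℂ) ^ (l + 1))⁻¹ := by
      rw [Nat.add_sub_cancel, pow_succ']; field_simp
    rw [h2, h3]
    abel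

/-- The homological equation on closed-form expressions. -/
theorem homological_expr (ha : P.a₁ ≠ 0)
    (hres : ∀ k k₁ : ℤ, (k : ℝ) * P.nStar + (k₁ : ℝ) * P.n₁ = 0 → k = 0 ∧ k₁ = 0)
    {c : Expr} (hc : c ∈ supp fun m => m Sym.ρ ≤ -1 ∧ m Sym.φ₁ = 0) :
    c - num P.nStar * (num P.a₁ * sym Sym.ρ (-1) * dAngle Sym.f (P.genFast c)) -
      num P.n₁ * (num P.a₁ * sym Sym.ρ (-1) * dAngle Sym.E₁ (P.genFast c)) -
      num P.n₁ * ((num P.a₁ * sym Sym.ρ (-1) - 1) * dSym Sym.φ₁ (P.genSlow c)) = P.average c := by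
  have hn : P.n₁ ≠ 0 := fun h => by simpa using (hres 0 1 (by simp [h])).2
  have ha' : (P.a₁ : ℂ) ≠ 0 := by exact_mod_cast ha
  set D : Expr →ₗ[ℂ] Expr := LinearMap.id -
    LinearMap.mulLeft ℂ (num P.nStar) ∘ₗ LinearMap.mulLeft ℂ (num P.a₁ * sym Sym.ρ (-1)) ∘ₗ
      dAngle Sym.f ∘ₗ P.genFast -
    LinearMap.mulLeft ℂ (num P.n₁) ∘ₗ LinearMap.mulLeft ℂ (num P.a₁ * sym Sym.ρ (-1)) ∘ₗ
      dAngle Sym.E₁ ∘ₗ P.genFast -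
    LinearMap.mulLeft ℂ (num P.n₁) ∘ₗ LinearMap.mulLeft ℂ (num P.a₁ * sym Sym.ρ (-1) - 1) ∘ₗ
      dSym Sym.φ₁ ∘ₗ P.genSlow - P.average with hD
  suffices h : D c ∈ (⊥ : AddSubgroup Expr) by
    have h0 : D c = 0 := by simpa using h
    exact sub_eq_zero.mp h0
  refine linear_mem D hc fun m hm z _ => ?_
  have hz : (AddMonoidAlgebra.single m z : Expr) = z • AddMonoidAlgebra.single m 1 := by simp
  suffices h : D (AddMonoidAlgebra.single m 1) = 0 by
    rw [hz, map_smul, h, smul_zero]; exact zero_mem _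
  rw [hD]
  simp only [LinearMap.sub_apply, LinearMap.comp_apply, LinearMap.id_apply,
    LinearMap.mulLeft_apply, genFast, genSlow, average, onMonomials_single, one_smul]
  -- Secular monomials are handled by the factor `φ₁` and the telescoping sum. For the others the
  -- divisor does not vanish, by nonresonance, and the average is zero.
  by_cases h0 : m Sym.f = 0 ∧ m Sym.E₁ = 0
  · simp only [if_pos h0, map_zero, mul_zero, sub_zero]
    obtain ⟨l, hl⟩ : ∃ l : ℕ, -m Sym.ρ = l := ⟨(-m Sym.ρ).toNat, by omega⟩
    rw [hl, Int.toNat_natCast, map_sum]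
    have : ∀ ψ ∈ Finset.Icc 1 l, dSym Sym.φ₁ (AddMonoidAlgebra.single
        (m + Pi.single Sym.ρ (ψ : ℤ) + Pi.single Sym.φ₁ 1)
          ((P.a₁ : ℂ) * (P.n₁ * P.a₁ ^ (ψ - 1)))⁻¹) =
        AddMonoidAlgebra.single (m + Pi.single Sym.ρ (ψ : ℤ))
          ((P.a₁ : ℂ) * (P.n₁ * P.a₁ ^ (ψ - 1)))⁻¹ := fun ψ _ => by
      rw [dSym, onMonomials_single, AddMonoidAlgebra.smul_single]
      simp [hm.2]
    rw [Finset.sum_congr rfl this, P.sum_slow hn ha]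
    abel
  · have hr : (m Sym.f : ℂ) * P.nStar + m Sym.E₁ * P.n₁ ≠ 0 := by
      intro h
      exact h0 (hres _ _ (by exact_mod_cast h))
    simp only [if_neg h0, map_zero, mul_zero, sub_zero, dAngle_eq_diag, diag_single, num, sym,
      AddMonoidAlgebra.single_mul_single, zero_add, Pi.add_apply, Pi.single_apply, reduceCtorEq,
      if_false, add_zero, mul_one]
    have h1 : Pi.single Sym.ρ (-1) + (m + Pi.single Sym.ρ 1) = m := by
      rw [add_left_comm, ← Pi.single_add]; simp
    rw [h1, ← AddMonoidAlgebra.single_sub, ← AddMonoidAlgebra.single_sub]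
    rw [AddMonoidAlgebra.single_eq_zero]
    have hw := mul_inv_cancel₀ (mul_ne_zero ha' (mul_ne_zero Complex.I_ne_zero hr))
    linear_combination -hw

/-! ### The bracket of `𝒵₀` with a generating function. -/

variable {P}

theorem d_Z₀ (v : Sym) (hv : v ≠ Sym.δL) (hJ : v ≠ Sym.J₁) : act (dSym v) P.Z₀ = 0 := by
  rw [Z₀, act_add, act_cst, act_cst]
  simp only [num, sym, AddMonoidAlgebra.single_mul_single, dSym, onMonomials_single, zero_add]
  simp [hv, hJ, cst]

theorem dAngle_Z₀ (v : Sym) (hv : v ≠ Sym.δL) (hJ : v ≠ Sym.J₁) : act (dAngle v) P.Z₀ = 0 := by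
  rw [Z₀, act_add, act_cst, act_cst]
  simp only [num, sym, AddMonoidAlgebra.single_mul_single, dAngle, onMonomials_single, zero_add]
  simp [hv, hJ, cst]

theorem d_δL_Z₀ : act (dSym Sym.δL) P.Z₀ = cst (num P.nStar) := by
  rw [Z₀, act_add, act_cst, act_cst]
  simp only [num, sym, AddMonoidAlgebra.single_mul_single, dSym, onMonomials_single, zero_add]
  simp [cst]

theorem d_J₁_Z₀ : d_J₁ P.Z₀ = cst (num P.n₁) := by
  rw [d_J₁, Z₀, act_add, act_cst, act_cst]
  simp only [num, sym, AddMonoidAlgebra.single_mul_single, dSym, onMonomials_single, zero_add]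
  simp [cst]

theorem lie_Z₀ {χ : Ser} (hχ : d_J₁ χ = 0) : P.lie χ P.Z₀ =
    -(cst (num P.nStar) * P.d_ℓ χ) - cst (num P.n₁) * P.d_M₁ χ := by
  have h1 : P.d_δL P.Z₀ = cst (num P.nStar) := by
    rw [d_δL, dAngle_Z₀ _ (by decide) (by decide), d_δL_Z₀, d_Z₀ _ (by decide) (by decide),
      d_Z₀ _ (by decide) (by decide)]
    ring
  have h2 : P.d_G P.Z₀ = 0 := by
    rw [d_G, dAngle_Z₀ _ (by decide) (by decide), d_Z₀ _ (by decide) (by decide),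
      d_Z₀ _ (by decide) (by decide), d_Z₀ _ (by decide) (by decide),
      d_Z₀ _ (by decide) (by decide)]
    ring
  have h3 : P.d_H P.Z₀ = 0 := by
    rw [d_H, d_Z₀ _ (by decide) (by decide), d_Z₀ _ (by decide) (by decide)]
    ring
  rw [lie_apply, bracket, hχ, h1, h2, h3, d_J₁_Z₀, d_ℓ, d_g, d_h,
    dAngle_Z₀ _ (by decide) (by decide), dAngle_Z₀ _ (by decide) (by decide),
    dAngle_Z₀ _ (by decide) (by decide)]
  ring

variable (P)

/-- What `{𝒵₀, χ}` leaves besides the terms prescribed by the homological equation. -/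
def leftover (j : ℕ) (R : Ser) : Ser :=
  -(cst (num P.nStar) * (act (dAngle Sym.f) (act P.genFast (part j R)) *
      (f_ℓTail * P.unitFactor + P.unitTail))) -
    cst (num P.n₁) * (act (dSym Sym.ρ) (P.generator j R) *
      (cst (num (P.a₁ * P.e₁) * sinA 0 0 0 1) * sig P.ν₁) * cst (num P.a₁ * sym Sym.ρ (-1)))

/-- The exponents that occur in a remainder. -/
def NoPhi (_ : ℤ) (_ : Fin 2 →₀ ℕ) (m : Sym → ℤ) : Prop := m Sym.ρ ≤ -1 ∧ m Sym.φ₁ = 0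

/-- The closed-form equation solves the problem with `∂f/∂ℓ` replaced by `1`, the unit factor by
`a₁/ρ`, and `ρ` held fixed in the derivative along `E₁`. The three corrections, each of positive
order in `σ`, make up `leftover`. -/
theorem homological (ha : P.a₁ ≠ 0)
    (hres : ∀ k k₁ : ℤ, (k : ℝ) * P.nStar + (k₁ : ℝ) * P.n₁ = 0 → k = 0 ∧ k₁ = 0)
    (j : ℕ) {R : Ser} (hR : Sup NoPhi R) (hχ : d_J₁ (P.generator j R) = 0) :
    part j R + P.lie (P.generator j R) P.Z₀ - P.secular j R = P.leftover j R := by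
  set r := part j R with hr
  have hrs : Sup NoPhi r := In.part hR
  have key : r - cst (num P.nStar) * (cst (num P.a₁ * sym Sym.ρ (-1)) *
        act (dAngle Sym.f) (act P.genFast r)) -
      cst (num P.n₁) * (cst (num P.a₁ * sym Sym.ρ (-1)) *
        act (dAngle Sym.E₁) (act P.genFast r)) -
      cst (num P.n₁) * (cst (num P.a₁ * sym Sym.ρ (-1) - 1) *
        act (dSym Sym.φ₁) (act P.genSlow r)) = act P.average r := by
    refine Ser.ext_cf fun k n => ?_
    simp only [cf_sub, cf_cst_mul, cf_act]
    exact P.homological_expr ha hres (hrs k n)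
  have hs : Sup (fun _ _ m => m Sym.f = 0 ∧ m Sym.E₁ = 0) (act P.genSlow r) :=
    hrs.onMonomials fun k n m hm => by
      split_ifs with h
      · refine sum_mem fun ψ _ => single_mem_supp ?_
        simpa using h
      · exact zero_mem _
  have ht : Sup (fun _ _ m => m Sym.φ₁ = 0) (act P.genFast r) :=
    hrs.onMonomials fun k n m hm => by
      split_ifs with h
      · exact zero_mem _
      · refine single_mem_supp ?_
        simpa using hm.2
  have h1 : act (dAngle Sym.f) (act P.genSlow r) = 0 := act_eq_zero hs fun k n m hm => by
    rw [dAngle, onMonomials_single, hm.1]; simp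
  have h2 : act (dAngle Sym.E₁) (act P.genSlow r) = 0 := act_eq_zero hs fun k n m hm => by
    rw [dAngle, onMonomials_single, hm.2]; simp
  have h3 : act (dSym Sym.φ₁) (act P.genFast r) = 0 := act_eq_zero ht fun k n m hm => by
    rw [dSym, onMonomials_single, hm]; simp
  -- The factor `σ^ν₁` in the slow part of the generating function compensates `σ^(-ν₁)` in
  -- `dφ₁/dM₁`.
  have hσ : sig P.ν₁ * sig (-P.ν₁) = 1 := by rw [sig_mul, add_neg_cancel]; rfl
  rw [lie_Z₀ hχ, secular_eq, ← hr, ← key, leftover, ← hr, d_ℓ, d_M₁]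
  have e1 : act (dAngle Sym.f) (P.generator j R) = act (dAngle Sym.f) (act P.genFast r) := by
    rw [generator_eq, act_add, act_sig_mul, ← hr, h1]; ring
  have e2 : act (dAngle Sym.E₁) (P.generator j R) = act (dAngle Sym.E₁) (act P.genFast r) := by
    rw [generator_eq, act_add, act_sig_mul, ← hr, h2]; ring
  have e3 : act (dSym Sym.φ₁) (P.generator j R) =
      sig P.ν₁ * act (dSym Sym.φ₁) (act P.genSlow r) := by
    rw [generator_eq, act_add, act_sig_mul, ← hr, h3]; ring
  rw [e1, e2, e3, cst_sub, cst_one, unitFactor_eq, f_ℓ_eq]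
  linear_combination -cst (num P.n₁) * act (dSym Sym.φ₁) (act P.genSlow r) *
    (cst (num P.a₁ * sym Sym.ρ (-1)) - 1) * hσ

end Params

/-! ### Generating functions and normal form terms in closed form -/

namespace Params

variable (P : Params)

/-- The divisor `i (s₁ n_* + s₄ n₁)` is imaginary and odd in the angular exponents, so cosines
become sines. In `genSlow_mem_frm` the factor `φ₁` reverses the parity instead. -/
theorem genFast_mem_frm {c : Expr} (hc : c ∈ frm (-1) 1) : P.genFast c ∈ frm 0 (-1) := by
  rw [← mul_one (-1 : ℤ)]
  have hflip := flip_pi_single (v := Sym.ρ) rfl 1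
  refine linear_mem_frm hc (fun m hm z => ?_) (fun m hm z => ?_) (fun m hm z => ?_)
  · rw [genFast, onMonomials_single]
    split_ifs
    · simp
    · rw [AddMonoidAlgebra.smul_single]
      refine single_mem_supp ?_
      simp only [Admissible, Pi.add_apply, Pi.single_apply] at *
      simp at *
      omega
  · simp only [genFast, onMonomials_single, conjT_single]
    split_ifs
    · simp
    · simp only [AddMonoidAlgebra.smul_single, conjT_single, neg_smul, one_smul,
        ← AddMonoidAlgebra.single_neg]
      congr 1
      simp
      ring
  · simp only [genFast, onMonomials_single, flipT_single, flip_apply, angleSign, neg_mul, one_mul,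
      neg_eq_zero]
    split_ifs
    · simp
    · simp only [AddMonoidAlgebra.smul_single, flipT_single, neg_smul, one_smul, map_add, hflip,
        ← AddMonoidAlgebra.single_neg]
      congr 1
      have h : (P.a₁ : ℂ) * (Complex.I * (((-m Sym.f : ℤ) : ℂ) * P.nStar +
          ((-m Sym.E₁ : ℤ) : ℂ) * P.n₁)) =
          -((P.a₁ : ℂ) * (Complex.I * ((m Sym.f : ℂ) * P.nStar + (m Sym.E₁ : ℂ) * P.n₁))) := by
        push_cast
        ring
      rw [h, inv_neg]
      simp
      ring

theorem genSlow_mem_frm {c : Expr} (hc : c ∈ frm (-1) 1) : P.genSlow c ∈ frm 0 (-1) := by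
  rw [← mul_one (-1 : ℤ)]
  refine linear_mem_frm hc (fun m hm z => ?_) (fun m hm z => ?_) (fun m hm z => ?_)
  · rw [genSlow, onMonomials_single]
    split_ifs
    · rw [Finset.smul_sum]
      refine sum_mem fun ψ hψ => ?_
      rw [AddMonoidAlgebra.smul_single]
      refine single_mem_supp ?_
      rw [Finset.mem_Icc] at hψ
      simp only [Admissible, Pi.add_apply, Pi.single_apply] at *
      simp at *
      omega
    · simp
  · simp only [genSlow, onMonomials_single, conjT_single]
    split_ifs
    · simp only [map_sum, Finset.smul_sum]
      refine Finset.sum_congr rfl fun ψ _ => ?_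
      simp only [AddMonoidAlgebra.smul_single, conjT_single, neg_smul, one_smul,
        ← AddMonoidAlgebra.single_neg]
      congr 1
      simp [zpow_add₀]
      ring
    · simp
  · simp only [genSlow, onMonomials_single, flipT_single, flip_apply, angleSign, neg_mul, one_mul,
      neg_eq_zero]
    split_ifs
    · simp only [map_sum, Finset.smul_sum]
      refine Finset.sum_congr rfl fun ψ _ => ?_
      simp only [AddMonoidAlgebra.smul_single, flipT_single, neg_smul, one_smul, map_add,
        flip_pi_single (v := Sym.ρ) rfl, flip_pi_single (v := Sym.φ₁) rfl,
        ← AddMonoidAlgebra.single_neg]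
      congr 1
      simp [zpow_add₀]
      ring
    · simp

theorem average_mem_frm {r : ℤ} {c : Expr} (hc : c ∈ frm r 1) : P.average c ∈ frm 0 1 := by
  rw [← mul_one (1 : ℤ)]
  refine linear_mem_frm hc (fun m hm z => ?_) (fun m hm z => ?_) (fun m hm z => ?_)
  · rw [average, onMonomials_single]
    split_ifs
    · rw [AddMonoidAlgebra.smul_single]
      refine single_mem_supp ?_
      simp only [Admissible, Pi.add_apply, Pi.single_apply] at *
      simp at *
      omega
    · simp
  · simp only [average, onMonomials_single, conjT_single]
    split_ifs
    · simp only [AddMonoidAlgebra.smul_single, conjT_single, one_smul]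
      congr 1
      simp
      ring
    · simp
  · simp only [average, onMonomials_single, flipT_single, flip_apply, angleSign, neg_mul, one_mul,
      neg_eq_zero]
    split_ifs
    · simp only [AddMonoidAlgebra.smul_single, flipT_single, one_smul, map_add,
        flip_pi_single (v := Sym.ρ) rfl]
      congr 1
      simp
      ring
    · simp

/-! ### The substitution `φ₁ = e₁ sin E₁`, and the exponents of generating functions and normal form
terms. -/

theorem sinSubst_mem_frm : num P.e₁ * sinA 0 0 0 1 ∈ frm 0 (-1) :=
  num_mul_mem_frm _ (sinA_mem_frm _ _ _ _)

theorem sinSubst_pow_mem_frm (n : ℕ) : (num P.e₁ * sinA 0 0 0 1) ^ n ∈ frm 0 ((-1) ^ n) := by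
  induction n with
  | zero => simpa using one_mem_frm
  | succ n ih => rw [pow_succ, pow_succ]; exact mul_mem_frm_zero ih P.sinSubst_mem_frm

theorem substφ₁_single (m : Sym → ℤ) (z : ℂ) : P.substφ₁ (AddMonoidAlgebra.single m z) =
    AddMonoidAlgebra.single (m - Pi.single Sym.φ₁ (m Sym.φ₁)) z *
      (num P.e₁ * sinA 0 0 0 1) ^ (m Sym.φ₁).toNat := by
  rw [substφ₁, onMonomials_single, ← smul_mul_assoc]
  simp

/-- This is the purpose of counting `φ₁` as odd and imaginary: `e₁ sin E₁`, written in exponentials,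
has the same behaviour under both symmetries, so each power may be replaced. -/
theorem substφ₁_mem_frm {r p : ℤ} {c : Expr} (hc : c ∈ frm r p) : P.substφ₁ c ∈ frm r p := by
  rw [← one_mul p]
  have h0 (m : Sym → ℤ) : (m - Pi.single Sym.φ₁ (m Sym.φ₁) : Sym → ℤ) Sym.φ₁ = 0 := by simp
  have hsign (m : Sym → ℤ) (hm : Admissible r m) :
      (-1 : ℂ) ^ m Sym.φ₁ = ((((-1 : ℤ) ^ (m Sym.φ₁).toNat : ℤ)) : ℂ) := by
    obtain ⟨l, hl⟩ := Int.eq_ofNat_of_zero_le hm.2.2.2.1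
    rw [hl]; simp
  refine linear_mem_frm hc (fun m hm z => ?_) (fun m hm z => ?_) (fun m hm z => ?_)
  · rw [substφ₁_single]
    refine mul_mem_supp (S := Admissible r) (single_mem_supp ?_)
      (P.sinSubst_pow_mem_frm _).1 fun m m' hm hm' => ?_
    · simpa [Admissible] using ⟨hm.1, hm.2.1, hm.2.2.1, hm.2.2.2.2⟩
    · simp only [Admissible, Pi.add_apply] at *
      omega
  · rw [conjT_single, substφ₁_single, substφ₁_single, map_mul, (P.sinSubst_pow_mem_frm _).2.1,
      conjT_single, h0, hsign m hm, one_smul, mul_smul_comm, ← smul_mul_assoc]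
    congr 1
    rw [zpow_zero, one_mul, ← Int.cast_smul_eq_zsmul ℂ, AddMonoidAlgebra.smul_single, smul_eq_mul]
  · rw [flipT_single, substφ₁_single, substφ₁_single, map_mul, (P.sinSubst_pow_mem_frm _).2.2,
      flipT_single, h0, hsign m hm, one_smul, mul_smul_comm, ← smul_mul_assoc, map_sub,
      flip_pi_single (v := Sym.φ₁) rfl]
    have h1 : flip m Sym.φ₁ = m Sym.φ₁ := by simp [flip_apply, angleSign]
    rw [h1]
    congr 1
    rw [zpow_zero, one_mul, ← Int.cast_smul_eq_zsmul ℂ, AddMonoidAlgebra.smul_single, smul_eq_mul]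

theorem sinSubst_pow_mem_supp (n : ℕ) : (num P.e₁ * sinA 0 0 0 1) ^ n ∈
    supp fun m => (∀ v, v ≠ Sym.E₁ → m v = 0) ∧ (n = 0 → m Sym.E₁ = 0) := by
  induction n with
  | zero => rw [pow_zero]; exact one_mem_supp ⟨fun _ _ => rfl, fun _ => rfl⟩
  | succ n ih =>
    rw [pow_succ]
    refine mul_mem_supp (T := fun m => ∀ v, v ≠ Sym.E₁ → m v = 0) ih ?_ fun m m' h h' =>
      ⟨fun v hv => by rw [Pi.add_apply, h.1 v hv, h' v hv, add_zero], by simp⟩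
    refine num_mul_mem_supp _ (sub_mem (single_mem_supp ?_) (single_mem_supp ?_)) <;>
    · intro v hv
      simp [angle, hv]

/-- Only the exponent of `E₁` can change, and only for monomials containing `φ₁`. The parity
relation between `E₁` and `g` is therefore safe on terms free of `φ₁`. -/
theorem sup_substφ₁ {S U : ℤ → (Fin 2 →₀ ℕ) → (Sym → ℤ) → Prop} {F : Ser} (hF : Sup S F)
    (h : ∀ k n m m', S k n m → (∀ v, v ≠ Sym.E₁ → v ≠ Sym.φ₁ → m' v = m v) → m' Sym.φ₁ = 0 →
      (m Sym.φ₁ = 0 → m' Sym.E₁ = m Sym.E₁) → U k n m') : Sup U (act P.substφ₁ F) :=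
  In.act hF fun k n c hc => linear_mem _ hc fun m hm z _ => by
    rw [substφ₁_single]
    refine mul_mem_supp (S := fun m' => m' = m - Pi.single Sym.φ₁ (m Sym.φ₁))
      (single_mem_supp rfl) (P.sinSubst_pow_mem_supp _) ?_
    rintro _ m' rfl h'
    refine h k n m _ hm (fun v hv hv' => ?_) ?_ fun h0 => ?_
    · simp [h'.1 v hv, hv']
    · simp [h'.1 Sym.φ₁ (by decide)]
    · simp [h'.2 (by simp [h0])]

theorem substφ₁_eq_self {F : Ser} (hF : Sup (fun _ _ m => m Sym.φ₁ = 0) F) :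
    act P.substφ₁ F = F := by
  have h : act (P.substφ₁ - LinearMap.id) F = 0 := act_eq_zero hF fun k n m hm => by
    rw [LinearMap.sub_apply, substφ₁_single, hm]
    simp
  refine Ser.ext_cf fun k n => ?_
  have := congrArg (fun G => cf G k n) h
  simp only [cf_act, cf_zero, LinearMap.sub_apply, LinearMap.id_apply] at this
  rw [cf_act]
  exact sub_eq_zero.mp this

theorem sup_Z₀ : Sup (fun k _ m => k = 0 ∧ m Sym.φ₁ = 0) P.Z₀ := by
  refine In.add (In.cst ?_) (In.cst ?_) <;>
  · refine num_mul_mem_supp _ (single_mem_supp ⟨rfl, ?_⟩)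
    simp

theorem frm_generator {j : ℕ} {R : Ser} (hR : Frm (-1) 1 R) : Frm 0 (-1) (P.generator j R) := by
  rw [generator_eq]
  refine In.add ?_ ?_
  · exact (frm_sig _).mul' (In.act (In.part hR) fun _ _ _ h => P.genSlow_mem_frm h)
  · exact In.act (In.part hR) fun _ _ _ h => P.genFast_mem_frm h

theorem frm_secular {j : ℕ} {R : Ser} (hR : Frm (-1) 1 R) : Frm 0 1 (P.secular j R) := by
  rw [secular_eq]
  exact In.act (In.part hR) fun _ _ _ h => P.average_mem_frm h

section
variable {S U : ℤ → (Fin 2 →₀ ℕ) → (Sym → ℤ) → Prop} {R : Ser} {j : ℕ}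

theorem sup_genFast (hR : Sup S R) (h : ∀ n m, S j n m → (m Sym.f ≠ 0 ∨ m Sym.E₁ ≠ 0) →
    U j n (m + Pi.single Sym.ρ 1)) : Sup U (act P.genFast (part j R)) :=
  (Sup.part hR).onMonomials fun k n m hm => by
    obtain ⟨rfl, hm⟩ := hm
    split_ifs with h0
    · exact zero_mem _
    · exact single_mem_supp (h n m hm (by tauto))

theorem sup_genSlow (hR : Sup S R) (h : ∀ n m (l : ℤ), S j n m → m Sym.f = 0 → m Sym.E₁ = 0 →
    U j n (m + Pi.single Sym.ρ l + Pi.single Sym.φ₁ 1)) : Sup U (act P.genSlow (part j R)) :=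
  (Sup.part hR).onMonomials fun k n m hm => by
    obtain ⟨rfl, hm⟩ := hm
    split_ifs with h0
    · exact sum_mem fun ψ _ => single_mem_supp (h n m ψ hm h0.1 h0.2)
    · exact zero_mem _

theorem sup_secular (hR : Sup S R) (h : ∀ n m, S j n m → m Sym.f = 0 → m Sym.E₁ = 0 →
    U j n (m + Pi.single Sym.ρ (-m Sym.ρ))) : Sup U (P.secular j R) := by
  rw [secular_eq]
  refine (Sup.part hR).onMonomials fun k n m hm => ?_
  obtain ⟨rfl, hm⟩ := hm
  split_ifs with h0
  · exact single_mem_supp (h n m hm h0.1 h0.2)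
  · exact zero_mem _

theorem low_generator {Q : ℤ → ℕ → ℤ → ℤ → ℤ → Prop} (hR : Sup S R)
    (hf : ∀ n m, S j n m → (m Sym.f ≠ 0 ∨ m Sym.E₁ ≠ 0) →
      Q j (n 0) (m Sym.f) (m Sym.g) (m Sym.e))
    (hs : ∀ n m, S j n m → m Sym.f = 0 → m Sym.E₁ = 0 →
      Q (j + P.ν₁) (n 0) (m Sym.f) (m Sym.g) (m Sym.e)) : Low Q (P.generator j R) := by
  rw [generator_eq]
  refine Low.add ?_ ?_
  · have := P.sup_genSlow (U := fun k n m => k = j ∧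
      Q (j + P.ν₁) (n 0) (m Sym.f) (m Sym.g) (m Sym.e)) hR fun n m l h h1 h2 => ⟨rfl, by
        simpa using hs n m h h1 h2⟩
    refine Sup.mul (T := fun k n m => k = j ∧
      Q (j + P.ν₁) (n 0) (m Sym.f) (m Sym.g) (m Sym.e))
      (In.sig (M := suppFam fun k n m => k = P.ν₁ ∧ n = 0 ∧ m = 0)
        (one_mem_supp ⟨rfl, rfl, rfl⟩)) this ?_
    rintro k k' n n' m m' ⟨rfl, rfl, rfl⟩ ⟨rfl, h⟩
    rw [zero_add, zero_add, add_comm]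
    exact h
  · exact P.sup_genFast hR fun n m h h1 => by simpa using hf n m h h1

end

end Params

/-! ### Real closed forms of even parity are combinations of cosines -/

/-- Invariance under conjugation makes the coefficients real when `φ₁` is absent. Invariance under
reversal of the angles gives `2 c = c + flipT c`, which pairs every monomial with its mirror image
into a cosine. -/
theorem mem_of_mem_frm {r : ℤ} {S : (Sym → ℤ) → Prop} {W : Submodule ℝ Expr} {c : Expr}
    (hc : c ∈ frm r 1) (hφ : c ∈ supp fun m => m Sym.φ₁ = 0 ∧ S m)
    (h : ∀ m, Admissible r m → m Sym.φ₁ = 0 → S m → (AddMonoidAlgebra.single m 1 : Expr) +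
      AddMonoidAlgebra.single (flip m) 1 ∈ W) : c ∈ W := by
  have h2 : (2 : ℝ) • c = c + flipT c := by rw [hc.2.2, one_smul, two_smul]
  have hsum : c = ∑ m ∈ c.coeff.support, AddMonoidAlgebra.single m (c.coeff m) :=
    (AddMonoidAlgebra.sum_coeff_single c).symm
  have hre (m) (hm : c.coeff m ≠ 0) : ((c.coeff m).re : ℂ) = c.coeff m := by
    have hT : ∀ m', (conjT c).coeff m' = (-1) ^ m' Sym.φ₁ * starRingEnd ℂ (c.coeff m') :=
        fun m' => by
      generalize c = a
      induction a using AddMonoidAlgebra.induction_linear with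
      | zero => simp
      | add a b ha hb =>
        simp only [map_add, AddMonoidAlgebra.coeff_add, Finsupp.add_apply, ha, hb, mul_add]
      | single m z =>
        rw [conjT_single]
        by_cases hmm : m = m'
        · subst hmm; simp
        · simp [hmm]
    have := hT m
    rw [hc.2.1, one_smul, (hφ m hm).1, zpow_zero, one_mul] at this
    exact Complex.conj_eq_iff_re.mp this.symm
  have hmem : (2 : ℝ) • c ∈ W := by
    rw [h2]
    have : c + flipT c = ∑ m ∈ c.coeff.support, (c.coeff m).re •
        ((AddMonoidAlgebra.single m 1 : Expr) + AddMonoidAlgebra.single (flip m) 1) := by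
      conv_lhs => rw [hsum, map_sum, ← Finset.sum_add_distrib]
      refine Finset.sum_congr rfl fun m hm => ?_
      rw [Finsupp.mem_support_iff] at hm
      rw [flipT_single, (hφ m hm).1, zpow_zero, one_mul, smul_add, AddMonoidAlgebra.smul_single,
        AddMonoidAlgebra.smul_single, Complex.real_smul, mul_one, hre m hm]
    rw [this]
    refine sum_mem fun m hm => W.smul_mem _ ?_
    rw [Finsupp.mem_support_iff] at hm
    exact h m (hc.1 m hm) (hφ m hm).1 (hφ m hm).2
  have := W.smul_mem (1 / 2 : ℝ) hmem
  rwa [smul_smul, one_div, inv_mul_cancel₀ two_ne_zero, one_smul] at this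

theorem single_add_single_flip {r : ℤ} {m : Sym → ℤ} (hm : Admissible r m) (hφ : m Sym.φ₁ = 0) :
    (AddMonoidAlgebra.single m 1 : Expr) + AddMonoidAlgebra.single (flip m) 1 =
      (2 : ℝ) • (sym Sym.ρ (m Sym.ρ) * slowMonomial (m Sym.δL).toNat (m Sym.e) (m Sym.η)
        (m Sym.ιc).toNat (m Sym.ιs) * cosA (m Sym.f) (m Sym.g) (m Sym.h) (m Sym.E₁)) := by
  have h1 := hm.2.1
  have h2 := hm.2.2.1
  have h3 := hm.2.2.2.2
  rw [slowMonomial, Int.toNat_of_nonneg h1, Int.toNat_of_nonneg h2, cosA, mul_add, smul_add]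
  simp only [sym, AddMonoidAlgebra.single_mul_single, AddMonoidAlgebra.smul_single,
    Complex.real_smul, one_mul]
  congr 1 <;> congr 1
  · ext v; cases v <;> simp [angle, hφ, h3]
  · norm_num
  · ext v; cases v <;> simp [angle, hφ, h3, flip_apply, angleSign]
  · norm_num

theorem mem_remainderForms {c : Expr} (hc : c ∈ frm (-1) 1)
    (hφ : c ∈ supp fun m => m Sym.φ₁ = 0) : c ∈ remainderForms :=
  mem_of_mem_frm (S := fun _ => True) hc (supp_mono (fun _ h => ⟨h, trivial⟩) hφ)
    fun m hm h0 _ => by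
      obtain ⟨l, hl⟩ : ∃ l : ℕ, m Sym.ρ = -(l : ℤ) := ⟨(-m Sym.ρ).toNat, by have := hm.1; omega⟩
      rw [single_add_single_flip hm h0, hl]
      exact Submodule.smul_mem _ _ (Submodule.subset_span
        ⟨l, _, _, _, _, _, _, _, _, _, by have := hm.1; omega, rfl⟩)

theorem mem_secularForms {c : Expr} (hc : c ∈ frm 0 1) (hφ : c ∈ supp fun m => m Sym.φ₁ = 0 ∧
    m Sym.ρ = 0 ∧ m Sym.f = 0 ∧ m Sym.E₁ = 0) : c ∈ secularForms :=
  mem_of_mem_frm hc hφ fun m hm h0 h => by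
    rw [single_add_single_flip hm h0, h.1, h.2.1, h.2.2, sym_zero, one_mul]
    exact Submodule.smul_mem _ _ (Submodule.subset_span ⟨_, _, _, _, _, _, _, rfl⟩)

theorem isRemainder_of {j : ℕ} {R : Ser} (hR : Frm (-1) 1 R)
    (hφ : Sup (fun k _ m => j ≤ k ∧ m Sym.φ₁ = 0) R) : IsRemainder j R := by
  refine ⟨fun k hk => MvPowerSeries.ext fun n => ?_, fun k n => mem_remainderForms (hR k n)
    (supp_mono (fun _ h => h.2) (hφ k n))⟩
  have : cf R k n = 0 := by
    ext m
    by_contra hm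
    have := (hφ k n m hm).1
    omega
  simpa [cf] using this

namespace Params

variable (P : Params)

theorem isSecular_secular {j : ℕ} {R : Ser} (hR : Frm (-1) 1 R)
    (hφ : Sup (fun _ _ m => m Sym.φ₁ = 0) R) : IsSecular j (P.secular j R) := by
  refine ⟨_, rfl, fun n => mem_secularForms ?_ ?_⟩
  · exact P.average_mem_frm (hR j n)
  · have := P.sup_secular (U := fun _ _ m => m Sym.φ₁ = 0 ∧
      m Sym.ρ = 0 ∧ m Sym.f = 0 ∧ m Sym.E₁ = 0) (j := j) hφ (fun n m h hf he => by
        simp [h, hf, he]) j n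
    rw [secular, cf_single, if_pos rfl] at this
    exact this

end Params

/-! ### One normalization step -/

theorem Low.part {Q : ℤ → ℕ → ℤ → ℤ → ℤ → Prop} {j : ℤ} {F : Ser} (hF : Low Q F) :
    Low Q (part j F) := In.part hF

theorem sup_noPhi {R : Ser} (hR : Frm (-1) 1 R) (hφ : Sup (fun _ _ m => m Sym.φ₁ = 0) R) :
    Sup Params.NoPhi R := fun k n m hm =>
  ⟨((hR k n).1 m hm).1, hφ k n m hm⟩

namespace Params

variable (P : Params) {j : ℕ} {R : Ser}

theorem frm_leftover (hR : Frm (-1) 1 R) : Frm (-1) 1 (P.leftover j R) := by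
  have hu : Frm (-1) 1 P.unitTail := by
    have := P.frm_unitFactor.sub (frm_cst (num_mul_mem_frm P.a₁ (sym_ρ_mem (-1))))
    rwa [unitFactor_eq, add_sub_cancel_left] at this
  have hf : Frm 0 1 f_ℓTail := by
    have := frm_f_ℓ.sub frm_one
    rwa [f_ℓ_eq, add_sub_cancel_left] at this
  have hg : Frm 0 (-1) (act P.genFast (part j R)) :=
    In.act (In.part hR) fun _ _ _ h => P.genFast_mem_frm h
  refine In.sub (In.neg ?_) ?_
  · exact (frm_cst (num_mem_frm _)).mul'
      (Frm.mul' (r := 0) (p := 1) (r'' := -1) (p'' := 1) (hg.dAngle rfl)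
        (In.add (Frm.mul' hf P.frm_unitFactor (r'' := -1) (p'' := 1)) hu))
  · exact (frm_cst (num_mem_frm _)).mul' (Frm.mul' (r := 0) (p := 1) (r'' := -1) (p'' := 1) (Frm.mul'
      (r := 0) (p := -1) (r' := 0) (p' := -1) ((P.frm_generator hR).dSym rfl (by decide))
      (Frm.mul' (frm_cst (num_mul_mem_frm _ (sinA_mem_frm _ _ _ _))) (frm_sig _)
        le_rfl (mul_one _)) le_rfl rfl)
      (frm_cst (num_mul_mem_frm _ (sym_ρ_mem (-1)))))

theorem low_genFast : Low (fun k _ _ _ _ => k = j) (act P.genFast (part j R)) :=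
  P.sup_genFast (S := fun _ _ _ => True) (fun _ _ _ _ => trivial) fun _ _ _ _ => rfl

theorem low_generator_ge : Low (fun k _ _ _ _ => j ≤ k) (P.generator j R) :=
  P.low_generator (S := fun _ _ _ => True) (fun _ _ _ _ => trivial)
    (fun _ _ _ _ => le_rfl) fun _ _ _ _ _ => by omega

theorem low_secular : Low (fun k _ _ _ _ => k = j) (P.secular j R) :=
  P.sup_secular (S := fun _ _ _ => True) (fun _ _ _ _ => trivial) fun _ _ _ _ _ => rfl

theorem sup_f_ℓTail : Sup (fun k _ m => 1 ≤ k ∧ (k = 1 → m Sym.e = 1 ∧ m Sym.g = 0 ∧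
    (m Sym.f = 1 ∨ m Sym.f = -1) ∧ m Sym.E₁ = 0 ∧ m Sym.φ₁ = 0)) f_ℓTail := by
  refine In.add ?_ ?_
  · rw [two_mul, ← cst_mul]
    refine In.add ?_ ?_ <;>
    · refine Sup.mul (S := fun k _ m => k = 0 ∧ m Sym.e = 1 ∧ m Sym.g = 0 ∧
        (m Sym.f = 1 ∨ m Sym.f = -1) ∧ m Sym.E₁ = 0 ∧ m Sym.φ₁ = 0)
        (T := fun k _ m => k = 1 ∧ m = 0) (In.cst ?_) (In.sig (one_mem_supp ⟨rfl, rfl⟩)) ?_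
      · rw [cosA, mul_add, sym, AddMonoidAlgebra.single_mul_single,
          AddMonoidAlgebra.single_mul_single]
        exact add_mem (single_mem_supp (by simp [angle])) (single_mem_supp (by simp [angle]))
      · rintro k k' n n' m m' ⟨rfl, h⟩ ⟨rfl, rfl⟩
        exact ⟨by norm_num, fun _ => by simpa using h⟩
  · exact Sup.mono' (Low.mul_ge (low_sig (a := 2) le_rfl) low_f_ℓSecond (add_zero 2))
      fun k _ _ h => ⟨by omega, by omega⟩

/-- No derivative in `e` and no division by `σ` occurs here, and each correction carries a positive
power of `σ`: the tail of `∂f/∂ℓ`, the tail of the unit factor, or `σ^ν₁` from `dρ/dE₁`. -/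
theorem low_leftover (hν : 1 ≤ P.ν₁) : Low (fun k _ _ _ _ => j + 1 ≤ k) (P.leftover j R) := by
  have h0 (x : ℝ) : Low (fun k _ _ _ _ => 0 ≤ k) (cst (num x)) := (lead_num x).ge_of_lead
  have hu := (P.lead_unitFactor hν).ge_of_lead
  have ht : Low (fun k _ _ _ _ => 1 ≤ k) P.unitTail :=
    P.lead_unitTail.ge_of_lead.mono fun _ _ _ _ _ h => by omega
  have hf : Low (fun k _ _ _ _ => 1 ≤ k) f_ℓTail := sup_f_ℓTail.mono' fun _ _ _ h => h.1
  have hj : Low (fun k _ _ _ _ => j ≤ k) (act P.genFast (part j R)) :=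
    P.low_genFast.mono fun _ _ _ _ _ h => h.ge
  refine Low.sub (Low.neg ?_) ?_
  · exact (h0 _).mul_ge ((hj.dAngle _).mul_ge ((hf.mul_ge hu (add_zero _)).add ht) rfl) (zero_add _)
  · refine (h0 _).mul_ge (Low.mul_ge (b := 0) (Low.mul_ge
      (P.low_generator_ge.dSym (by decide) (by decide) (by decide))
      (Low.mul_ge (low_cst_nonneg _) (low_sig (a := P.ν₁) ?_) (zero_add 1)) rfl)
      (low_cst_nonneg _) (add_zero _)) (zero_add _)
    omega

theorem lie_generator_Z₀ (ha : P.a₁ ≠ 0)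
    (hres : ∀ k k₁ : ℤ, (k : ℝ) * P.nStar + (k₁ : ℝ) * P.n₁ = 0 → k = 0 ∧ k₁ = 0)
    (hR : Frm (-1) 1 R) (hφ : Sup (fun _ _ m => m Sym.φ₁ = 0) R) :
    P.lie (P.generator j R) P.Z₀ = P.leftover j R - part j R + P.secular j R := by
  rw [← P.homological ha hres j (sup_noPhi hR hφ) (P.frm_generator hR).d_J₁_eq_zero]
  abel

/-- By the homological equation `{𝒵₀, χ}` cancels the targeted part of `R` and inserts the normal
form term and `leftover`. The remaining terms of the Lie series start with `{T + R, χ}` and `{{𝒵₀,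
χ}, χ}`. They are collected in `W`, and it suffices to bound these two seeds and to know that `Q` is
stable. -/
theorem exists_isStep (ha : P.a₁ ≠ 0) (hν : 1 ≤ P.ν₁)
    (hres : ∀ k k₁ : ℤ, (k : ℝ) * P.nStar + (k₁ : ℝ) * P.n₁ = 0 → k = 0 ∧ k₁ = 0)
    {T : Ser} (hT : Frm 0 1 T) (hTφ : Sup (fun _ _ m => m Sym.φ₁ = 0) T)
    (hT₀ : Low (fun k _ _ _ _ => 0 ≤ k) T)
    (hR : Frm (-1) 1 R) (hRφ : Sup (fun _ _ m => m Sym.φ₁ = 0) R)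
    (hR₀ : Low (fun k _ _ _ _ => 0 ≤ k) R) (hχ : Contracting (P.generator j R))
    {Q : ℤ → ℕ → ℤ → ℤ → ℤ → Prop} (h₁ : Low Q (P.lie (P.generator j R) (T + R)))
    (h₂ : Low Q (P.lie (P.generator j R) (P.leftover j R - part j R + P.secular j R)))
    (h₃ : ∀ F, Frm 0 1 F → Low Q F → Low Q (P.lie (P.generator j R) F)) :
    ∃ W, Low Q W ∧ Frm (-1) 1 (act P.substφ₁ (R - part j R + P.leftover j R + W)) ∧
      P.IsStep j (P.Z₀ + (T + R)) R (P.generator j R) (P.secular j R) (P.Z₀ + (T +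
        P.secular j R + act P.substφ₁ (R - part j R + P.leftover j R + W))) := by
  have hZ := P.lie_generator_Z₀ (j := j) ha hres hR hRφ
  have hl := P.frm_leftover (j := j) hR
  have hs := P.frm_secular (j := j) hR
  obtain ⟨G, hG, hGf, hGl⟩ := P.exists_lieSeries hν hχ (P.frm_generator hR)
    (hT.add (hR.mono (by norm_num))) (hT₀.add hR₀)
    (by
      rw [hZ]
      exact In.add (Frm.mono (hl.sub (In.part hR)) (by norm_num)) hs)
    (by
      rw [hZ]
      refine Low.add (Low.sub ((P.low_leftover hν).mono fun _ _ _ _ _ h => ?_) hR₀.part)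
        (P.low_secular.mono fun _ _ _ _ _ h => ?_) <;> omega)
    (P.sup_Z₀.mono' fun _ _ _ h => h.1.ge) h₁ (by rwa [hZ]) h₃
  rw [hZ] at hGf hGl
  refine ⟨_, hGl, In.act (((hR.sub (In.part hR)).add hl).add hGf)
    fun _ _ _ h => P.substφ₁_mem_frm h, rfl, rfl, G, hG, ?_⟩
  set W := G - (P.Z₀ + (T + R) + (P.leftover j R - part j R + P.secular j R)) with hW
  -- Only the last group can contain `φ₁`; the substitution fixes the normal form part.
  have e : G = P.Z₀ + T + P.secular j R + (R - part j R + P.leftover j R + W) := by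
    rw [hW]; abel
  rw [e, act_add (F := P.Z₀ + T + P.secular j R),
    P.substφ₁_eq_self (F := P.Z₀ + T + P.secular j R)]
  · rw [add_assoc P.Z₀, add_assoc P.Z₀]
  · refine In.add (In.add (P.sup_Z₀.mono' fun _ _ _ h => h.2) hTφ) ?_
    exact P.sup_secular hRφ fun n m h _ _ => by simpa using h

end Params

/-! ### The steps of order one, two, two again, and of higher order -/

/-- Up to `σ` the exponents of a function of `f + g`, and up to `σ ^ 2` those of a polynomial of
degree at most one in `e cos f`, `e sin f` over such functions. -/
def FirstOrder (k : ℤ) (n : Fin 2 →₀ ℕ) (m : Sym → ℤ) : Prop :=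
  1 ≤ k ∧ (k = 1 → m Sym.f = m Sym.g ∧ m Sym.e = 0 ∧ 2 ∣ m Sym.E₁ - m Sym.g ∧
      (m Sym.f ≠ 0 → 1 ≤ n 0)) ∧
    (k = 2 → m Sym.f = m Sym.g ∧ m Sym.e = 0 ∨ m Sym.e = 1 ∧
      (m Sym.f - m Sym.g = 1 ∨ m Sym.f - m Sym.g = -1) ∧ 2 ∣ m Sym.E₁ - m Sym.g ∧ 1 ≤ n 0)

/-- The condition `FirstOrder` without terms of order `σ`. -/
def SecondOrder (k : ℤ) (n : Fin 2 →₀ ℕ) (m : Sym → ℤ) : Prop :=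
  2 ≤ k ∧ (k = 2 → m Sym.f = m Sym.g ∧ m Sym.e = 0 ∨ m Sym.e = 1 ∧
    (m Sym.f - m Sym.g = 1 ∨ m Sym.f - m Sym.g = -1) ∧ 2 ∣ m Sym.E₁ - m Sym.g ∧ 1 ≤ n 0)

/-- Terms of order at least `σ ^ 2`, those of order `σ ^ 2` being functions of `f + g`. -/
def ReducedOrder (k : ℤ) (_ : Fin 2 →₀ ℕ) (m : Sym → ℤ) : Prop :=
  2 ≤ k ∧ (k = 2 → m Sym.f = m Sym.g ∧ m Sym.e = 0)

/-- Terms of order at least `σ ^ a`. -/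
def OrderGE (a k : ℤ) (_ : Fin 2 →₀ ℕ) (_ : Sym → ℤ) : Prop := a ≤ k

/-- The exponents of a sum of normal form terms. -/
def SlowOrder (k : ℤ) (_ : Fin 2 →₀ ℕ) (m : Sym → ℤ) : Prop :=
  1 ≤ k ∧ (k < 3 → m Sym.f = 0 ∧ m Sym.g = 0 ∧ m Sym.e = 0)

/-- Remainders in closed form with exponents in `S`. -/
def Rem (S : ℤ → (Fin 2 →₀ ℕ) → (Sym → ℤ) → Prop) (R : Ser) : Prop :=
  Frm (-1) 1 R ∧ Sup (fun k n m => S k n m ∧ m Sym.φ₁ = 0) R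

/-- Sums of normal form terms. -/
def Slow (T : Ser) : Prop := Frm 0 1 T ∧ Sup (fun k n m => SlowOrder k n m ∧ m Sym.φ₁ = 0) T

theorem Slow.zero : Slow 0 := ⟨In.zero, In.zero⟩

theorem Slow.add {T T' : Ser} (h : Slow T) (h' : Slow T') : Slow (T + T') :=
  ⟨h.1.add h'.1, h.2.add h'.2⟩

namespace Params

variable (P : Params) {R T : Ser}

/-- The step of order `j` on `𝒵₀ + T + R` gives `𝒵₀ + T + 𝒵 + R'` with exponents of `R'` in `U`. -/
def StepsTo (j : ℕ) (T R : Ser) (U : ℤ → (Fin 2 →₀ ℕ) → (Sym → ℤ) → Prop) : Prop :=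
  Slow (P.secular j R) ∧ ∃ R', Rem U R' ∧ P.IsStep j (P.Z₀ + (T + R)) R (P.generator j R)
    (P.secular j R) (P.Z₀ + (T + P.secular j R + R'))

/-- The new remainder has three sources: the untargeted part of `R` (exponents `S`), `leftover`
(`V`) and the Lie series (`Q`). Each is compared with `U`, and `hU` passes from `U` to `U'` through
the substitution of `φ₁`. -/
theorem stepsTo (ha : P.a₁ ≠ 0) (hν : 1 ≤ P.ν₁)
    (hres : ∀ k k₁ : ℤ, (k : ℝ) * P.nStar + (k₁ : ℝ) * P.n₁ = 0 → k = 0 ∧ k₁ = 0) {j : ℕ}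
    {S U V : ℤ → (Fin 2 →₀ ℕ) → (Sym → ℤ) → Prop} (hT : Slow T) (hR : Rem S R)
    (hS : ∀ k n m, S k n m → 0 ≤ k) (hj : ∀ n m, S j n m → m Sym.φ₁ = 0 → m Sym.f = 0 →
      m Sym.E₁ = 0 → SlowOrder j n m) (hχ : Contracting (P.generator j R))
    {Q : ℤ → ℕ → ℤ → ℤ → ℤ → Prop} (h₁ : Low Q (P.lie (P.generator j R) (T + R)))
    (h₂ : Low Q (P.lie (P.generator j R) (P.leftover j R - part j R + P.secular j R)))
    (h₃ : ∀ F, Frm 0 1 F → Low Q F → Low Q (P.lie (P.generator j R) F))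
    (hV : Sup V (P.leftover j R)) (hVU : ∀ k n m, V k n m → U k n m)
    (hSU : ∀ k n m, S k n m → k ≠ j → m Sym.φ₁ = 0 → U k n m)
    (hQU : ∀ k n m, Q k (n 0) (m Sym.f) (m Sym.g) (m Sym.e) → U k n m)
    {U' : ℤ → (Fin 2 →₀ ℕ) → (Sym → ℤ) → Prop} (hU : ∀ k n m m', U k n m →
      (∀ v, v ≠ Sym.E₁ → v ≠ Sym.φ₁ → m' v = m v) → (m Sym.φ₁ = 0 → m' Sym.E₁ = m Sym.E₁) →
        U' k n m') : P.StepsTo j T R U' := by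
  have hRφ : Sup (fun _ _ m => m Sym.φ₁ = 0) R := hR.2.mono' fun _ _ _ h => h.2
  refine ⟨⟨P.frm_secular hR.1, ?_⟩, ?_⟩
  · refine P.sup_secular hR.2 fun n m h hf hE => ⟨?_, by simpa using h.2⟩
    have := hj n m h.1 h.2 hf hE
    simpa [SlowOrder] using this
  obtain ⟨W, hW, hR', hstep⟩ := P.exists_isStep ha hν hres hT.1
    (hT.2.mono' fun _ _ _ h => h.2) (hT.2.mono' fun _ _ _ h => zero_le_one.trans h.1.1) hR.1 hRφ
    (hR.2.mono' fun _ _ _ h => hS _ _ _ h.1) hχ h₁ h₂ h₃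
  refine ⟨_, ⟨hR', ?_⟩, hstep⟩
  refine P.sup_substφ₁ (S := U) ?_ fun k n m m' h hv h0 hE => ⟨hU k n m m' h hv hE, h0⟩
  refine In.add (In.add ?_ (hV.mono' hVU)) (hW.mono' hQU)
  exact hR.2.sub_part.mono' fun k n m h => hSU k n m h.2.1 h.1 h.2.2

variable {P}

theorem low_generator_first (hR : Rem FirstOrder R) :
    Low (fun k n f g e => (k = 1 ∧ (f ≠ 0 → 1 ≤ n) ∨ k = 1 + P.ν₁) ∧ f = g ∧ e = 0)
      (P.generator 1 R) := by
  refine P.low_generator hR.2 (fun n m h _ => ?_) fun n m h _ _ => ?_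
  · have := h.1.2.1 rfl
    omega
  · have := h.1.2.1 rfl
    omega

/-- The term `2 σ e cos f` of `∂f/∂ℓ` creates terms linear in `e` at `σ²`. Their parity relation and
factor `μ` come from the targeted `σ`-terms. The clause `φ₁ = 0` is recorded so that the
substitution does not alter their exponent of `E₁`. -/
theorem sup_leftover_first (hν : 1 ≤ P.ν₁) (hR : Rem FirstOrder R) :
    Sup (fun k n m => 2 ≤ k ∧ (k = 2 → m Sym.f = m Sym.g ∧ m Sym.e = 0 ∨ m Sym.e = 1 ∧
      (m Sym.f - m Sym.g = 1 ∨ m Sym.f - m Sym.g = -1) ∧ 2 ∣ m Sym.E₁ - m Sym.g ∧ 1 ≤ n 0 ∧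
      m Sym.φ₁ = 0)) (P.leftover 1 R) := by
  have hχ : Low (fun k _ f g e => 1 ≤ k ∧ f = g ∧ e = 0) (P.generator 1 R) :=
    (low_generator_first (P := P) hR).mono fun _ _ _ _ _ h => by omega
  refine In.sub (In.neg ?_) ?_
  · have ht : Sup (fun k n m => k = 1 ∧ m Sym.f = m Sym.g ∧ m Sym.e = 0 ∧
        2 ∣ m Sym.E₁ - m Sym.g ∧ 1 ≤ n 0 ∧ m Sym.φ₁ = 0)
        (act (dAngle Sym.f) (act P.genFast (part (1 : ℕ) R))) := by
      refine Sup.mono' (Sup.diag (P.sup_genFast (U := fun k n m => k = 1 ∧ m Sym.f = m Sym.g ∧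
        m Sym.e = 0 ∧ 2 ∣ m Sym.E₁ - m Sym.g ∧ (m Sym.f ≠ 0 → 1 ≤ n 0) ∧ m Sym.φ₁ = 0) hR.2 ?_)) ?_
      · intro n m h _
        simpa [and_assoc] using (⟨h.1.2.1 rfl, h.2⟩ : _ ∧ _)
      · rintro k n m ⟨⟨rfl, h1, h2, h3, h4, h5⟩, h⟩
        -- Differentiation in `f` removes the Keplerian terms, the only ones of order `σ` that may
        -- lack a factor `μ`.
        exact ⟨rfl, h1, h2, h3, h4 fun h0 => h (by rw [h0]; simp), h5⟩
    have hu : Sup (fun k _ m => 0 ≤ k ∧ (k = 0 → m Sym.f = 0 ∧ m Sym.g = 0 ∧ m Sym.e = 0 ∧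
        m Sym.E₁ = 0 ∧ m Sym.φ₁ = 0)) P.unitFactor := by
      rw [unitFactor_eq]
      refine In.add (In.cst ?_) (P.lead_unitTail.mono' fun k n m h => ?_)
      · exact num_mul_mem_supp _ (single_mem_supp ⟨le_rfl, by simp⟩)
      · have := h.1
        omega
    have hv : Sup (fun k _ m => 1 ≤ k ∧ (k = 1 → m Sym.f = 0 ∧ m Sym.g = 0 ∧ m Sym.e = 0 ∨
        m Sym.e = 1 ∧ m Sym.g = 0 ∧ (m Sym.f = 1 ∨ m Sym.f = -1) ∧ m Sym.E₁ = 0 ∧ m Sym.φ₁ = 0))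
        (f_ℓTail * P.unitFactor + P.unitTail) := by
      refine In.add (sup_f_ℓTail.mul hu fun k k' n n' m m' h h' => ?_)
        (P.lead_unitTail.mono' fun k n m h => ?_)
      · simp only [Pi.add_apply]
        omega
      · unfold Lead at h
        omega
    refine Sup.mul (S := fun k n m => k = 0 ∧ n = 0 ∧ m = 0)
      (In.cst (single_mem_supp ⟨rfl, rfl, rfl⟩)) (ht.mul hv (U := fun k n m => 2 ≤ k ∧
      (k = 2 → m Sym.f = m Sym.g ∧ m Sym.e = 0 ∨ m Sym.e = 1 ∧
      (m Sym.f - m Sym.g = 1 ∨ m Sym.f - m Sym.g = -1) ∧ 2 ∣ m Sym.E₁ - m Sym.g ∧ 1 ≤ n 0 ∧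
      m Sym.φ₁ = 0)) fun k k' n n' m m' h h' => ?_) ?_
    · simp only [Pi.add_apply, Finsupp.add_apply]
      omega
    · rintro k k' n n' m m' ⟨rfl, rfl, rfl⟩ h
      simpa only [zero_add] using h
  · have h2 : Low (Lead P.ν₁ 0 0 0) (cst (num (P.a₁ * P.e₁) * sinA 0 0 0 1) * sig P.ν₁) := by
      rw [cst_mul]
      exact ((lead_num _).mul_lead_zero (lead_sinA _)).lead_zero_mul (lead_sig _)
    have h3 : Low (fun k _ f g e => 2 ≤ k ∧ (k = 2 → f = g ∧ e = 0))
        (act (dSym Sym.ρ) (P.generator 1 R) *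
          (cst (num (P.a₁ * P.e₁) * sinA 0 0 0 1) * sig P.ν₁)) :=
      Low.mul (hχ.dSym (by decide) (by decide) (by decide)) h2
        fun k k' n n' f f' g g' e e' h h' => by unfold Lead at h'; omega
    have h4 : Low (fun k _ f g e => 2 ≤ k ∧ (k = 2 → f = g ∧ e = 0))
        (act (dSym Sym.ρ) (P.generator 1 R) *
          (cst (num (P.a₁ * P.e₁) * sinA 0 0 0 1) * sig P.ν₁) *
            cst (num P.a₁ * sym Sym.ρ (-1))) :=
      Low.mul h3 P.lead_a₁_div_ρ
        fun k k' n n' f f' g g' e e' h h' => by unfold Lead at h'; omega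
    refine Sup.mono' (Low.mul (lead_num _) h4 (U := fun k _ f g e => 2 ≤ k ∧
      (k = 2 → f = g ∧ e = 0)) fun k k' n n' f f' g g' e e' h h' => by unfold Lead at h; omega)
      fun k n m h => ⟨h.1, fun hk => Or.inl (h.2 hk)⟩

theorem step_first (ha : P.a₁ ≠ 0) (hν : 1 ≤ P.ν₁)
    (hres : ∀ k k₁ : ℤ, (k : ℝ) * P.nStar + (k₁ : ℝ) * P.n₁ = 0 → k = 0 ∧ k₁ = 0)
    (hR : Rem FirstOrder R) : P.StepsTo 1 0 R SecondOrder := by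
  have hχ := low_generator_first (P := P) hR
  have hF := P.frm_generator (j := 1) hR.1
  have hχ' : Low (fun k _ f g e => 1 ≤ k ∧ f = g ∧ e = 0) (P.generator 1 R) :=
    hχ.mono fun _ _ _ _ _ h => by omega
  have hle := sup_leftover_first hν hR
  have hlie {F : Ser} (hF₀ : d_J₁ F = 0) := P.lie_first (F := F) hν hF₀ hF.d_J₁_eq_zero
  refine P.stepsTo ha hν hres Slow.zero hR (fun _ _ _ h => zero_le_one.trans h.1)
    (fun n m h _ h1 h2 => ?_) (hχ.mono fun _ _ _ _ _ h => by omega) ?_ ?_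
    (fun F h h' => hlie h.d_J₁_eq_zero (h'.mono fun _ _ _ _ _ h => by omega) hχ') hle
    (fun k n m h => h) (fun k n m h h1 h2 => ?_) (fun k n m h => ?_) fun k n m m' h hv hE => ?_
  -- At order `σ` the exponents of `f` and `g` agree, so a term without `f` has no `g` either.
  · have := h.2.1 rfl
    refine ⟨by norm_num, fun _ => ?_⟩
    omega
  · rw [zero_add]
    refine hlie hR.1.d_J₁_eq_zero (hR.2.mono' fun k n m h => ?_) hχ'
    obtain ⟨⟨h1, h2, h3⟩, -⟩ := h
    omega
  · refine hlie (Frm.d_J₁_eq_zero (r := 0) (p := 1) ?_) ?_ hχ'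
    · exact In.add (Frm.mono (In.sub (P.frm_leftover hR.1) (In.part hR.1)) (by norm_num))
        (P.frm_secular hR.1)
    · refine Low.add (Low.sub (hle.mono' fun k n m h => ?_) (Low.part (hR.2.mono'
        fun k n m h => ?_))) ?_
      · omega
      · obtain ⟨⟨h1, h2, h3⟩, -⟩ := h
        omega
      · refine P.sup_secular hR.2 fun n m h h1 h2 => ?_
        have := h.1.2.1 rfl
        simp
        omega
  · have := h.2.2
    have := h.1
    push_cast at h1
    refine ⟨by omega, fun hk => ?_⟩
    omega
  · exact ⟨h.1, fun hk => Or.inl (h.2 hk)⟩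
  · rw [SecondOrder, hv Sym.f (by decide) (by decide), hv Sym.g (by decide) (by decide),
      hv Sym.e (by decide) (by decide)]
    refine ⟨h.1, fun hk => (h.2 hk).imp_right fun h' => ?_⟩
    rw [hE h'.2.2.2.2]
    tauto

end Params

theorem Slow.low {T : Ser} (hT : Slow T) :
    Low (fun k _ f g e => 1 ≤ k ∧ (k < 3 → f = 0 ∧ g = 0 ∧ e = 0)) T :=
  hT.2.mono' fun _ _ _ h => h.1

namespace Params

variable {P : Params} {R T : Ser}

theorem frm_lie_Z₀ {j : ℕ} (hR : Frm (-1) 1 R) :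
    Frm 0 1 (P.leftover j R - part j R + P.secular j R) :=
  In.add (Frm.mono (In.sub (P.frm_leftover hR) (In.part hR)) (by norm_num)) (P.frm_secular hR)

/-- The order does not improve: `{R, χ₂}` returns to `σ²` through the `σ⁻²` part of the bracket.
What improves is the shape of the `σ²`-terms, which become free of `e` and functions of `f + g`. -/
theorem step_second (ha : P.a₁ ≠ 0) (hν : 1 ≤ P.ν₁)
    (hres : ∀ k k₁ : ℤ, (k : ℝ) * P.nStar + (k₁ : ℝ) * P.n₁ = 0 → k = 0 ∧ k₁ = 0)
    (hT : Slow T) (hR : Rem SecondOrder R) : P.StepsTo 2 T R ReducedOrder := by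
  have hχ : Low (fun k n f g e => 2 ≤ k ∧ (f = g ∧ e = 0 ∨
      e = 1 ∧ (f - g = 1 ∨ f - g = -1) ∧ 1 ≤ n)) (P.generator 2 R) := by
    refine P.low_generator hR.2 (fun n m h _ => ?_) fun n m h _ _ => ?_ <;>
    · have := h.1.2 rfl
      refine ⟨by simp, ?_⟩
      omega
  have hF := P.frm_generator (j := 2) hR.1
  have hχ' : Low (fun k _ f g e => 2 ≤ k ∧ (k = 2 → f = g ∧ e = 0 ∨
      e = 1 ∧ (f - g = 1 ∨ f - g = -1))) (P.generator 2 R) :=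
    hχ.mono fun _ _ _ _ _ h => by omega
  have hle := P.low_leftover (j := 2) (R := R) hν
  have hRl : Low (fun k _ f g e => 2 ≤ k ∧ (k = 2 → f = g ∧ e = 0 ∨
      e = 1 ∧ (f - g = 1 ∨ f - g = -1))) R := hR.2.mono' fun k n m h => by
    obtain ⟨⟨h1, h2⟩, -⟩ := h
    omega
  have hlie {F : Ser} (hF₀ : d_J₁ F = 0) := P.lie_second (F := F) hν hF₀ hF.d_J₁_eq_zero
  refine P.stepsTo ha hν hres hT hR (fun _ _ _ h => zero_le_two.trans h.1)
    (fun n m h _ h1 h2 => ?_) (hχ.mono fun _ _ _ _ _ h => by omega) ?_ ?_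
    (fun F h h' => hlie h.d_J₁_eq_zero (h'.mono fun _ _ _ _ _ h => by omega) hχ') hle
    (U := ReducedOrder)
    (fun k n m h => ⟨by push_cast at h; omega, by push_cast at h; omega⟩) (fun k n m h h1 h2 => ?_)
    (fun k n m h => h) fun k n m m' h hv hE => ?_
  -- A term linear in `e` with `f = E₁ = 0` would have `g = ± 1`, against the evenness of `E₁ - g`.
  -- Hence the normal form term at `σ²` contains neither `g` nor `e`.
  · have := h.2 rfl
    refine ⟨by norm_num, fun _ => ?_⟩
    omega
  · rw [map_add]
    refine Low.add ((P.lie_secular (j := 2) hν hT.1.d_J₁_eq_zero hF.d_J₁_eq_zero hT.low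
      (hχ.mono fun _ _ _ _ _ h => h.1)).mono fun _ _ _ _ _ h => by omega) ?_
    exact hlie hR.1.d_J₁_eq_zero hRl hχ'
  · refine hlie (frm_lie_Z₀ hR.1).d_J₁_eq_zero ?_ hχ'
    refine Low.add (Low.sub (hle.mono fun _ _ _ _ _ h => ?_) hRl.part) ?_
    · push_cast at h
      omega
    · refine P.sup_secular hR.2 fun n m h h1 h2 => ?_
      have := h.1.2 rfl
      simp
      omega
  · have := h.1
    push_cast at h1
    exact ⟨by omega, by omega⟩
  · rw [ReducedOrder, hv Sym.f (by decide) (by decide), hv Sym.g (by decide) (by decide),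
      hv Sym.e (by decide) (by decide)]
    exact h

/-- The step of order `j` when `{·, χ}` raises the order in `σ`. -/
theorem stepsTo_orderGE (ha : P.a₁ ≠ 0) (hν : 1 ≤ P.ν₁)
    (hres : ∀ k k₁ : ℤ, (k : ℝ) * P.nStar + (k₁ : ℝ) * P.n₁ = 0 → k = 0 ∧ k₁ = 0)
    {j : ℕ} {S : ℤ → (Fin 2 →₀ ℕ) → (Sym → ℤ) → Prop} (hj : 2 ≤ j)
    (hS : ∀ k n m, S k n m → j ≤ k ∧ (k < 3 → m Sym.f = m Sym.g ∧ m Sym.e = 0))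
    (hT : Slow T) (hR : Rem S R) : P.StepsTo j T R (OrderGE (j + 1)) := by
  have hχ : Low (fun k _ f g e => j ≤ k ∧ (k < 3 → f = g ∧ e = 0)) (P.generator j R) := by
    refine P.low_generator hR.2 (fun n m h _ => ?_) fun n m h _ _ => ?_ <;>
    · have := hS _ _ _ h.1
      omega
  have hF := P.frm_generator (j := j) hR.1
  have hχ' : Low (fun k _ f g e => 2 ≤ k ∧ (k < 3 → f = g ∧ e = 0)) (P.generator j R) :=
    hχ.mono fun _ _ _ _ _ h => by omega
  have hle := P.low_leftover (j := j) (R := R) hν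
  have hRl : Low (fun k _ _ _ _ => j ≤ k) R := hR.2.mono' fun k n m h => (hS _ _ _ h.1).1
  have hlie {F : Ser} (hF₀ : d_J₁ F = 0) {a : ℤ} :=
    P.lie_raises (F := F) (a := a) hν hF₀ hF.d_J₁_eq_zero
  refine P.stepsTo ha hν hres hT hR (U := OrderGE (j + 1)) (fun _ _ _ h => ?_)
    (fun n m h _ h1 h2 => ?_) (hχ.mono fun _ _ _ _ _ h => by omega) ?_ ?_
    (fun F h h' => (hlie h.d_J₁_eq_zero h' hχ').mono fun _ _ _ _ _ h => ?_) hle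
    (fun k n m h => h) (fun k n m h h1 h2 => ?_) (fun k n m h => h) fun k n m m' h _ _ => h
  · have := (hS _ _ _ h).1
    omega
  · have := hS _ _ _ h
    refine ⟨by omega, fun _ => ?_⟩
    omega
  · rw [map_add]
    exact Low.add (P.lie_secular (j := j) hν hT.1.d_J₁_eq_zero hF.d_J₁_eq_zero hT.low
      (hχ.mono fun _ _ _ _ _ h => h.1)) (hlie hR.1.d_J₁_eq_zero hRl hχ')
  · refine hlie (frm_lie_Z₀ hR.1).d_J₁_eq_zero ?_ hχ'
    exact Low.add (Low.sub (hle.mono fun _ _ _ _ _ h => by omega) hRl.part)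
      (P.low_secular.mono fun _ _ _ _ _ h => h.ge)
  · exact (Int.lt_succ _).le.trans h
  · have := (hS _ _ _ h).1
    change (j : ℤ) + 1 ≤ k
    omega

/-- After the second step the `σ²`-terms depend on `x, y` no longer, so this generating function of
order `σ²` meets the hypotheses of `lie_raises`. -/
theorem step_extra (ha : P.a₁ ≠ 0) (hν : 1 ≤ P.ν₁)
    (hres : ∀ k k₁ : ℤ, (k : ℝ) * P.nStar + (k₁ : ℝ) * P.n₁ = 0 → k = 0 ∧ k₁ = 0)
    (hT : Slow T) (hR : Rem ReducedOrder R) : P.StepsTo 2 T R (OrderGE 3) :=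
  stepsTo_orderGE ha hν hres le_rfl
    (fun k n m h => ⟨h.1, fun hk => h.2 (by have := h.1; omega)⟩) hT hR

theorem step_of_three_le (ha : P.a₁ ≠ 0) (hν : 1 ≤ P.ν₁)
    (hres : ∀ k k₁ : ℤ, (k : ℝ) * P.nStar + (k₁ : ℝ) * P.n₁ = 0 → k = 0 ∧ k₁ = 0)
    {j : ℕ} (hj : 3 ≤ j) (hT : Slow T) (hR : Rem (OrderGE j) R) :
    P.StepsTo j T R (OrderGE (j + 1)) :=
  stepsTo_orderGE ha hν hres (by omega)
    (fun k n m (h : (j : ℤ) ≤ k) => ⟨h, fun hk => by omega⟩) hT hR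

end Params

/-! ### The initial remainder -/

theorem In.tauSum {M : Fam} {T : ℕ → PowerSeries Coef}
    (h : ∀ l, In M (HahnSeries.ofPowerSeries ℤ Coef (T l))) :
    In M (HahnSeries.ofPowerSeries ℤ Coef (Params.tauSum T)) :=
  In.ofPowerSeries fun k n => by
    have : MvPowerSeries.coeff n (PowerSeries.coeff k (Params.tauSum T)) =
        ∑ l ∈ Finset.range (n 1 + 1), MvPowerSeries.coeff n (PowerSeries.coeff k (T l)) := by
      exact congrArg (MvPowerSeries.coeff n) (PowerSeries.coeff_mk k _)
    rw [this]
    refine sum_mem fun l _ => ?_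
    rw [← cf_ofPowerSeries_nat]
    exact h l k n

/-- The exponents in the disturbing function: those of order `σ ^ 0` are of a function of `f + g`,
and those of order `σ` of a polynomial of degree at most one in `e cos f`, `e sin f` over such
functions, where the parity of the exponents of `E₁` and `g` differs by `s`. -/
def DisturbingOrder (s k : ℤ) (_ : Fin 2 →₀ ℕ) (m : Sym → ℤ) : Prop :=
  0 ≤ k ∧ m Sym.φ₁ = 0 ∧
    (k = 0 → m Sym.f = m Sym.g ∧ m Sym.e = 0 ∧ 2 ∣ m Sym.E₁ - m Sym.g - s) ∧
    (k = 1 → m Sym.f = m Sym.g ∧ m Sym.e = 0 ∨ m Sym.e = 1 ∧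
      (m Sym.f - m Sym.g = 1 ∨ m Sym.f - m Sym.g = -1) ∧ 2 ∣ m Sym.E₁ - m Sym.g - s)

/-- Real closed forms of parity `p` with the exponents of the disturbing function. -/
def Disturbing (p s : ℤ) (A : PowerSeries Coef) : Prop :=
  Frm 0 p (HahnSeries.ofPowerSeries ℤ Coef A) ∧
    Sup (DisturbingOrder s) (HahnSeries.ofPowerSeries ℤ Coef A)

namespace Disturbing

variable {p p' p'' s s' s'' : ℤ} {A B : PowerSeries Coef}

theorem add (hA : Disturbing p s A) (hB : Disturbing p s B) : Disturbing p s (A + B) := by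
  rw [Disturbing, map_add]
  exact ⟨hA.1.add hB.1, hA.2.add hB.2⟩

theorem neg (hA : Disturbing p s A) : Disturbing p s (-A) := by
  rw [Disturbing, map_neg]
  exact ⟨hA.1.neg, hA.2.neg⟩

theorem sub (hA : Disturbing p s A) (hB : Disturbing p s B) : Disturbing p s (A - B) := by
  rw [sub_eq_add_neg]
  exact hA.add hB.neg

/-- At `σ` one of the two factors is taken at `σ⁰`, where it is free of `e`. The degree in `x, y`
stays at most one and the parities `s` add. -/
theorem mul (hA : Disturbing p s A) (hB : Disturbing p' s' B) (hp : p * p' = p'' := by norm_num)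
    (hs : 2 ∣ s + s' - s'' := by norm_num) : Disturbing p'' s'' (A * B) := by
  rw [Disturbing, map_mul]
  refine ⟨hA.1.mul' hB.1 le_rfl hp, hA.2.mul hB.2 fun k k' n n' m m' h h' => ?_⟩
  simp only [DisturbingOrder, Pi.add_apply] at *
  omega

theorem mul_even (hA : Disturbing 1 0 A) (hB : Disturbing 1 0 B) : Disturbing 1 0 (A * B) :=
  hA.mul hB

theorem cstP {c : Expr} (hc : c ∈ frm 0 p) (h : c ∈ supp fun m => m Sym.φ₁ = 0 ∧
    m Sym.f = m Sym.g ∧ m Sym.e = 0 ∧ 2 ∣ m Sym.E₁ - m Sym.g - s) :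
    Disturbing p s (ClosedForm.cstP c) := by
  rw [Disturbing, ClosedForm.cstP, HahnSeries.ofPowerSeries_C]
  exact ⟨In.cst hc, In.cst (supp_mono (fun m hm => ⟨le_rfl, hm.1, by tauto, by norm_num⟩) h)⟩

theorem num (x : ℝ) : Disturbing 1 0 (ClosedForm.cstP (ClosedForm.num x)) :=
  cstP (num_mem_frm x) (single_mem_supp (by simp))

theorem one : Disturbing 1 0 1 := by
  have := num 1
  rwa [ClosedForm.cstP, show ClosedForm.num 1 = 1 from rfl, map_one, map_one] at this

theorem pow (hA : Disturbing 1 0 A) (l : ℕ) : Disturbing 1 0 (A ^ l) := by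
  induction l with
  | zero => rw [pow_zero]; exact one
  | succ l ih => rw [pow_succ]; exact ih.mul hA

theorem two_mul (hA : Disturbing 1 0 A) : Disturbing 1 0 (2 * A) := by
  rw [_root_.two_mul]
  exact hA.add hA

theorem X_mul {c : Expr} (hc : c ∈ frm 0 p) (h : c ∈ supp fun m => m Sym.φ₁ = 0 ∧
    (m Sym.f = m Sym.g ∧ m Sym.e = 0 ∨ m Sym.e = 1 ∧
      (m Sym.f - m Sym.g = 1 ∨ m Sym.f - m Sym.g = -1) ∧ 2 ∣ m Sym.E₁ - m Sym.g - s)) {k : ℕ}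
    (hk : 1 ≤ k) : Disturbing p s (PowerSeries.X ^ k * ClosedForm.cstP c) := by
  rw [Disturbing, map_mul, HahnSeries.ofPowerSeries_X_pow, ClosedForm.cstP,
    HahnSeries.ofPowerSeries_C]
  refine ⟨Frm.mul' (frm_sig k) (frm_cst hc) le_rfl (one_mul p), ?_⟩
  refine Sup.mul (In.sig (a := k) (M := suppFam fun i _ m => i = k ∧ m = 0)
    (one_mem_supp ⟨rfl, rfl⟩)) (In.cst (M := suppFam fun i _ m => i = 0 ∧ m Sym.φ₁ = 0 ∧
    (m Sym.f = m Sym.g ∧ m Sym.e = 0 ∨ m Sym.e = 1 ∧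
      (m Sym.f - m Sym.g = 1 ∨ m Sym.f - m Sym.g = -1) ∧ 2 ∣ m Sym.E₁ - m Sym.g - s)) ?_) ?_
  · exact supp_mono (fun m hm => ⟨rfl, hm⟩) h
  · rintro i i' n n' m m' ⟨rfl, rfl⟩ ⟨rfl, h1, h2⟩
    rw [zero_add]
    exact ⟨by omega, h1, by omega, fun _ => h2⟩

theorem C {C : Coef} (h : ∀ n, MvPowerSeries.coeff n C ∈ frm 0 1)
    (h' : ∀ n, MvPowerSeries.coeff n C ∈ supp fun m => m = 0) :
    Disturbing 1 0 (PowerSeries.C C) := by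
  rw [Disturbing, HahnSeries.ofPowerSeries_C, HahnSeries.C_apply]
  refine ⟨In.single h, In.single fun n => supp_mono (fun m hm => ?_) (h' n)⟩
  rw [hm]
  simp [DisturbingOrder]

theorem C_X (i : Fin 2) : Disturbing 1 0 (PowerSeries.C (MvPowerSeries.X i)) := by
  classical
  refine C (fun n => ?_) fun n => ?_ <;>
  · rw [MvPowerSeries.coeff_X]
    split_ifs
    · first | exact one_mem_frm | exact one_mem_supp rfl
    · exact zero_mem _

theorem tauSum {T : ℕ → PowerSeries Coef} (h : ∀ l, Disturbing p s (T l)) :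
    Disturbing p s (Params.tauSum T) :=
  ⟨In.tauSum fun l => (h l).1, In.tauSum fun l => (h l).2⟩

theorem muP : Disturbing 1 0 Params.muP := by
  have h := X_mul (s := 0) (c := 1) (k := 1) one_mem_frm (one_mem_supp (by simp)) le_rfl
  rw [ClosedForm.cstP, map_one, map_one, mul_one, pow_one] at h
  exact h.mul_even (C_X 0)

variable (P : Params)

theorem invLP : Disturbing 1 0 P.invLP := by
  classical
  refine ⟨P.frm_invL, In.ofPowerSeries fun k n => ?_⟩
  rw [Params.invLP, PowerSeries.coeff_mk, MvPowerSeries.coeff_C]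
  split_ifs
  · rw [ClosedForm.num, sym, AddMonoidAlgebra.single_mul_single]
    exact single_mem_supp (by simp [DisturbingOrder])
  · exact zero_mem _

theorem oneSubP (hν : 1 ≤ P.ν₁) : Disturbing 1 0 P.oneSubP := by
  refine one.sub (X_mul (num_mul_mem_frm _ (cosA_mem_frm _ _ _ _)) ?_ hν)
  refine num_mul_mem_supp _ (add_mem (single_mem_supp ?_) (single_mem_supp ?_)) <;> simp [angle]

/-- The factor `1 + σ e cos f` is the only source of `e` in the disturbing function, and it supplies
one power of `σ` for each power of `e`. -/
theorem invR : Disturbing 1 0 P.invR := by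
  refine (((num _).mul_even ((invLP P).pow 2)).mul_even (one.add ?_)).mul_even
    (one.add (X_mul ?_ ?_ one_le_two))
  · rw [← pow_one PowerSeries.X]
    refine X_mul (mul_mem_frm_one (sym_e_mem _) (cosA_mem_frm _ _ _ _)) ?_ le_rfl
    rw [cosA, mul_add, sym, AddMonoidAlgebra.single_mul_single, AddMonoidAlgebra.single_mul_single]
    refine add_mem (single_mem_supp ?_) (single_mem_supp ?_) <;> simp [angle]
  · exact sub_mem (sym_η_mem _) one_mem_frm
  · exact sub_mem (single_mem_supp (by simp)) (one_mem_supp (by simp))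

/-- At `σ⁰` this is bilinear in `cos E₁, sin E₁` and `cos θ, sin θ`. Each factor is odd in its own
angle (`s = 1`), so the exponents of `E₁` and `g` have the same parity in the product. -/
theorem r₁R (hν : 1 ≤ P.ν₁) : Disturbing 1 0 P.r₁R := by
  have hcos (s₃ : ℤ) : cosA 0 0 s₃ 0 ∈ supp fun m => m Sym.φ₁ = 0 ∧ m Sym.f = 0 ∧ m Sym.g = 0 ∧
      m Sym.e = 0 ∧ m Sym.E₁ = 0 := by
    refine add_mem (single_mem_supp ?_) (single_mem_supp ?_) <;> simp [angle]
  have hsin (s₃ : ℤ) : sinA 0 0 s₃ 0 ∈ supp fun m => m Sym.φ₁ = 0 ∧ m Sym.f = 0 ∧ m Sym.g = 0 ∧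
      m Sym.e = 0 ∧ m Sym.E₁ = 0 := by
    refine sub_mem (single_mem_supp ?_) (single_mem_supp ?_) <;> simp [angle]
  have hcos' : cosA 1 1 0 0 ∈ supp fun m => m Sym.φ₁ = 0 ∧ m Sym.f = m Sym.g ∧
      m Sym.e = 0 ∧ 2 ∣ m Sym.E₁ - m Sym.g - 1 := by
    refine add_mem (single_mem_supp ?_) (single_mem_supp ?_) <;> simp [angle]
  have hsin' : sinA 1 1 0 0 ∈ supp fun m => m Sym.φ₁ = 0 ∧ m Sym.f = m Sym.g ∧
      m Sym.e = 0 ∧ 2 ∣ m Sym.E₁ - m Sym.g - 1 := by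
    refine sub_mem (single_mem_supp ?_) (single_mem_supp ?_) <;> simp [angle]
  have hιc : sym Sym.ιc 1 ∈ supp fun m => m Sym.φ₁ = 0 ∧ m Sym.f = 0 ∧ m Sym.g = 0 ∧
      m Sym.e = 0 ∧ m Sym.E₁ = 0 := single_mem_supp (by simp)
  have hm {a b : Expr} (ha : a ∈ supp fun m => m Sym.φ₁ = 0 ∧ m Sym.f = 0 ∧ m Sym.g = 0 ∧
      m Sym.e = 0 ∧ m Sym.E₁ = 0) (hb : b ∈ supp fun m => m Sym.φ₁ = 0 ∧ m Sym.f = m Sym.g ∧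
      m Sym.e = 0 ∧ 2 ∣ m Sym.E₁ - m Sym.g - 1) : a * b ∈ supp fun m => m Sym.φ₁ = 0 ∧
      m Sym.f = m Sym.g ∧ m Sym.e = 0 ∧ 2 ∣ m Sym.E₁ - m Sym.g - 1 :=
    mul_mem_supp ha hb fun m m' h h' => by
      simp only [Pi.add_apply]
      omega
  have hic : sym Sym.ιc 1 ∈ frm 0 1 := sym_ιc_mem zero_le_one
  refine (num _).mul_even (add (mul (p := 1) (s := 1) (p' := 1) (s' := 1) (sub ?_ ?_) (cstP ?_ ?_))
    (mul (p := -1) (s := 1) (p' := -1) (s' := 1)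
      (mul (p := 1) (s := 0) (p' := -1) (s' := 1) (one.add ?_) ?_) (cstP ?_ ?_)))
  · refine cstP (cosA_mem_frm _ _ _ _) ?_
    refine add_mem (single_mem_supp ?_) (single_mem_supp ?_) <;> simp [angle]
  -- The offset `e₁` of the ellipse breaks the parity, but it comes with `σ^ν₁` and without `e`,
  -- where no parity is required.
  · exact X_mul (num_mem_frm _) (single_mem_supp (by simp)) hν
  · refine sub_mem (mul_mem_frm_one (cosA_mem_frm _ _ _ _) (cosA_mem_frm _ _ _ _)) ?_
    have := mul_mem_frm_zero (mul_mem_frm_zero (sinA_mem_frm 0 0 1 0) (sinA_mem_frm 1 1 0 0)) hic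
    simpa using this
  · refine sub_mem (hm (hcos 1) hcos') ?_
    rw [mul_right_comm, mul_comm (sinA 0 0 1 0), mul_assoc]
    exact hm hιc (hm (hsin 1) hsin')
  · exact X_mul (num_mem_frm _) (single_mem_supp (by simp)) (by omega)
  · refine cstP (sinA_mem_frm _ _ _ _) ?_
    refine sub_mem (single_mem_supp ?_) (single_mem_supp ?_) <;> simp [angle]
  · refine add_mem ?_ ?_
    · rw [mul_comm]
      exact mul_mem_frm_neg (cosA_mem_frm _ _ _ _) (sinA_mem_frm _ _ _ _)
    · rw [mul_comm]
      exact mul_mem_frm_neg hic (mul_mem_frm_neg (cosA_mem_frm _ _ _ _) (sinA_mem_frm _ _ _ _))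
  · refine add_mem (hm (hsin 1) hcos') ?_
    rw [mul_right_comm, mul_comm (cosA 0 0 1 0), mul_assoc]
    exact hm hιc (hm (hcos 1) hsin')

theorem ratioDot (hν : 1 ≤ P.ν₁) : Disturbing 1 0 P.ratioDot :=
  ((C_X 1).mul_even (r₁R P hν)).mul_even (invR P)

theorem ratioSq (hν : 1 ≤ P.ν₁) : Disturbing 1 0 P.ratioSq :=
  pow ((((C_X 1).mul_even (num _)).mul_even (oneSubP P hν)).mul_even (invR P)) 2

theorem disturbing (hν : 1 ≤ P.ν₁) : Disturbing 1 0 P.disturbing := by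
  have h1 : Disturbing 1 0 (1 - Params.muP) := one.sub muP
  refine mul_even ((num _).mul_even (invR P)).neg (add (add ?_ (tauSum fun l => ?_))
    (tauSum fun l => ?_))
  · classical
    refine ⟨In.ofPowerSeries fun k n => ?_, In.ofPowerSeries fun k n => ?_⟩ <;>
    · rw [PowerSeries.coeff_mk, MvPowerSeries.coeff_X_pow]
      split_ifs
      · first | exact one_mem_frm | exact one_mem_supp (by simp [DisturbingOrder])
      · exact zero_mem _
  · exact ((muP.pow _).mul_even (num _)).mul_even
      (((ratioDot P hν).two_mul.add (muP.mul_even (ratioSq P hν))).pow _)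
  · refine ((h1.pow _).mul_even (num _)).mul_even ((add ?_ (h1.mul_even (ratioSq P hν))).pow _)
    rw [neg_mul]
    exact (ratioDot P hν).two_mul.neg

end Disturbing

namespace Params

variable (P : Params)

theorem sup_muP : Sup (fun k n m => k = 1 ∧ 1 ≤ n 0 ∧ m = 0)
    (HahnSeries.ofPowerSeries ℤ Coef muP) := by
  classical
  rw [muP, map_mul, HahnSeries.ofPowerSeries_X, HahnSeries.ofPowerSeries_C, HahnSeries.C_apply,
    HahnSeries.single_mul_single]
  refine In.single fun n => ?_
  rw [one_mul, MvPowerSeries.coeff_X]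
  split_ifs with h
  · exact one_mem_supp ⟨by simp, by simp [h], rfl⟩
  · exact zero_mem _

/-- The Keplerian part has no angles and starts at `σ`. The disturbing function is multiplied by `σ
μ`, which moves its orders `σ⁰` and `σ` to `σ` and `σ²` and gives angular terms their factor `μ`.
The unit factor adds no `f`, `g` or `e`. -/
theorem rem_ofPowerSeries (hν : 1 ≤ P.ν₁) : Rem FirstOrder (HahnSeries.ofPowerSeries ℤ Coef
    ((P.keplerP + muP * P.disturbing) * (cstP (num P.a₁ * sym Sym.ρ (-1)) * P.oneSubP))) := by
  classical
  have hd := Disturbing.disturbing P hν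
  have hu : HahnSeries.ofPowerSeries ℤ Coef (cstP (num P.a₁ * sym Sym.ρ (-1)) * P.oneSubP) =
      P.unitFactor := by
    rw [unitFactor, oneSubP, map_mul, map_sub, map_mul, map_one, HahnSeries.ofPowerSeries_X_pow]
    simp only [cstP, HahnSeries.ofPowerSeries_C]
    rfl
  rw [map_mul, hu, map_add, map_mul]
  have hk : Frm 0 1 (HahnSeries.ofPowerSeries ℤ Coef P.keplerP) := by
    refine In.ofPowerSeries fun k n => ?_
    rw [keplerP, PowerSeries.coeff_mk]
    split_ifs
    · rw [map_zero]; exact zero_mem _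
    · rw [MvPowerSeries.coeff_C]
      split_ifs
      · exact num_mul_mem_frm _ (sym_δL_mem (by positivity))
      · exact zero_mem _
  have hk' : Sup (fun k n m => FirstOrder k n m ∧ m Sym.φ₁ = 0)
      (HahnSeries.ofPowerSeries ℤ Coef P.keplerP) := by
    refine In.ofPowerSeries fun k n => ?_
    rw [keplerP, PowerSeries.coeff_mk]
    split_ifs with h0
    · rw [map_zero]; exact zero_mem _
    · rw [MvPowerSeries.coeff_C]
      split_ifs
      · refine num_mul_mem_supp _ (single_mem_supp ⟨⟨by omega, ?_, ?_⟩, ?_⟩) <;> simp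
      · exact zero_mem _
  refine ⟨Frm.mul' (In.add hk (Disturbing.muP.1.mul_one' hd.1)) P.frm_unitFactor, ?_⟩
  have htail : Sup (fun k _ m => 0 ≤ k ∧ m Sym.φ₁ = 0 ∧ m Sym.e = 0 ∧ m Sym.f = 0 ∧ m Sym.g = 0 ∧
      (k = 0 → m Sym.E₁ = 0)) (1 - sig P.ν₁ * cst (num P.e₁ * cosA 0 0 0 1)) := by
    refine In.sub (In.sig (a := 0) (one_mem_supp (by simp))) (Sup.mul
      (S := fun k _ m => k = P.ν₁ ∧ m = 0) (T := fun k _ m => k = 0 ∧ m Sym.φ₁ = 0 ∧ m Sym.e = 0 ∧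
        m Sym.f = 0 ∧ m Sym.g = 0) (In.sig (one_mem_supp ⟨rfl, rfl⟩)) (In.cst ?_) ?_)
    · refine num_mul_mem_supp _ (add_mem (single_mem_supp ?_) (single_mem_supp ?_)) <;> simp [angle]
    · rintro k k' n n' m m' ⟨rfl, rfl⟩ h
      rw [zero_add]
      omega
  refine Sup.mul (S := fun k n m => FirstOrder k n m ∧ m Sym.φ₁ = 0)
    (In.add hk' (sup_muP.mul hd.2 ?_)) (Sup.mul (S := fun k _ m => k = 0 ∧ m Sym.φ₁ = 0 ∧
      m Sym.e = 0 ∧ m Sym.f = 0 ∧ m Sym.g = 0 ∧ m Sym.E₁ = 0) (U := fun k _ m => 0 ≤ k ∧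
      m Sym.φ₁ = 0 ∧ m Sym.e = 0 ∧ m Sym.f = 0 ∧ m Sym.g = 0 ∧ (k = 0 → m Sym.E₁ = 0))
      (In.cst ?_) htail ?_) ?_
  · rintro k k' n n' m m' ⟨rfl, hn, rfl⟩ h
    simp only [DisturbingOrder, FirstOrder, zero_add, Finsupp.add_apply] at *
    omega
  · exact num_mul_mem_supp _ (single_mem_supp (by simp))
  · intro k k' n n' m m' h h'
    simp only [Pi.add_apply]
    omega
  · intro k k' n n' m m' h h'
    simp only [FirstOrder, Pi.add_apply, Finsupp.add_apply] at *
    omega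

end Params

/-! ### Composition of all the steps. -/

theorem Rem.noPhi {S : ℤ → (Fin 2 →₀ ℕ) → (Sym → ℤ) → Prop} {R : Ser} (h : Rem S R) :
    Sup (fun _ _ m => m Sym.φ₁ = 0) R := h.2.mono' fun _ _ _ h => h.2

theorem Rem.isRemainder {S : ℤ → (Fin 2 →₀ ℕ) → (Sym → ℤ) → Prop} {R : Ser} (h : Rem S R) {j : ℕ}
    (hS : ∀ k n m, S k n m → j ≤ k) : IsRemainder j R :=
  isRemainder_of h.1 (h.2.mono' fun k n m hm => ⟨hS k n m hm.1, hm.2⟩)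

namespace Params

variable {P : Params}

/-- The invariants of the loop are carried in a subtype, so that one choice of a successor for every
state can be iterated. Index `i` stands for the state after step `i + 3`. -/
theorem exists_remainders (ha : P.a₁ ≠ 0) (hν : 1 ≤ P.ν₁)
    (hres : ∀ k k₁ : ℤ, (k : ℝ) * P.nStar + (k₁ : ℝ) * P.n₁ = 0 → k = 0 ∧ k₁ = 0)
    {T R : Ser} (hT : Slow T) (hR : Rem (OrderGE 4) R) :
    ∃ T' R' : ℕ → Ser, T' 0 = T ∧ R' 0 = R ∧ ∀ i : ℕ, Rem (OrderGE (i + 4)) (R' i) ∧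
      T' (i + 1) = T' i + P.secular (i + 4) (R' i) ∧
      P.IsStep (i + 4) (P.Z₀ + (T' i + R' i)) (R' i) (P.generator (i + 4) (R' i))
        (P.secular (i + 4) (R' i)) (P.Z₀ + (T' (i + 1) + R' (i + 1))) := by
  have step (i : ℕ) (s : {p : Ser × Ser // Slow p.1 ∧ Rem (OrderGE (i + 4)) p.2}) :
      ∃ s' : {p : Ser × Ser // Slow p.1 ∧ Rem (OrderGE ((i + 1 : ℕ) + 4)) p.2},
        s'.1.1 = s.1.1 + P.secular (i + 4) s.1.2 ∧
        P.IsStep (i + 4) (P.Z₀ + (s.1.1 + s.1.2)) s.1.2 (P.generator (i + 4) s.1.2)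
          (P.secular (i + 4) s.1.2) (P.Z₀ + (s'.1.1 + s'.1.2)) := by
    obtain ⟨hZ, R', hR', h⟩ := step_of_three_le ha hν hres (j := i + 4) (by omega) s.2.1
      (by push_cast; exact s.2.2)
    refine ⟨⟨(s.1.1 + P.secular (i + 4) s.1.2, R'), s.2.1.add hZ, ?_⟩, rfl, h⟩
    rw [show ((i + 1 : ℕ) : ℤ) + 4 = ((i + 4 : ℕ) : ℤ) + 1 by push_cast; ring]
    exact hR'
  choose next hnext using step
  let st (i : ℕ) : {p : Ser × Ser // Slow p.1 ∧ Rem (OrderGE (i + 4)) p.2} :=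
    Nat.rec ⟨(T, R), hT, by simpa using hR⟩ next i
  exact ⟨fun i => (st i).1.1, fun i => (st i).1.2, rfl, rfl, fun i => ⟨(st i).2.2, hnext i (st i)⟩⟩

theorem exists_normalization (ha : P.a₁ ≠ 0) (hν : 1 ≤ P.ν₁)
    (hres : ∀ k k₁ : ℤ, (k : ℝ) * P.nStar + (k₁ : ℝ) * P.n₁ = 0 → k = 0 ∧ k₁ = 0)
    {R₀ : Ser} (hR₀ : Rem FirstOrder R₀) (hH₀ : P.H₀ = P.Z₀ + R₀) :
    ∃ (H R χ Z : ℕ → Ser) (HII RII χII ZII : Ser),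
      (H 0 = P.H₀ ∧ H 0 = P.Z₀ + R 0 ∧ IsRemainder 1 (R 0)) ∧
      (P.IsStep 1 (H 0) (R 0) (χ 1) (Z 1) (H 1) ∧
        H 1 = P.Z₀ + Z 1 + R 1 ∧ IsSecular 1 (Z 1) ∧ IsRemainder 2 (R 1)) ∧
      (P.IsStep 2 (H 1) (R 1) (χ 2) (Z 2) (H 2) ∧
        H 2 = P.Z₀ + Z 1 + Z 2 + R 2 ∧ IsSecular 2 (Z 2) ∧ IsRemainder 2 (R 2)) ∧
      (P.IsStep 2 (H 2) (R 2) χII ZII HII ∧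
        HII = P.Z₀ + Z 1 + Z 2 + ZII + RII ∧ IsSecular 2 ZII ∧ IsRemainder 3 RII) ∧
      (P.IsStep 3 HII RII (χ 3) (Z 3) (H 3) ∧
        H 3 = P.Z₀ + Z 1 + Z 2 + ZII + Z 3 + R 3 ∧ IsSecular 3 (Z 3) ∧ IsRemainder 4 (R 3)) ∧
      (∀ j : ℕ, 4 ≤ j →
        P.IsStep j (H (j - 1)) (R (j - 1)) (χ j) (Z j) (H j) ∧
        H j = P.Z₀ + ∑ l ∈ Finset.Icc 1 j, Z l + ZII + R j ∧
        IsSecular j (Z j) ∧ IsRemainder (j + 1) (R j)) := by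
  obtain ⟨hZ₁, R₁, hR₁, h₁⟩ := step_first ha hν hres hR₀
  obtain ⟨hZ₂, R₂, hR₂, h₂⟩ := step_second ha hν hres (Slow.zero.add hZ₁) hR₁
  obtain ⟨hZII, RII, hRII, hII⟩ := step_extra ha hν hres ((Slow.zero.add hZ₁).add hZ₂) hR₂
  obtain ⟨hZ₃, R₃, hR₃, h₃⟩ := step_of_three_le ha hν hres (j := 3) le_rfl
    (((Slow.zero.add hZ₁).add hZ₂).add hZII) hRII
  obtain ⟨T, R, hT0, rfl, h⟩ := exists_remainders ha hν hres
    ((((Slow.zero.add hZ₁).add hZ₂).add hZII).add hZ₃) hR₃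
  let Z : ℕ → Ser := fun
    | 0 => 0
    | 1 => P.secular 1 R₀
    | 2 => P.secular 2 R₁
    | 3 => P.secular 3 RII
    | i + 4 => P.secular (i + 4) (R i)
  -- The accumulated normal form after step `i + 3` consists of the regular terms and the one extra
  -- term of order `σ²`, which has no place in the sequence `Z`.
  have hT (i : ℕ) : T i = ∑ l ∈ Finset.Icc 1 (i + 3), Z l + P.secular 2 R₂ := by
    induction i with
    | zero =>
      rw [hT0]
      simp only [Z, Finset.sum_Icc_succ_top, zero_add, Nat.reduceAdd, Nat.reduceLeDiff,
        Finset.Icc_self, Finset.sum_singleton]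
      exact add_right_comm _ _ _
    | succ i ih =>
      have hs := Finset.sum_Icc_succ_top (Nat.le_add_left 1 (i + 3)) Z
      rw [(h i).2.1, ih, show i + 1 + 3 = i + 3 + 1 by ring, hs]
      exact add_right_comm (G := Ser) _ _ _
  have sec {S : ℤ → (Fin 2 →₀ ℕ) → (Sym → ℤ) → Prop} {X : Ser} (j : ℕ) (hX : Rem S X) :
      IsSecular j (P.secular j X) := P.isSecular_secular hX.1 hX.noPhi
  refine ⟨fun
    | 0 => P.Z₀ + (0 + R₀)
    | 1 => P.Z₀ + (0 + P.secular 1 R₀ + R₁)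
    | 2 => P.Z₀ + (0 + P.secular 1 R₀ + P.secular 2 R₁ + R₂)
    | i + 3 => P.Z₀ + (T i + R i), fun
    | 0 => R₀
    | 1 => R₁
    | 2 => R₂
    | i + 3 => R i, fun
    | 0 => 0
    | 1 => P.generator 1 R₀
    | 2 => P.generator 2 R₁
    | 3 => P.generator 3 RII
    | i + 4 => P.generator (i + 4) (R i), Z,
    P.Z₀ + (0 + P.secular 1 R₀ + P.secular 2 R₁ + P.secular 2 R₂ + RII), RII, P.generator 2 R₂,
    P.secular 2 R₂, ⟨?_, ?_, ?_⟩, ⟨h₁, ?_, sec 1 hR₀, ?_⟩, ⟨h₂, ?_, sec 2 hR₁, ?_⟩,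
    ⟨hII, ?_, sec 2 hR₂, ?_⟩, ⟨?_, ?_, sec 3 hRII, ?_⟩, fun j hj => ?_⟩
  · rw [hH₀, zero_add]
  · rw [zero_add]
  · exact hR₀.isRemainder fun _ _ _ h => h.1
  · simp only [Z]; abel
  · exact hR₁.isRemainder fun _ _ _ h => h.1
  · simp only [Z]; abel
  · exact hR₂.isRemainder fun _ _ _ h => h.1
  · simp only [Z]; abel
  · exact hRII.isRemainder fun _ _ _ h => h
  · rw [← hT0] at h₃
    exact h₃
  · simp only [Z, hT0]; abel
  · exact (h 0).1.isRemainder fun _ _ _ h => h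
  · obtain ⟨i, rfl⟩ : ∃ i, j = i + 4 := ⟨j - 4, by omega⟩
    refine ⟨(h i).2.2, ?_, sec _ (h i).1, ?_⟩
    · change P.Z₀ + (T (i + 1) + R (i + 1)) = _
      rw [hT]
      simp only [add_assoc]
    · refine (h (i + 1)).1.isRemainder fun k _ _ (h : ((i + 1 : ℕ) : ℤ) + 4 ≤ k) => ?_
      omega

end Params

end ClosedForm

end

open ClosedForm in
theorem mainTheorem3 (P : Params) (hGM : 0 < P.GM) (haStar : 0 < P.aStar) (ha₁ : 0 < P.a₁)
    (he₁ : 0 ≤ P.e₁) (he₁' : P.e₁ < 1) (hν₁ : 1 ≤ P.ν₁)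
    (hres : ∀ k k₁ : ℤ, (k : ℝ) * P.nStar + (k₁ : ℝ) * P.n₁ = 0 → k = 0 ∧ k₁ = 0) :
    ∃ (H R χ Z : ℕ → Ser) (HII RII χII ZII : Ser),
      -- the initial Hamiltonian and the first two steps
      (H 0 = P.H₀ ∧ H 0 = P.Z₀ + R 0 ∧ IsRemainder 1 (R 0)) ∧
      (P.IsStep 1 (H 0) (R 0) (χ 1) (Z 1) (H 1) ∧
        H 1 = P.Z₀ + Z 1 + R 1 ∧ IsSecular 1 (Z 1) ∧ IsRemainder 2 (R 1)) ∧
      (P.IsStep 2 (H 1) (R 1) (χ 2) (Z 2) (H 2) ∧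
        H 2 = P.Z₀ + Z 1 + Z 2 + R 2 ∧ IsSecular 2 (Z 2) ∧ IsRemainder 2 (R 2)) ∧
      -- the extra step
      (P.IsStep 2 (H 2) (R 2) χII ZII HII ∧
        HII = P.Z₀ + Z 1 + Z 2 + ZII + RII ∧ IsSecular 2 ZII ∧ IsRemainder 3 RII) ∧
      -- the loop restarts
      (P.IsStep 3 HII RII (χ 3) (Z 3) (H 3) ∧
        H 3 = P.Z₀ + Z 1 + Z 2 + ZII + Z 3 + R 3 ∧ IsSecular 3 (Z 3) ∧ IsRemainder 4 (R 3)) ∧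
      (∀ j : ℕ, 4 ≤ j →
        P.IsStep j (H (j - 1)) (R (j - 1)) (χ j) (Z j) (H j) ∧
        H j = P.Z₀ + ∑ l ∈ Finset.Icc 1 j, Z l + ZII + R j ∧
        IsSecular j (Z j) ∧ IsRemainder (j + 1) (R j)) :=
  Params.exists_normalization ha₁.ne' hν₁ hres (P.rem_ofPowerSeries hν₁) rfl
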